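/- Fix $n\ge 1$ and a weight $\omega=(\omega_1,\dots,\omega_n)\in\mathbb R_{>0}^n$. *2-colored trees.* A tree is a planar rooted tree in which every vertex has at least two inputs; the leaves and the root are (external) edges. A cut is a set of edges and vertices containing exactly one element of each path from a leaf to the root; the part of the tree above the cut is blue, the part below it is red. A 2-colored tree is a tree with a cut. The face order $S\subset T$ means that $T$ is obtained from $S$ by a sequence of contractions of monochrome edges and moves of the cut from a family of edges to an adjacent vertex. (When the cut meets every input edge of a red vertex in that edge or at its upper end, it may be moved down to this vertex, the input edges whose upper end is in the cut being contracted simultaneously.) Let $\mathrm{CT}_n$ be the poset of 2-colored trees with $n$ leaves and its augmentation by a global minimum $\emptyset_n$. A 2-colored atomic tree is a 2-colored binary tree whose cut consists of edges only. The Tamari-type order on the set $\mathrm{CMT}_n$ of 2-colored atomic trees with $n$ leaves is generated by the relations $s\prec t$ of three kinds, applied anywhere in the tree: (i) two adjacent blue vertices are rotated from left to right, $((t_1t_2)t_3)\prec(t_1(t_2t_3))$; (ii) two adjacent red vertices are rotated in the same way; (iii) the cut is moved from the edge just below a blue vertex to the two edges just above it, and the vertex becomes red. *The polytope.* For $t\in\mathrm{CMT}_n$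 order the $n-1$ vertices from left to right, let $\alpha_i$ and $\beta_i$ be the sums of the weights of the leaves above the left and the right input of the $i$-th vertex, and let $M(t,\omega)\in\mathbb R^{n-1}$ be the point with $i$-th coordinate $\alpha_i\beta_i$ if the $i$-th vertex is blue and $2\alpha_i\beta_i$ if it is red. The Forcey–Loday realization is $\mathrm J_\omega=\operatorname{conv}\{M(t,\omega)\mid t\in\mathrm{CMT}_n\}\subset\mathbb R^{n-1}$. *Orientations.* A vector $\vec v\in\mathbb R^{n-1}$ is a good orientation vector if $v_i\ge 2v_{i+1}$ for $1\le i\le n-2$ and $v_{n-1}>0$ (no condition if $n=1$). **Statement.** For every good orientation vector $\vec v\in\mathbb R^{n-1}$, the pair $(\mathrm J_\omega,\vec v)$ is a well-oriented realization of the multiplihedron, that is: 1. $\mathrm J_\omega$ is a polytope of dimension $n-1$, and there is an isomorphism from the lattice $(\mathrm{CT}_n,\subset)$ of 2-colored trees to the face lattice of $\mathrm J_\omega$ (including the empty face) that sends each $t\in\mathrm{CMT}_n$ to the vertex $\{M(t,\omega)\}$; 2. $(\mathrm J_\omega,\vec v)$ is positively oriented: for every $z\in\mathrm J_\omega$, the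 vector $\vec v$ is not perpendicular to any edge of $\mathrm J_\omega\cap(2z-\mathrm J_\omega)$; 3. $\vec v$ induces the Tamari-type order on the vertices: for $s,t\in\mathrm{CMT}_n$ one has $s\le t$ if and only if there is a (possibly trivial) path of edges of $\mathrm J_\omega$ from $M(s,\omega)$ to $M(t,\omega)$ along which the scalar product with $\vec v$ strictly increases. -/

import Mathlib

/-! ### 2-colored planar rooted trees -/

/-- Planar rooted trees: a single edge (`leaf`), or a root vertex carrying an ordered list of
subtrees. The edges of the tree are the root edges of its subtrees. -/
inductive PlaneTree : Type
  | leaf : PlaneTree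
  | node (children : List PlaneTree) : PlaneTree

namespace PlaneTree

/-- The number of leaves. -/
def leaves : PlaneTree → ℕ
  | leaf => 1
  | node cs => (cs.map leaves).sum

/-- Every vertex has at least two inputs. -/
inductive Reduced : PlaneTree → Prop
  | leaf : Reduced leaf
  | node (cs : List PlaneTree) (h : 2 ≤ cs.length) (hcs : ∀ c ∈ cs, Reduced c) :
      Reduced (node cs)

/-- The contraction of one edge, in a family of trees attached to a common vertex below. The
contracted edge either joins that common vertex to the root vertex of one of the trees (`edge`),
or lies inside one of the trees (`inside`). -/
inductive Contraction : List PlaneTree → List PlaneTree → Prop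
  | edge (l cs r : List PlaneTree) : Contraction (l ++ node cs :: r) (l ++ cs ++ r)
  | inside (l r : List PlaneTree) {cs ds : List PlaneTree} (h : Contraction cs ds) :
      Contraction (l ++ node cs :: r) (l ++ node ds :: r)

end PlaneTree

/-- Planar rooted trees together with a cut, that is, a choice of edges and vertices meeting each
path from a leaf to the root exactly once. What lies above the cut has the upper color (blue),
what lies below has the lower color (red). Reading the tree from the root upwards, there are three
cases:
* the root edge of the tree `t` is in the cut (then nothing else is, and all of `t` is blue);
* the root vertex is in the cut (then nothing else is, and the trees above it are blue);
* the root vertex is red, and the cut consists of a cut of each of the trees above it. -/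
inductive ColoredTree : Type
  | cutEdge (t : PlaneTree) : ColoredTree
  | cutVertex (children : List PlaneTree) : ColoredTree
  | red (children : List ColoredTree) : ColoredTree

namespace ColoredTree

/-- The number of leaves. -/
def leaves : ColoredTree → ℕ
  | cutEdge t => t.leaves
  | cutVertex cs => (cs.map PlaneTree.leaves).sum
  | red cs => (cs.map leaves).sum

/-- Every vertex has at least two inputs. -/
inductive Reduced : ColoredTree → Prop
  | cutEdge (t : PlaneTree) (h : t.Reduced) : Reduced (cutEdge t)
  | cutVertex (cs : List PlaneTree) (h : 2 ≤ cs.length) (hcs : ∀ c ∈ cs, c.Reduced) :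
      Reduced (cutVertex cs)
  | red (cs : List ColoredTree) (h : 2 ≤ cs.length) (hcs : ∀ c ∈ cs, Reduced c) :
      Reduced (red cs)

/-- The blue trees directly above the cut when the cut is at the root edge or the root vertex. -/
def aboveCut : ColoredTree → Option (List PlaneTree)
  | cutEdge t => some [t]
  | cutVertex cs => some cs
  | red _ => none

/-- The elementary moves generating the face order: contractions of monochrome edges, and moves
of the cut from a family of edges to an adjacent vertex. -/
inductive Move : ColoredTree → ColoredTree → Prop
  /-- contraction of a blue edge between two blue vertices -/
  | contractBlue {cs ds : List PlaneTree} (h : PlaneTree.Contraction cs ds) :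
      Move (cutEdge (.node cs)) (cutEdge (.node ds))
  /-- contraction of a blue edge above a vertex of the cut -/
  | contractAboveCut {cs ds : List PlaneTree} (h : PlaneTree.Contraction cs ds) :
      Move (cutVertex cs) (cutVertex ds)
  /-- contraction of a red edge between two red vertices -/
  | contractRed (l cs r : List ColoredTree) :
      Move (red (l ++ red cs :: r)) (red (l ++ cs ++ r))
  /-- move of the cut from an edge to the vertex just above it -/
  | cutUp (cs : List PlaneTree) : Move (cutEdge (.node cs)) (cutVertex cs)
  /-- move of the cut down to a red vertex each of whose input edges is in the cut or ends in a
  vertex of the cut: the cut moves from the former edges to their common lower vertex, the latter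
  edges, which are red, are contracted (all at once, as the result has to be a cut) -/
  | cutDown {cs : List ColoredTree} {fs : List (List PlaneTree)}
      (h : List.Forall₂ (fun c f => c.aboveCut = some f) cs fs) :
      Move (red cs) (cutVertex fs.flatten)
  /-- a move in a tree above a red vertex -/
  | above (l r : List ColoredTree) {s t : ColoredTree} (h : Move s t) :
      Move (red (l ++ s :: r)) (red (l ++ t :: r))

end ColoredTree

/-- The 2-colored trees with `n` leaves. -/
def CT (n : ℕ) : Type := {T : ColoredTree // T.Reduced ∧ T.leaves = n}

/-- The face order on 2-colored trees. The lattice of 2-colored trees is `WithBot (CT n)`, in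
which a global minimum has been added. -/
instance (n : ℕ) : LE (CT n) :=
  ⟨Relation.ReflTransGen fun S T : CT n => S.1.Move T.1⟩

/-! ### 2-colored atomic trees and the Tamari-type order -/

/-- Planar binary trees together with a cut made of edges only: either the root edge is in the
cut, and all vertices of `t` are blue, or the root vertex is red, and there is such a cut of each
of the two trees above it. -/
inductive ColoredBinaryTree : Type
  | cut (t : BinaryTree Unit) : ColoredBinaryTree
  | red (left right : ColoredBinaryTree) : ColoredBinaryTree

/-- A planar binary tree seen as a planar tree. -/
def BinaryTree.toPlaneTree : BinaryTree Unit → PlaneTree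
  | .nil => .leaf
  | .node _ a b => .node [a.toPlaneTree, b.toPlaneTree]

theorem BinaryTree.toPlaneTree_reduced (t : BinaryTree Unit) : t.toPlaneTree.Reduced := by
  induction t with
  | nil => exact .leaf
  | node _ a b ha hb => exact .node _ (by simp) (by simp [ha, hb])

theorem BinaryTree.toPlaneTree_leaves (t : BinaryTree Unit) :
    t.toPlaneTree.leaves = t.numLeaves := by
  induction t with
  | nil => simp [toPlaneTree, PlaneTree.leaves]
  | node _ a b ha hb => simp [toPlaneTree, PlaneTree.leaves, ha, hb]

/-- The rotations of binary trees, at any vertex. -/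
inductive BinaryTree.Rotation : BinaryTree Unit → BinaryTree Unit → Prop
  | root (a b c : BinaryTree Unit) :
      Rotation (.node () (.node () a b) c) (.node () a (.node () b c))
  | left {s t : BinaryTree Unit} (c : BinaryTree Unit) (h : Rotation s t) :
      Rotation (.node () s c) (.node () t c)
  | right (c : BinaryTree Unit) {s t : BinaryTree Unit} (h : Rotation s t) :
      Rotation (.node () c s) (.node () c t)

namespace ColoredBinaryTree

/-- The number of leaves. -/
def leaves : ColoredBinaryTree → ℕ
  | cut t => t.numLeaves
  | red a b => a.leaves + b.leaves

/-- The underlying 2-colored tree. -/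
def toColoredTree : ColoredBinaryTree → ColoredTree
  | cut t => .cutEdge t.toPlaneTree
  | red a b => .red [a.toColoredTree, b.toColoredTree]

theorem toColoredTree_reduced (t : ColoredBinaryTree) : t.toColoredTree.Reduced := by
  induction t with
  | cut t => exact .cutEdge _ t.toPlaneTree_reduced
  | red a b ha hb => exact .red _ (by simp) (by simp [ha, hb])

theorem toColoredTree_leaves (t : ColoredBinaryTree) : t.toColoredTree.leaves = t.leaves := by
  induction t with
  | cut t => simp [toColoredTree, ColoredTree.leaves, leaves, t.toPlaneTree_leaves]
  | red a b ha hb => simp [toColoredTree, ColoredTree.leaves, leaves, ha, hb]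

/-- The covering relations of the Tamari-type order: rotation from left to right at two adjacent
blue vertices, rotation from left to right at two adjacent red vertices, and move of the cut from
the edge just below a blue vertex to the two edges just above it, the vertex becoming red. -/
inductive Cover : ColoredBinaryTree → ColoredBinaryTree → Prop
  | rotateBlue {s t : BinaryTree Unit} (h : s.Rotation t) : Cover (cut s) (cut t)
  | rotateRed (a b c : ColoredBinaryTree) : Cover (red (red a b) c) (red a (red b c))
  | recolor (a b : BinaryTree Unit) : Cover (cut (.node () a b)) (red (cut a) (cut b))
  | left {s t : ColoredBinaryTree} (c : ColoredBinaryTree) (h : Cover s t) :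
      Cover (red s c) (red t c)
  | right (c : ColoredBinaryTree) {s t : ColoredBinaryTree} (h : Cover s t) :
      Cover (red c s) (red c t)

end ColoredBinaryTree

/-- The 2-colored atomic trees with `n` leaves. -/
def AtomicTree (n : ℕ) : Type := {t : ColoredBinaryTree // t.leaves = n}

/-- The Tamari-type order. -/
instance (n : ℕ) : LE (AtomicTree n) :=
  ⟨Relation.ReflTransGen fun s t : AtomicTree n => s.1.Cover t.1⟩

/-- A 2-colored atomic tree seen as a 2-colored tree. -/
def AtomicTree.toCT {n : ℕ} (t : AtomicTree n) : CT n :=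
  ⟨t.1.toColoredTree, t.1.toColoredTree_reduced, t.1.toColoredTree_leaves.trans t.2⟩

/-! ### The Forcey–Loday realization -/

/-- The numbers `αᵢ βᵢ` attached to the vertices, listed from left to right, of a binary tree whose
leaves have the weights `w`, listed from left to right. -/
noncomputable def BinaryTree.coords : BinaryTree Unit → List ℝ → List ℝ
  | .nil, _ => []
  | .node _ a b, w =>
      a.coords (w.take a.numLeaves) ++
        ((w.take a.numLeaves).sum * (w.drop a.numLeaves).sum) :: b.coords (w.drop a.numLeaves)

/-- The numbers `αᵢ βᵢ` (for blue vertices) and `2 αᵢ βᵢ` (for red vertices), listed from left to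
right, of a 2-colored atomic tree whose leaves have the weights `w`, listed from left to right. -/
noncomputable def ColoredBinaryTree.coords : ColoredBinaryTree → List ℝ → List ℝ
  | .cut t, w => t.coords w
  | .red a b, w =>
      a.coords (w.take a.leaves) ++
        (2 * (w.take a.leaves).sum * (w.drop a.leaves).sum) :: b.coords (w.drop a.leaves)

theorem BinaryTree.length_coords (t : BinaryTree Unit) (w : List ℝ) :
    (t.coords w).length + 1 = t.numLeaves := by
  induction t generalizing w with
  | nil => simp [coords]
  | node _ a b ha hb =>
    have h1 := ha (w.take a.numLeaves)
    have h2 := hb (w.drop a.numLeaves)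
    simp only [coords, List.length_append, List.length_cons, numLeaves]
    omega

/-- The list of coordinates of a tree with `m + 1` leaves has length `m`. -/
theorem ColoredBinaryTree.length_coords (t : ColoredBinaryTree) (w : List ℝ) :
    (t.coords w).length + 1 = t.leaves := by
  induction t generalizing w with
  | cut t => exact t.length_coords w
  | red a b ha hb =>
    have h1 := ha (w.take a.leaves)
    have h2 := hb (w.drop a.leaves)
    simp only [coords, List.length_append, List.length_cons, leaves]
    omega

/-- The point `M(t, ω)`. The default value of `getD` is never used, by
`ColoredBinaryTree.length_coords`. -/
noncomputable def forceyLodayPoint {m : ℕ} (ω : Fin (m + 1) → ℝ) (t : AtomicTree (m + 1)) :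
    EuclideanSpace ℝ (Fin m) :=
  WithLp.toLp 2 fun i : Fin m => (t.1.coords (List.ofFn ω)).getD i 0

/-- The Forcey–Loday realization `J_ω`. -/
noncomputable def forceyLoday {m : ℕ} (ω : Fin (m + 1) → ℝ) : Set (EuclideanSpace ℝ (Fin m)) :=
  convexHull ℝ (Set.range (forceyLodayPoint ω))

/-! ### Oriented polytopes -/

/-- A polytope is the convex hull of a finite set of points. -/
def IsPolytope {m : ℕ} (P : Set (EuclideanSpace ℝ (Fin m))) : Prop :=
  ∃ s : Finset (EuclideanSpace ℝ (Fin m)), P = convexHull ℝ (s : Set (EuclideanSpace ℝ (Fin m)))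

/-- The face lattice of `P`, ordered by inclusion. The faces are the empty set and the sets of
maximizers over `P` of the linear forms (`P` itself for the zero form). -/
abbrev Face {m : ℕ} (P : Set (EuclideanSpace ℝ (Fin m))) : Type :=
  {F : Set (EuclideanSpace ℝ (Fin m)) // IsExposed ℝ P F}

/-- `x` and `y` are the two ends of an edge, that is, of a one-dimensional face, of the
polytope `P`. -/
def IsEdge {m : ℕ} (P : Set (EuclideanSpace ℝ (Fin m))) (x y : EuclideanSpace ℝ (Fin m)) : Prop :=
  x ≠ y ∧ IsExposed ℝ P (segment ℝ x y)

/-- The reflection of `P` with respect to the point `z`. -/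
def reflection {m : ℕ} (z : EuclideanSpace ℝ (Fin m)) (P : Set (EuclideanSpace ℝ (Fin m))) :
    Set (EuclideanSpace ℝ (Fin m)) :=
  (fun x => (2 : ℝ) • z - x) '' P

/-- `v` is not perpendicular to any edge of `P ∩ ρ_z P`, for any `z ∈ P`. -/
def PositivelyOriented {m : ℕ} (P : Set (EuclideanSpace ℝ (Fin m)))
    (v : EuclideanSpace ℝ (Fin m)) : Prop :=
  ∀ z ∈ P, ∀ x y, IsEdge (P ∩ reflection z P) x y → inner ℝ v (y - x) ≠ 0

/-- The order on the vertices of `P` induced by `v`: it is generated by the edges of `P`, oriented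
in the direction in which the scalar product with `v` increases. -/
def VertexOrder {m : ℕ} (P : Set (EuclideanSpace ℝ (Fin m))) (v : EuclideanSpace ℝ (Fin m)) :
    EuclideanSpace ℝ (Fin m) → EuclideanSpace ℝ (Fin m) → Prop :=
  Relation.ReflTransGen fun x y => IsEdge P x y ∧ inner ℝ v x < inner ℝ v y

/-- `(P, v)` is a well-oriented realization of the `m`-dimensional multiplihedron, in which the
vertex of label `t` is the point `p t`. -/
structure IsWellOrientedRealization {m : ℕ} (P : Set (EuclideanSpace ℝ (Fin m)))
    (v : EuclideanSpace ℝ (Fin m)) (p : AtomicTree (m + 1) → EuclideanSpace ℝ (Fin m)) :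
    Prop where
  isPolytope : IsPolytope P
  dim_eq : Module.finrank ℝ (vectorSpan ℝ P) = m
  faceLattice : ∃ Φ : WithBot (CT (m + 1)) ≃o Face P,
    ∀ t : AtomicTree (m + 1), (Φ (t.toCT : WithBot (CT (m + 1)))).1 = {p t}
  positivelyOriented : PositivelyOriented P v
  vertexOrder : ∀ s t : AtomicTree (m + 1), s ≤ t ↔ VertexOrder P v (p s) (p t)

/-- Good orientation vectors: `vᵢ ≥ 2 vᵢ₊₁` for all `i`, and the last coordinate is positive. -/
structure IsGoodOrientationVector {m : ℕ} (v : EuclideanSpace ℝ (Fin m)) : Prop where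
  two_mul_le : ∀ (i : ℕ) (h : i + 1 < m), 2 * v ⟨i + 1, h⟩ ≤ v ⟨i, Nat.lt_of_succ_lt h⟩
  last_pos : ∀ i : Fin m, (i : ℕ) + 1 = m → 0 < v i

/-! Everything rests on an explicit support function. The coordinates of a vector `u` are read as
labels of the gaps between consecutive leaves, hence of the vertices of any atomic tree. Expanding
the products `αᵢ βᵢ`, the scalar product of `u` with `M(t, ω)` becomes a sum over pairs of leaves:
the two weights times the label of the vertex where the leaves meet, doubled if this vertex is red.
That vertex sits at a gap between the two leaves, so each term is at least the product of the
weights with `min (x, 2x)`, where `x` is the smallest label between the leaves. This lower bound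
`minValue` does not depend on `t`. It is attained exactly when the labels increase weakly upwards,
are nonpositive at red vertices and nonnegative at blue ones (`ColoredBinaryTree.pairSum_le_dot`,
`ColoredBinaryTree.Fits`).

Face lattice. The same labelling condition makes sense for every 2-colored tree, with label `0` on
the cut; the weak labellings of a tree form the normal cone of its face, and the strict ones its
relative interior. Each vector strictly labels exactly one tree: equal labels are removed by
contractions, labels `0` by moves of the cut (`HasLabels.exists_strict`, `HasLabels.unique`). A
strict labelling of `T` labels `S` weakly if and only if `S ≤ T` (`CT.hasLabels_iff_le`), and weak
labellings are detected by the atomic trees below (`Reduced.detected`). So inclusion of faces, which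
is inclusion of their sets of vertices, is the face order.

Vertex order. A vector fitting `s` fits either no other atomic tree or one related to `s` by a
cover, and each cover is realized by a vector fitting exactly its two trees. Hence edges are covers.
A direct computation shows that a cover increases the product with any positive decreasing vector.

Orientation. `minValue` is additive when a vector is peeled into its levels, so the polytope is cut
out by the inequalities attached to vectors of the form indicator minus constant
(`mem_forceyLoday_iff`). With the opposite of the sum of the coordinates as an extra coordinate,
these bound sums over subsets by a supermodular function: the polytope is a generalized
permutahedron. The sets tight at a point therefore form a lattice, and the directions available at
that point are the vectors of zero sum on the blocks of a partition. An edge direction of `P ∩ ρ_z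
P` has zero sum on the blocks of two partitions. Two partitions form a bipartite graph whose edges
are the coordinates; a cycle in it, with alternating signs, gives a direction with entries `-1`,
`0`, `1`, necessarily parallel to the edge. Since each coordinate of `v` exceeds the sum of the
following ones, `v` is not perpendicular to such a direction. -/

/-! ### Labelled plane forests -/

namespace PlaneTree

/-- `Labels r cs b u`: the list `u` is obtained from a labelling of the vertices of a forest `cs`
attached to a vertex of label `b`, in which labels of successive vertices are related by `r`, by
listing from left to right the labels of the vertices at which two consecutive leaves meet. The
label `b` is repeated after the last tree. -/
inductive Labels (r : ℝ → ℝ → Prop) : List PlaneTree → ℝ → List ℝ → Prop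
  | nil (b : ℝ) : Labels r [] b []
  | leaf {cs : List PlaneTree} {b : ℝ} {v : List ℝ} (h : Labels r cs b v) :
      Labels r (leaf :: cs) b (b :: v)
  | node {cs ds : List PlaneTree} {b g : ℝ} {u v : List ℝ} (hbg : r b g) (hds : 2 ≤ ds.length)
      (hu : Labels r ds g (u ++ [g])) (hv : Labels r cs b v) :
      Labels r (node ds :: cs) b (u ++ b :: v)

variable {r : ℝ → ℝ → Prop} {b c : ℝ} {u v : List ℝ} {cs ds l : List PlaneTree}

namespace Labels

theorem append (hl : Labels r l b u) (hc : Labels r cs b v) : Labels r (l ++ cs) b (u ++ v) := by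
  induction hl with
  | nil => simpa
  | leaf _ ih => exact (ih hc).leaf
  | node h1 h2 h3 _ _ ih => simpa using Labels.node h1 h2 h3 (ih hc)

theorem of_append (h : Labels r (l ++ cs) b u) :
    ∃ u₁ u₂, u = u₁ ++ u₂ ∧ Labels r l b u₁ ∧ Labels r cs b u₂ := by
  induction l generalizing u with
  | nil => exact ⟨[], u, rfl, .nil b, h⟩
  | cons t l ih =>
    cases h with
    | leaf h =>
      obtain ⟨u₁, u₂, rfl, h1, h2⟩ := ih h
      exact ⟨b :: u₁, u₂, rfl, h1.leaf, h2⟩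
    | node h1 h2 h3 h =>
      obtain ⟨u₁, u₂, rfl, h4, h5⟩ := ih h
      exact ⟨_, u₂, by simp, .node h1 h2 h3 h4, h5⟩

theorem length_eq (h : Labels r cs b u) : u.length = (cs.map leaves).sum := by
  induction h with
  | nil => rfl
  | leaf _ ih => simp [ih, leaves, add_comm]
  | node _ _ _ _ ih1 ih2 =>
    simp only [List.length_append, List.length_cons, List.length_nil, List.map_cons, leaves,
      List.sum_cons] at *
    omega

theorem le_of_mem (hr : ∀ x y, r x y → x ≤ y) (h : Labels r cs b u) : ∀ x ∈ u, b ≤ x := by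
  induction h with
  | nil => simp
  | leaf _ ih => simpa using ih
  | node h1 _ _ _ ih1 ih2 =>
    intro x hx
    simp only [List.mem_append, List.mem_cons] at hx ih1
    rcases hx with hx | rfl | hx
    · exact (hr _ _ h1).trans (ih1 x (.inl hx))
    · exact le_rfl
    · exact ih2 x hx

theorem exists_eq_append (h : Labels r cs b u) (hc : cs ≠ []) : ∃ v, u = v ++ [b] := by
  induction h with
  | nil => exact absurd rfl hc
  | @leaf cs b v h ih =>
    rcases eq_or_ne cs [] with rfl | hcs
    · cases h; exact ⟨[], rfl⟩
    · obtain ⟨w, rfl⟩ := ih hcs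
      exact ⟨b :: w, rfl⟩
  | @node cs ds b g u v _ _ _ h _ ih =>
    rcases eq_or_ne cs [] with rfl | hcs
    · cases h; exact ⟨u, rfl⟩
    · obtain ⟨w, rfl⟩ := ih hcs
      exact ⟨u ++ b :: w, by simp⟩

/-- The first of at least two trees is followed by a gap of label `b`. -/
theorem exists_split {t : PlaneTree} (h : Labels r (t :: cs) b (u ++ [b])) (hc : cs ≠ []) :
    ∃ u₁ u₂, u = u₁ ++ b :: u₂ ∧ Labels r [t] b (u₁ ++ [b]) ∧ Labels r cs b (u₂ ++ [b]) := by
  obtain ⟨v, w, h1, h2, h3⟩ := of_append (l := [t]) h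
  obtain ⟨v, rfl⟩ := h2.exists_eq_append (by simp)
  obtain ⟨w, rfl⟩ := h3.exists_eq_append hc
  refine ⟨v, w, ?_, h2, h3⟩
  rw [← List.append_assoc] at h1
  simpa using List.append_cancel_right h1

theorem cons {t : PlaneTree} (h : Labels r [t] b (u ++ [b])) (hc : Labels r cs b (v ++ [b])) :
    Labels r (t :: cs) b (u ++ b :: v ++ [b]) := by
  simpa using h.append hc

/-- This makes the label of a vertex visible in the list of gaps, and is where the hypothesis of two
inputs enters. -/
theorem mem_of_two_le_length (h : Labels r cs b (u ++ [b])) (hc : 2 ≤ cs.length) : b ∈ u := by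
  match cs, hc with
  | t :: t' :: cs, _ =>
    obtain ⟨u₁, u₂, rfl, -⟩ := h.exists_split (by simp)
    simp

/-- The labels of a forest determine the value of the label at the bottom. -/
theorem bottom_unique (hr : ∀ x y, r x y → x ≤ y) (h : Labels r cs b (u ++ [b]))
    (h' : Labels r ds c (u ++ [c])) (hc : 2 ≤ cs.length) (hd : 2 ≤ ds.length) : b = c :=
  le_antisymm (h.le_of_mem hr c (by simp [h'.mem_of_two_le_length hd]))
    (h'.le_of_mem hr b (by simp [h.mem_of_two_le_length hc]))

theorem singleton_leaf : Labels r [PlaneTree.leaf] b [b] := .leaf (.nil b)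

theorem singleton_leaf_iff : Labels r [PlaneTree.leaf] b (u ++ [b]) ↔ u = [] := by
  constructor
  · intro h
    have := h.length_eq
    simpa [leaves] using this
  · rintro rfl
    exact singleton_leaf

theorem singleton_node_iff :
    Labels r [PlaneTree.node cs] b (u ++ [b]) ↔ ∃ g, r b g ∧ 2 ≤ cs.length ∧ Labels r cs g (u ++ [g]) := by
  constructor
  · intro h
    generalize hw : u ++ [b] = w at h
    cases h with
    | node h1 h2 h3 h4 =>
      cases h4
      obtain rfl := List.append_cancel_right hw
      exact ⟨_, h1, h2, h3⟩
  · rintro ⟨g, h1, h2, h3⟩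
    exact .node h1 h2 h3 (.nil b)

end Labels

theorem eq_of_append_cons_eq {α : Type*} {a : α} {u u' v v' : List α}
    (h : u ++ a :: v = u' ++ a :: v') (hu : a ∉ u) (hu' : a ∉ u') : u = u' ∧ v = v' := by
  induction u generalizing u' with
  | nil =>
    cases u' with
    | nil => simpa using h
    | cons x u' => simp at h hu'; exact absurd h.1 hu'.1
  | cons x u ih =>
    cases u' with
    | nil => simp at h hu; exact absurd h.1.symm hu.1
    | cons y u' =>
      simp only [List.cons_append, List.cons.injEq, List.mem_cons, not_or] at h hu hu'
      obtain ⟨rfl, rfl⟩ := ih h.2 hu.2 hu'.2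
      simp [h.1]

/-- All labels above a vertex of a tree attached to `b` exceed `b` strictly, so the first occurrence
of `b` marks the end of the first tree. The label of the root vertex of that tree is then recovered
as the minimum of its gaps. -/
theorem Labels.unique (h : Labels (· < ·) cs b u) (h' : Labels (· < ·) ds b u) : cs = ds := by
  have hlt : ∀ x y : ℝ, x < y → x ≤ y := fun _ _ => le_of_lt
  induction h generalizing ds with
  | nil =>
    generalize hw : [] = w at h'
    cases h' <;> simp_all
  | leaf h ih =>
    generalize hw : _ :: _ = w at h'
    cases h' with
    | nil => simp at hw
    | leaf h' =>
      simp only [List.cons.injEq, true_and] at hw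
      rw [ih (hw ▸ h')]
    | @node cs' ds' _ g u v h1 h2 h3 h4 =>
      have h5 := h3.mem_of_two_le_length h2
      cases u with
      | nil => simp at h5
      | cons x u =>
        simp only [List.cons_append, List.cons.injEq] at hw
        have := h3.le_of_mem hlt x (by simp)
        rw [← hw.1] at this
        exact absurd h1 this.not_gt
  | @node cs ds' b g u v h1 h2 h3 h4 ih1 ih2 =>
    generalize hw : _ ++ _ :: _ = w at h'
    have hu : b ∉ u := fun hb => h1.not_ge (h3.le_of_mem hlt b (by simp [hb]))
    cases h' with
    | nil => simp at hw
    | leaf h' =>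
      have h5 := h3.mem_of_two_le_length h2
      cases u with
      | nil => simp at h5
      | cons x u =>
        simp only [List.cons_append, List.cons.injEq] at hw
        simp [hw.1] at hu
    | @node cs'' ds'' _ g' u' v' h1' h2' h3' h4' =>
      have hu' : b ∉ u' := fun hb => h1'.not_ge (h3'.le_of_mem hlt b (by simp [hb]))
      obtain ⟨rfl, rfl⟩ := eq_of_append_cons_eq hw hu hu'
      obtain rfl := h3.bottom_unique hlt h3' h2 h2'
      rw [ih1 h3', ih2 h4']

/-- Sequences of contractions. -/
abbrev Contractions : List PlaneTree → List PlaneTree → Prop :=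
  Relation.ReflTransGen Contraction

theorem Contraction.append_left {cs ds : List PlaneTree} (h : Contraction cs ds)
    (l : List PlaneTree) : Contraction (l ++ cs) (l ++ ds) := by
  cases h with
  | edge l' cs r => simpa using Contraction.edge (l ++ l') cs r
  | inside l' r h => simpa using Contraction.inside (l ++ l') r h

theorem Contraction.append_right {cs ds : List PlaneTree} (h : Contraction cs ds)
    (l : List PlaneTree) : Contraction (cs ++ l) (ds ++ l) := by
  cases h with
  | edge l' cs r => simpa using Contraction.edge l' cs (r ++ l)
  | inside l' r h => simpa using Contraction.inside l' (r ++ l) h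

theorem Contractions.append_left {cs ds : List PlaneTree} (h : Contractions cs ds)
    (l : List PlaneTree) : Contractions (l ++ cs) (l ++ ds) :=
  Relation.ReflTransGen.lift (p := Contraction) (l ++ ·) (fun _ _ h => Contraction.append_left h l) _ _ h

theorem Contractions.append_right {cs ds : List PlaneTree} (h : Contractions cs ds)
    (l : List PlaneTree) : Contractions (cs ++ l) (ds ++ l) :=
  Relation.ReflTransGen.lift (p := Contraction) (· ++ l) (fun _ _ h => Contraction.append_right h l) _ _ h

theorem Contractions.node {cs ds : List PlaneTree} (h : Contractions cs ds) :
    Contractions [node cs] [node ds] :=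
  Relation.ReflTransGen.lift (p := Contraction)
    (fun cs => [PlaneTree.node cs]) (fun _ _ h => Contraction.inside [] [] h) _ _ h

theorem Contractions.append {cs ds cs' ds' : List PlaneTree} (h : Contractions cs ds)
    (h' : Contractions cs' ds') : Contractions (cs ++ cs') (ds ++ ds') :=
  (h.append_right cs').trans (h'.append_left ds)

/-- Contracting the edges between vertices of the same label, one obtains strictly increasing
labels. -/
theorem Labels.exists_strict (h : Labels (· ≤ ·) cs b u) :
    ∃ ds, Contractions cs ds ∧ cs.length ≤ ds.length ∧ Labels (· < ·) ds b u := by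
  induction h with
  | nil b => exact ⟨[], .refl, le_rfl, .nil b⟩
  | leaf _ ih =>
    obtain ⟨ds, h1, h2, h3⟩ := ih
    exact ⟨_, h1.append_left [PlaneTree.leaf], by simpa using h2, h3.leaf⟩
  | @node cs ds b g u v hbg h2 h3 h4 ih1 ih2 =>
    obtain ⟨ds', h5, h6, h7⟩ := ih1
    obtain ⟨cs', h8, h9, h10⟩ := ih2
    rcases hbg.lt_or_eq with hlt | rfl
    · exact ⟨[PlaneTree.node ds'] ++ cs', h5.node.append h8, by simpa using h9,
        .node hlt (h2.trans h6) h7 h10⟩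
    · have h11 : Contractions [PlaneTree.node ds'] ds' :=
        .single (by simpa using Contraction.edge [] ds' [])
      exact ⟨ds' ++ cs', Contractions.append (h5.node.trans h11) h8, by simp; omega,
        by simpa using h7.append h10⟩

/-- Labels that increase weakly still do so after the creation of a vertex. -/
theorem Contraction.labels {ds : List PlaneTree} (h : Contraction cs ds)
    (hcs : ∀ t ∈ cs, t.Reduced) (hu : Labels (· ≤ ·) ds b u) : Labels (· ≤ ·) cs b u := by
  induction h generalizing b u with
  | edge l cs r =>
    obtain ⟨u₁, u₃, rfl, h1, h3⟩ := hu.of_append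
    obtain ⟨u₁, u₂, rfl, h1', h2⟩ := h1.of_append
    have h4 : 2 ≤ cs.length := by
      have := hcs (PlaneTree.node cs) (by simp)
      cases this; assumption
    obtain ⟨v, rfl⟩ := h2.exists_eq_append (by rintro rfl; simp at h4)
    simpa using h1'.append (.node le_rfl h4 h2 h3)
  | @inside l r cs ds h ih =>
    obtain ⟨u₁, u₃, rfl, h1, h3⟩ := hu.of_append
    have h4 := hcs (PlaneTree.node cs) (by simp)
    cases h4 with
    | node _ h4 h5 =>
      cases h3 with
      | node h6 h7 h8 h9 => exact h1.append (.node h6 h4 (ih h5 h8) h9)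

theorem Contraction.length_le {ds : List PlaneTree} (h : Contraction cs ds)
    (hcs : ∀ t ∈ cs, t.Reduced) : cs.length ≤ ds.length := by
  cases h with
  | edge l cs r =>
    have := hcs (PlaneTree.node cs) (by simp)
    cases this with
    | node _ h => simp; omega
  | inside => simp

theorem Contraction.reduced {ds : List PlaneTree} (h : Contraction cs ds)
    (hcs : ∀ t ∈ cs, t.Reduced) : ∀ t ∈ ds, t.Reduced := by
  induction h with
  | edge l cs r =>
    have := hcs (PlaneTree.node cs) (by simp)
    cases this with
    | node _ h h' => simp at hcs ⊢; grind
  | inside l r h ih =>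
    have h1 := hcs (PlaneTree.node _) (by simp; right; left; rfl)
    cases h1 with
    | node _ h2 h3 =>
      have := Reduced.node _ (h2.trans (h.length_le h3)) (ih h3)
      simp at hcs ⊢
      grind

theorem Contraction.leaves_eq {ds : List PlaneTree} (h : Contraction cs ds) :
    (cs.map leaves).sum = (ds.map leaves).sum := by
  induction h with
  | edge l cs r => simp [leaves]
  | inside l r h ih => simp [leaves, ih]

/-- Reduced forests have strictly increasing labels. -/
theorem Reduced.exists_labels {t : PlaneTree} (h : t.Reduced) (b : ℝ) :
    ∃ u, Labels (· < ·) [t] b (u ++ [b]) := by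
  induction h generalizing b with
  | leaf => exact ⟨[], Labels.singleton_leaf⟩
  | node cs h hcs ih =>
    have key : ∀ l : List PlaneTree, (∀ t ∈ l, t ∈ cs) → ∃ u, Labels (· < ·) l (b + 1) u := by
      intro l
      induction l with
      | nil => exact fun _ => ⟨[], .nil _⟩
      | cons t l ih' =>
        intro hl
        obtain ⟨u, hu⟩ := ih t (hl t (by simp)) (b + 1)
        obtain ⟨v, hv⟩ := ih' fun t ht => hl t (by simp [ht])
        exact ⟨_, hu.append hv⟩
    obtain ⟨u, hu⟩ := key cs fun _ h => h
    obtain ⟨v, rfl⟩ := hu.exists_eq_append (by rintro rfl; simp at h)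
    exact ⟨v, Labels.singleton_node_iff.2 ⟨b + 1, lt_add_one b, h, hu⟩⟩

theorem exists_labels (hcs : ∀ t ∈ cs, t.Reduced) (b : ℝ) : ∃ u, Labels (· < ·) cs b u := by
  induction cs with
  | nil => exact ⟨[], .nil b⟩
  | cons t cs ih =>
    obtain ⟨u, hu⟩ := (hcs t (by simp)).exists_labels b
    obtain ⟨v, hv⟩ := ih fun t ht => hcs t (by simp [ht])
    exact ⟨_, hu.append hv⟩

/-- The number of vertices. -/
def vertices : PlaneTree → ℕ
  | leaf => 0
  | node cs => (cs.map vertices).sum + 1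

theorem Contraction.vertices_eq {ds : List PlaneTree} (h : Contraction cs ds) :
    (cs.map vertices).sum = (ds.map vertices).sum + 1 := by
  induction h with
  | edge l cs r => simp [vertices]; ring
  | inside l r h ih => simp [vertices, ih]; ring

end PlaneTree

/-! ### Labelled 2-colored forests -/

namespace ColoredTree

/-- `Labels r cs b u`: as for plane forests, the list `u` is obtained from a labelling of the
vertices of the 2-colored forest `cs` attached to a red vertex of label `b`. Labels of successive
vertices are related by `r`, the vertices of the cut have label `0`, and there is an additional
vertex of label `0` on each edge of the cut. -/
inductive Labels (r : ℝ → ℝ → Prop) : List ColoredTree → ℝ → List ℝ → Prop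
  | nil (b : ℝ) : Labels r [] b []
  | cutEdge {t : PlaneTree} {cs : List ColoredTree} {b : ℝ} {u v : List ℝ}
      (hu : PlaneTree.Labels r [t] 0 (u ++ [0])) (hv : Labels r cs b v) :
      Labels r (cutEdge t :: cs) b (u ++ b :: v)
  | cutVertex {fs : List PlaneTree} {cs : List ColoredTree} {b : ℝ} {u v : List ℝ}
      (hfs : 2 ≤ fs.length) (hu : PlaneTree.Labels r fs 0 (u ++ [0])) (hv : Labels r cs b v) :
      Labels r (cutVertex fs :: cs) b (u ++ b :: v)
  | red {cs ds : List ColoredTree} {b g : ℝ} {u v : List ℝ} (hbg : r b g) (hg : r g 0)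
      (hds : 2 ≤ ds.length) (hu : Labels r ds g (u ++ [g])) (hv : Labels r cs b v) :
      Labels r (red ds :: cs) b (u ++ b :: v)

variable {r : ℝ → ℝ → Prop} {b c : ℝ} {u v : List ℝ} {cs ds l : List ColoredTree}

namespace Labels

theorem append (hl : Labels r l b u) (hc : Labels r cs b v) : Labels r (l ++ cs) b (u ++ v) := by
  induction hl with
  | nil => simpa
  | cutEdge h1 _ ih => simpa using Labels.cutEdge h1 (ih hc)
  | cutVertex h1 h2 _ ih => simpa using Labels.cutVertex h1 h2 (ih hc)
  | red h1 h2 h3 h4 _ _ ih => simpa using Labels.red h1 h2 h3 h4 (ih hc)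

theorem of_append (h : Labels r (l ++ cs) b u) :
    ∃ u₁ u₂, u = u₁ ++ u₂ ∧ Labels r l b u₁ ∧ Labels r cs b u₂ := by
  induction l generalizing u with
  | nil => exact ⟨[], u, rfl, .nil b, h⟩
  | cons t l ih =>
    cases h with
    | cutEdge h1 h =>
      obtain ⟨u₁, u₂, rfl, h4, h5⟩ := ih h
      exact ⟨_, u₂, by simp, .cutEdge h1 h4, h5⟩
    | cutVertex h1 h2 h =>
      obtain ⟨u₁, u₂, rfl, h4, h5⟩ := ih h
      exact ⟨_, u₂, by simp, .cutVertex h1 h2 h4, h5⟩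
    | red h1 h2 h3 h0 h =>
      obtain ⟨u₁, u₂, rfl, h4, h5⟩ := ih h
      exact ⟨_, u₂, by simp, .red h1 h2 h3 h0 h4, h5⟩

theorem length_eq (h : Labels r cs b u) : u.length = (cs.map leaves).sum := by
  induction h with
  | nil => rfl
  | cutEdge h1 _ ih =>
    have := h1.length_eq
    simp [leaves] at *; omega
  | cutVertex _ h1 _ ih =>
    have := h1.length_eq
    simp [leaves] at *; omega
  | red _ _ _ _ _ ih1 ih2 => simp [leaves] at *; omega

theorem le_of_mem (hr : ∀ x y, r x y → x ≤ y) (h : Labels r cs b u) (hb : b ≤ 0) :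
    ∀ x ∈ u, b ≤ x := by
  have key : ∀ u v : List ℝ, (∀ x ∈ u, b ≤ x) → (∀ x ∈ v, b ≤ x) → ∀ x ∈ u ++ b :: v, b ≤ x := by
    intro u v hu hv x hx
    simp only [List.mem_append, List.mem_cons] at hx
    rcases hx with hx | rfl | hx
    exacts [hu x hx, le_rfl, hv x hx]
  induction h with
  | nil => simp
  | cutEdge h1 _ ih =>
    exact key _ _ (fun x hx => hb.trans (h1.le_of_mem hr x (by simp [hx]))) (ih hb key)
  | cutVertex _ h1 _ ih =>
    exact key _ _ (fun x hx => hb.trans (h1.le_of_mem hr x (by simp [hx]))) (ih hb key)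
  | @red _ _ _ g _ _ h1 h2 _ _ _ ih1 ih2 =>
    refine key _ _ (fun x hx => (hr _ _ h1).trans (ih1 (hr _ _ h2) ?_ x (by simp [hx]))) (ih2 hb key)
    intro u v hu hv x hx
    simp only [List.mem_append, List.mem_cons] at hx
    rcases hx with hx | rfl | hx
    exacts [hu x hx, le_rfl, hv x hx]

theorem exists_eq_append (h : Labels r cs b u) (hc : cs ≠ []) : ∃ v, u = v ++ [b] := by
  have key : ∀ (u v : List ℝ) (cs : List ColoredTree), Labels r cs b v →
      (cs ≠ [] → ∃ w, v = w ++ [b]) → ∃ w, u ++ b :: v = w ++ [b] := by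
    intro u v cs h ih
    rcases eq_or_ne cs [] with rfl | hcs
    · cases h; exact ⟨u, rfl⟩
    · obtain ⟨w, rfl⟩ := ih hcs
      exact ⟨u ++ b :: w, by simp⟩
  cases cs with
  | nil => exact absurd rfl hc
  | cons t cs =>
    clear hc
    induction cs generalizing t u with
    | nil =>
      cases h with
      | cutEdge _ h => exact key _ _ _ h (by simp)
      | cutVertex _ _ h => exact key _ _ _ h (by simp)
      | red _ _ _ _ h => exact key _ _ _ h (by simp)
    | cons t' cs ih =>
      cases h with
      | cutEdge _ h => exact key _ _ _ h fun _ => ih _ h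
      | cutVertex _ _ h => exact key _ _ _ h fun _ => ih _ h
      | red _ _ _ _ h => exact key _ _ _ h fun _ => ih _ h

/-- The first of at least two trees is followed by a gap of label `b`. -/
theorem exists_split {t : ColoredTree} (h : Labels r (t :: cs) b (u ++ [b])) (hc : cs ≠ []) :
    ∃ u₁ u₂, u = u₁ ++ b :: u₂ ∧ Labels r [t] b (u₁ ++ [b]) ∧ Labels r cs b (u₂ ++ [b]) := by
  obtain ⟨v, w, h1, h2, h3⟩ := of_append (l := [t]) h
  obtain ⟨v, rfl⟩ := h2.exists_eq_append (by simp)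
  obtain ⟨w, rfl⟩ := h3.exists_eq_append hc
  refine ⟨v, w, ?_, h2, h3⟩
  rw [← List.append_assoc] at h1
  simpa using List.append_cancel_right h1

theorem cons {t : ColoredTree} (h : Labels r [t] b (u ++ [b])) (hc : Labels r cs b (v ++ [b])) :
    Labels r (t :: cs) b (u ++ b :: v ++ [b]) := by
  simpa using h.append hc

theorem mem_of_two_le_length (h : Labels r cs b (u ++ [b])) (hc : 2 ≤ cs.length) : b ∈ u := by
  match cs, hc with
  | t :: t' :: cs, _ =>
    obtain ⟨u₁, u₂, rfl, -⟩ := h.exists_split (by simp)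
    simp

theorem bottom_unique (hr : ∀ x y, r x y → x ≤ y) (h : Labels r cs b (u ++ [b]))
    (h' : Labels r ds c (u ++ [c])) (hc : 2 ≤ cs.length) (hd : 2 ≤ ds.length) (hb : b ≤ 0)
    (hc' : c ≤ 0) : b = c :=
  le_antisymm (h.le_of_mem hr hb c (by simp [h'.mem_of_two_le_length hd]))
    (h'.le_of_mem hr hc' b (by simp [h.mem_of_two_le_length hc]))

theorem singleton_cutEdge_iff {t : PlaneTree} :
    Labels r [ColoredTree.cutEdge t] b (u ++ [b]) ↔ PlaneTree.Labels r [t] 0 (u ++ [0]) := by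
  constructor
  · intro h
    generalize hw : u ++ [b] = w at h
    cases h with
    | cutEdge h1 h4 =>
      cases h4
      obtain rfl := List.append_cancel_right hw
      exact h1
  · exact fun h => .cutEdge h (.nil b)

theorem singleton_cutVertex_iff {fs : List PlaneTree} :
    Labels r [ColoredTree.cutVertex fs] b (u ++ [b]) ↔
      2 ≤ fs.length ∧ PlaneTree.Labels r fs 0 (u ++ [0]) := by
  constructor
  · intro h
    generalize hw : u ++ [b] = w at h
    cases h with
    | cutVertex h1 h2 h4 =>
      cases h4
      obtain rfl := List.append_cancel_right hw
      exact ⟨h1, h2⟩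
  · exact fun h => .cutVertex h.1 h.2 (.nil b)

theorem singleton_red_iff :
    Labels r [ColoredTree.red cs] b (u ++ [b]) ↔
      ∃ g, r b g ∧ r g 0 ∧ 2 ≤ cs.length ∧ Labels r cs g (u ++ [g]) := by
  constructor
  · intro h
    generalize hw : u ++ [b] = w at h
    cases h with
    | red h1 h2 h3 h4 h5 =>
      cases h5
      obtain rfl := List.append_cancel_right hw
      exact ⟨_, h1, h2, h3, h4⟩
  · rintro ⟨g, h1, h2, h3, h4⟩
    exact .red h1 h2 h3 h4 (.nil b)

/-- The label below a tree is only bounded from above, so it can be lowered. This allows two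
labellings with different bottoms to be compared. -/
theorem singleton_mono (hr : ∀ x y z, x ≤ y → r y z → r x z) {t : ColoredTree}
    (h : Labels r [t] b (u ++ [b])) (hbc : c ≤ b) : Labels r [t] c (u ++ [c]) := by
  cases t with
  | cutEdge t =>
    rw [singleton_cutEdge_iff] at h ⊢
    exact h
  | cutVertex fs =>
    rw [singleton_cutVertex_iff] at h ⊢
    exact h
  | red cs =>
    rw [singleton_red_iff] at h ⊢
    obtain ⟨g, h1, h2⟩ := h
    exact ⟨g, hr _ _ _ hbc h1, h2⟩

/-- The list `u` shows the type of the root: a red root vertex puts a negative label into `u`,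
whereas the labels above a cut are nonnegative; and a cut at the root edge or at the root vertex is
told apart by the number of trees above it, one or at least two. The hypothesis `ih` is the
inductive uniqueness above a red root vertex. -/
theorem singleton_unique {s t : ColoredTree}
    (ih : ∀ cs g, s = ColoredTree.red cs → 2 ≤ cs.length → g < 0 → Labels (· < ·) cs g (u ++ [g]) →
      ∀ ds, Labels (· < ·) ds g (u ++ [g]) → cs = ds)
    (h : Labels (· < ·) [s] b (u ++ [b])) (h' : Labels (· < ·) [t] b (u ++ [b])) : s = t := by
  have hlt : ∀ x y : ℝ, x < y → x ≤ y := fun _ _ => le_of_lt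
  have key : ∀ (cs : List ColoredTree) (fs : List PlaneTree) (g : ℝ), g < 0 → 2 ≤ cs.length →
      Labels (· < ·) cs g (u ++ [g]) → PlaneTree.Labels (· < ·) fs 0 (u ++ [0]) → False := by
    intro cs fs g hg h1 h2 h3
    have := h3.le_of_mem hlt g (by simp [h2.mem_of_two_le_length h1])
    exact hg.not_ge this
  cases s with
  | cutEdge s =>
    rw [singleton_cutEdge_iff] at h
    cases t with
    | cutEdge t =>
      rw [singleton_cutEdge_iff] at h'
      have := h.unique h'
      simp_all
    | cutVertex fs =>
      rw [singleton_cutVertex_iff] at h'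
      have := h.unique h'.2
      simp [← this] at h'
    | red ds =>
      rw [singleton_red_iff] at h'
      obtain ⟨g, -, h1, h2, h3⟩ := h'
      exact (key _ _ _ h1 h2 h3 h).elim
  | cutVertex fs =>
    rw [singleton_cutVertex_iff] at h
    cases t with
    | cutEdge t =>
      rw [singleton_cutEdge_iff] at h'
      have := h'.unique h.2
      simp [← this] at h
    | cutVertex fs =>
      rw [singleton_cutVertex_iff] at h'
      rw [h.2.unique h'.2]
    | red ds =>
      rw [singleton_red_iff] at h'
      obtain ⟨g, -, h1, h2, h3⟩ := h'
      exact (key _ _ _ h1 h2 h3 h.2).elim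
  | red cs =>
    rw [singleton_red_iff] at h
    obtain ⟨g, -, h1, h2, h3⟩ := h
    cases t with
    | cutEdge t =>
      rw [singleton_cutEdge_iff] at h'
      exact (key _ _ _ h1 h2 h3 h').elim
    | cutVertex fs =>
      rw [singleton_cutVertex_iff] at h'
      exact (key _ _ _ h1 h2 h3 h'.2).elim
    | red ds =>
      rw [singleton_red_iff] at h'
      obtain ⟨g', -, h1', h2', h3'⟩ := h'
      obtain rfl := h3.bottom_unique hlt h3' h2 h2' h1.le h1'.le
      rw [ih _ _ rfl h2 h1 h3 ds h3']

end Labels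

theorem Labels.forall_lt_of_singleton {t : ColoredTree} (hb : b < 0)
    (h : Labels (· < ·) [t] b (u ++ [b])) : ∀ x ∈ u, b < x := by
  have hlt : ∀ x y : ℝ, x < y → x ≤ y := fun _ _ => le_of_lt
  intro x hx
  cases t with
  | cutEdge t =>
    rw [singleton_cutEdge_iff] at h
    exact hb.trans_le (h.le_of_mem hlt x (by simp [hx]))
  | cutVertex fs =>
    rw [singleton_cutVertex_iff] at h
    exact hb.trans_le (h.2.le_of_mem hlt x (by simp [hx]))
  | red cs =>
    rw [singleton_red_iff] at h
    obtain ⟨g, h1, h2, h3, h4⟩ := h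
    exact h1.trans_le (h4.le_of_mem hlt h2.le x (by simp [hx]))

/-- As for plane forests, the list is split at its first entry `b`. This needs `b < 0`, since
otherwise the labels of the blue parts need not exceed `b`. -/
theorem Labels.unique (hb : b < 0) (h : Labels (· < ·) cs b u) (h' : Labels (· < ·) ds b u) :
    cs = ds := by
  have step : ∀ {s : ColoredTree} {cs ds : List ColoredTree} {b : ℝ} {u v w : List ℝ}, b < 0 →
      Labels (· < ·) [s] b (u ++ [b]) → w = u ++ b :: v → Labels (· < ·) ds b w →
      (∀ t, Labels (· < ·) [t] b (u ++ [b]) → s = t) →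
      (∀ {ds}, Labels (· < ·) ds b v → cs = ds) → s :: cs = ds := by
    intro s cs ds b u v w hb hs hw h' hst ih
    cases ds with
    | nil => cases h'; simp at hw
    | cons t ds =>
      obtain ⟨w₁, w₂, rfl, h1, h2⟩ := of_append (l := [t]) h'
      obtain ⟨w₁, rfl⟩ := h1.exists_eq_append (by simp)
      obtain ⟨rfl, rfl⟩ := PlaneTree.eq_of_append_cons_eq (v := w₂) (by simpa using hw)
        (fun hx => (h1.forall_lt_of_singleton hb _ hx).false)
        (fun hx => (hs.forall_lt_of_singleton hb _ hx).false)
      rw [hst _ h1, ih h2]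
  induction h generalizing ds with
  | nil b =>
    generalize hw : [] = w at h'
    cases h' <;> simp_all
  | @cutEdge t cs b u v h1 _ ih =>
    have h0 : Labels (· < ·) [ColoredTree.cutEdge t] b (u ++ [b]) := singleton_cutEdge_iff.2 h1
    exact step hb h0 rfl h' (fun t ht => h0.singleton_unique (by simp) ht) fun h => ih hb h
  | @cutVertex fs cs b u v h2 h1 _ ih =>
    have h0 : Labels (· < ·) [ColoredTree.cutVertex fs] b (u ++ [b]) :=
      singleton_cutVertex_iff.2 ⟨h2, h1⟩
    exact step hb h0 rfl h' (fun t ht => h0.singleton_unique (by simp) ht) fun h => ih hb h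
  | @red cs ds' b g u v h1 h2 h3 h4 _ ih1 ih =>
    have h0 : Labels (· < ·) [ColoredTree.red ds'] b (u ++ [b]) :=
      singleton_red_iff.2 ⟨g, h1, h2, h3, h4⟩
    refine step hb h0 rfl h' (fun t ht => h0.singleton_unique ?_ ht) fun h => ih hb h
    rintro cs' g' h6 h7 h8 h9 ds h10
    obtain rfl := ColoredTree.red.inj h6
    obtain rfl := h4.bottom_unique (fun _ _ => le_of_lt) h9 h3 h3 h2.le h8.le
    exact ih1 h2 h10

/-- Sequences of moves. -/
abbrev Moves : ColoredTree → ColoredTree → Prop :=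
  Relation.ReflTransGen Move

end ColoredTree

/-! ### Moves that turn weak labels into strict ones -/

namespace ColoredTree

variable {r : ℝ → ℝ → Prop} {b c : ℝ} {u v : List ℝ} {cs ds l : List ColoredTree}

/-- Moves in a forest attached to a red vertex. -/
def ForestMove (cs ds : List ColoredTree) : Prop :=
  Move (red cs) (red ds)

theorem ForestMove.append_left (h : ForestMove cs ds) (l : List ColoredTree) :
    ForestMove (l ++ cs) (l ++ ds) := by
  cases h with
  | contractRed l' cs r => simpa [ForestMove] using Move.contractRed (l ++ l') cs r
  | above l' r h => simpa [ForestMove] using Move.above (l ++ l') r h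

theorem ForestMove.append_right (h : ForestMove cs ds) (l : List ColoredTree) :
    ForestMove (cs ++ l) (ds ++ l) := by
  cases h with
  | contractRed l' cs r => simpa [ForestMove] using Move.contractRed l' cs (r ++ l)
  | above l' r h => simpa [ForestMove] using Move.above l' (r ++ l) h

/-- Sequences of moves in a forest attached to a red vertex. -/
abbrev ForestMoves : List ColoredTree → List ColoredTree → Prop :=
  Relation.ReflTransGen ForestMove

theorem ForestMoves.append {cs' ds' : List ColoredTree} (h : ForestMoves cs ds)
    (h' : ForestMoves cs' ds') : ForestMoves (cs ++ cs') (ds ++ ds') :=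
  (Relation.ReflTransGen.lift (p := ForestMove) (· ++ cs')
    (fun _ _ h => ForestMove.append_right h cs') _ _ h).trans
  (Relation.ReflTransGen.lift (p := ForestMove) (ds ++ ·)
    (fun _ _ h => ForestMove.append_left h ds) _ _ h')

theorem ForestMoves.moves (h : ForestMoves cs ds) : Moves (red cs) (red ds) :=
  Relation.ReflTransGen.lift (p := Move) red (fun _ _ h => h) _ _ h

theorem Moves.forestMoves {s t : ColoredTree} (h : Moves s t) : ForestMoves [s] [t] :=
  Relation.ReflTransGen.lift (p := ForestMove) (fun s => [s])
    (fun _ _ h => Move.above [] [] h) _ _ h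

theorem moves_cutVertex {fs gs : List PlaneTree} (h : PlaneTree.Contractions fs gs) :
    Moves (cutVertex fs) (cutVertex gs) :=
  Relation.ReflTransGen.lift (p := Move) cutVertex (fun _ _ h => .contractAboveCut h) _ _ h

theorem moves_cutEdge {fs gs : List PlaneTree} (h : PlaneTree.Contractions fs gs) :
    Moves (cutEdge (.node fs)) (cutEdge (.node gs)) :=
  Relation.ReflTransGen.lift (p := Move) (fun fs => cutEdge (.node fs))
    (fun _ _ h => .contractBlue h) _ _ h

theorem exists_strict_cutVertex {fs : List PlaneTree} (hfs : 2 ≤ fs.length)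
    (h : PlaneTree.Labels (· ≤ ·) fs 0 (u ++ [0])) :
    ∃ T, Moves (cutVertex fs) T ∧ ∀ b, Labels (· < ·) [T] b (u ++ [b]) := by
  obtain ⟨gs, h1, h2, h3⟩ := h.exists_strict
  exact ⟨_, moves_cutVertex h1, fun b => Labels.singleton_cutVertex_iff.2 ⟨hfs.trans h2, h3⟩⟩

theorem exists_strict_cutEdge {t : PlaneTree} (h : PlaneTree.Labels (· ≤ ·) [t] 0 (u ++ [0])) :
    ∃ T, Moves (cutEdge t) T ∧ ∀ b, Labels (· < ·) [T] b (u ++ [b]) := by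
  cases t with
  | leaf =>
    refine ⟨_, .refl, fun b => Labels.singleton_cutEdge_iff.2 ?_⟩
    rw [PlaneTree.Labels.singleton_leaf_iff] at h ⊢
    exact h
  | node fs =>
    rw [PlaneTree.Labels.singleton_node_iff] at h
    obtain ⟨g, h1, h2, h3⟩ := h
    rcases h1.eq_or_lt with rfl | h1
    · obtain ⟨T, h4, h5⟩ := exists_strict_cutVertex h2 h3
      exact ⟨T, h4.head (.cutUp fs), h5⟩
    · obtain ⟨gs, h4, h5, h6⟩ := h3.exists_strict
      exact ⟨_, moves_cutEdge h4, fun b => Labels.singleton_cutEdge_iff.2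
        (PlaneTree.Labels.singleton_node_iff.2 ⟨g, h1, h2.trans h5, h6⟩)⟩

/-- A red vertex above the label `0` would need a label `g` with `0 < g < 0`. So only blue trees and
cuts occur, and the cut can move down to the common vertex. -/
theorem Labels.exists_aboveCut (h : Labels (· < ·) cs 0 u) :
    ∃ fs : List (List PlaneTree), List.Forall₂ (fun c f => c.aboveCut = some f) cs fs ∧
      cs.length ≤ fs.flatten.length ∧ PlaneTree.Labels (· < ·) fs.flatten 0 u := by
  generalize hb : (0 : ℝ) = b at h
  induction h with
  | nil => subst hb; exact ⟨[], .nil, by simp, .nil 0⟩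
  | cutEdge h1 _ ih =>
    subst hb
    obtain ⟨fs, h2, h3, h4⟩ := ih rfl
    exact ⟨_ :: fs, .cons rfl h2, by simpa using h3, by simpa using h1.append h4⟩
  | cutVertex h0 h1 _ ih =>
    subst hb
    obtain ⟨fs, h2, h3, h4⟩ := ih rfl
    exact ⟨_ :: fs, .cons rfl h2, by simp at h3 ⊢; omega, by simpa using h1.append h4⟩
  | red h1 h2 =>
    subst hb
    exact absurd h1 h2.not_gt

theorem exists_strict_red {g : ℝ} (hg : g ≤ 0) (hcs : 2 ≤ cs.length) (hcd : cs.length ≤ ds.length)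
    (h : ForestMoves cs ds) (hu : Labels (· < ·) ds g (u ++ [g])) :
    ∃ T, Moves (red cs) T ∧ ∀ b < g, Labels (· < ·) [T] b (u ++ [b]) := by
  rcases hg.eq_or_lt with rfl | hg
  · obtain ⟨fs, h1, h2, h3⟩ := hu.exists_aboveCut
    exact ⟨_, h.moves.tail (.cutDown h1), fun b _ => Labels.singleton_cutVertex_iff.2
      ⟨by omega, h3⟩⟩
  · exact ⟨_, h.moves, fun b hb => Labels.singleton_red_iff.2 ⟨g, hb, hg, by omega, hu⟩⟩

/-- Two adjacent vertices with the same label are merged by a contraction; a blue or red vertex of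
label `0` next to the cut absorbs the cut. The bound on lengths ensures that vertices keep at least
two inputs. -/
theorem Labels.exists_strict (h : Labels (· ≤ ·) cs b u) :
    ∃ ds, ForestMoves cs ds ∧ cs.length ≤ ds.length ∧ Labels (· < ·) ds b u := by
  induction h with
  | nil b => exact ⟨[], .refl, le_rfl, .nil b⟩
  | cutEdge h1 _ ih =>
    obtain ⟨ds, h2, h3, h4⟩ := ih
    obtain ⟨T, h5, h6⟩ := exists_strict_cutEdge h1
    exact ⟨[T] ++ ds, h5.forestMoves.append h2, by simpa using h3, by simpa using (h6 _).append h4⟩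
  | cutVertex h0 h1 _ ih =>
    obtain ⟨ds, h2, h3, h4⟩ := ih
    obtain ⟨T, h5, h6⟩ := exists_strict_cutVertex h0 h1
    exact ⟨[T] ++ ds, h5.forestMoves.append h2, by simpa using h3, by simpa using (h6 _).append h4⟩
  | @red cs ds b g u v h0 h1 h2 h3 _ ih1 ih =>
    obtain ⟨cs', h4, h5, h6⟩ := ih
    obtain ⟨ds', h7, h8, h9⟩ := ih1
    rcases h0.eq_or_lt with rfl | h0
    · have h10 : ForestMoves [ColoredTree.red ds'] ds' :=
        .single (by simpa [ForestMove] using Move.contractRed [] ds' [])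
      exact ⟨ds' ++ cs', ForestMoves.append (h7.moves.forestMoves.trans h10) h4, by simp; omega,
        by simpa using h9.append h6⟩
    · obtain ⟨T, h10, h11⟩ := exists_strict_red h1 h2 h8 h7 h9
      exact ⟨[T] ++ cs', h10.forestMoves.append h4, by simpa using h5,
        by simpa using (h11 _ h0).append h6⟩

/-! ### Labellings of 2-colored trees -/

/-- `T.HasLabels r u`: the list `u` is obtained from a labelling of the vertices of `T` by listing
the labels of the vertices at which two consecutive leaves meet. -/
def HasLabels (r : ℝ → ℝ → Prop) (T : ColoredTree) (u : List ℝ) : Prop :=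
  ∃ b < 0, Labels r [T] b (u ++ [b])

variable {S T : ColoredTree}

theorem HasLabels.length_eq (h : T.HasLabels r u) : u.length + 1 = T.leaves := by
  obtain ⟨b, -, h⟩ := h
  simpa using h.length_eq

theorem HasLabels.exists_strict (h : T.HasLabels (· ≤ ·) u) :
    ∃ T', Moves T T' ∧ T'.HasLabels (· < ·) u := by
  obtain ⟨b, hb, h⟩ := h
  cases T with
  | cutEdge t =>
    obtain ⟨T', h1, h2⟩ := exists_strict_cutEdge (Labels.singleton_cutEdge_iff.1 h)
    exact ⟨T', h1, b, hb, h2 b⟩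
  | cutVertex fs =>
    rw [Labels.singleton_cutVertex_iff] at h
    obtain ⟨T', h1, h2⟩ := exists_strict_cutVertex h.1 h.2
    exact ⟨T', h1, b, hb, h2 b⟩
  | red cs =>
    rw [Labels.singleton_red_iff] at h
    obtain ⟨g, h1, h2, h3, h4⟩ := h
    obtain ⟨ds, h5, h6, h7⟩ := h4.exists_strict
    obtain ⟨T', h8, h9⟩ := exists_strict_red h2 h3 h6 h5 h7
    exact ⟨T', h8, g - 1, by linarith, h9 _ (by linarith)⟩

theorem HasLabels.unique (h : S.HasLabels (· < ·) u) (h' : T.HasLabels (· < ·) u) : S = T := by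
  obtain ⟨b, hb, h⟩ := h
  obtain ⟨c, hc, h'⟩ := h'
  have hr : ∀ x y z : ℝ, x ≤ y → y < z → x < z := fun _ _ _ => lt_of_le_of_lt
  have := (h.singleton_mono hr (min_le_left b c)).unique (min_lt_of_left_lt hb)
    (h'.singleton_mono hr (min_le_right b c))
  simpa using this

theorem exists_labels (hcs : ∀ T ∈ cs, ∀ b < 0, ∃ u, Labels (· < ·) [T] b (u ++ [b])) (hb : b < 0) :
    ∃ u, Labels (· < ·) cs b u := by
  induction cs with
  | nil => exact ⟨[], .nil b⟩
  | cons t cs ih =>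
    obtain ⟨u, hu⟩ := hcs t (by simp) b hb
    obtain ⟨v, hv⟩ := ih fun t ht => hcs t (by simp [ht])
    exact ⟨_, hu.append hv⟩

theorem Reduced.exists_labels (h : T.Reduced) (hb : b < 0) :
    ∃ u, Labels (· < ·) [T] b (u ++ [b]) := by
  induction h generalizing b with
  | cutEdge t h =>
    obtain ⟨u, hu⟩ := h.exists_labels 0
    exact ⟨u, Labels.singleton_cutEdge_iff.2 hu⟩
  | cutVertex fs h h' =>
    obtain ⟨u, hu⟩ := PlaneTree.exists_labels h' 0
    obtain ⟨u, rfl⟩ := hu.exists_eq_append (by rintro rfl; simp at h)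
    exact ⟨u, Labels.singleton_cutVertex_iff.2 ⟨h, hu⟩⟩
  | red cs h _ ih =>
    -- Halving the negative label at each red vertex lets the labels increase strictly while they
    -- stay below `0`.
    obtain ⟨u, hu⟩ := ColoredTree.exists_labels (b := b / 2) (fun T hT b hb => ih T hT hb)
      (by linarith)
    obtain ⟨u, rfl⟩ := hu.exists_eq_append (by rintro rfl; simp at h)
    exact ⟨u, Labels.singleton_red_iff.2 ⟨b / 2, by linarith, by linarith, h, hu⟩⟩

theorem Reduced.exists_hasLabels (h : T.Reduced) : ∃ u, T.HasLabels (· < ·) u := by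
  obtain ⟨u, hu⟩ := h.exists_labels neg_one_lt_zero
  exact ⟨u, -1, neg_one_lt_zero, hu⟩

theorem aboveCut_labels {fs : List (List PlaneTree)}
    (h : List.Forall₂ (fun c f => c.aboveCut = some f) cs fs) (hcs : ∀ c ∈ cs, c.Reduced)
    (hu : PlaneTree.Labels (· ≤ ·) fs.flatten 0 u) : Labels (· ≤ ·) cs 0 u := by
  induction h generalizing u with
  | nil => cases hu; exact .nil 0
  | @cons c f cs fs h _ ih =>
    obtain ⟨u₁, u₂, rfl, h1, h2⟩ := hu.of_append
    refine Labels.append (l := [c]) ?_ (ih (fun c hc => hcs c (by simp [hc])) h2)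
    have hc := hcs c (by simp)
    cases c with
    | cutEdge t =>
      obtain rfl := Option.some.inj h
      obtain ⟨v, rfl⟩ := h1.exists_eq_append (by simp)
      exact Labels.singleton_cutEdge_iff.2 h1
    | cutVertex gs =>
      obtain rfl := Option.some.inj h
      cases hc with
      | cutVertex _ h3 =>
        obtain ⟨v, rfl⟩ := h1.exists_eq_append (by rintro rfl; simp at h3)
        exact Labels.singleton_cutVertex_iff.2 ⟨h3, h1⟩
    | red ds => cases h

/-- Labels that increase weakly still do so after a move downwards in the face order. -/
theorem Move.labels (h : Move S T) (hS : S.Reduced) (hb : b ≤ 0)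
    (hu : Labels (· ≤ ·) [T] b (u ++ [b])) : Labels (· ≤ ·) [S] b (u ++ [b]) := by
  induction h generalizing b u with
  | contractBlue h =>
    cases hS with
    | cutEdge _ hS =>
      exact Labels.singleton_cutEdge_iff.2 ((PlaneTree.Contraction.inside [] [] h).labels
        (by simpa using hS) (Labels.singleton_cutEdge_iff.1 hu))
  | contractAboveCut h =>
    cases hS with
    | cutVertex _ h1 h2 =>
      rw [Labels.singleton_cutVertex_iff] at hu ⊢
      exact ⟨h1, h.labels h2 hu.2⟩
  | contractRed l cs r =>
    cases hS with
    | red _ h1 h2 =>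
      rw [Labels.singleton_red_iff] at hu ⊢
      obtain ⟨g, h3, h4, h5, h6⟩ := hu
      refine ⟨g, h3, h4, h1, ?_⟩
      obtain ⟨u₁, u₃, h7, h8, h9⟩ := h6.of_append
      obtain ⟨u₁, u₂, rfl, h12, h10⟩ := h8.of_append
      rw [h7]
      have h11 := h2 (ColoredTree.red cs) (by simp)
      cases h11 with
      | red _ h11 =>
        obtain ⟨v, rfl⟩ := h10.exists_eq_append (by rintro rfl; simp at h11)
        simpa using h12.append (.red le_rfl h4 h11 h10 h9)
  | cutUp cs =>
    rw [Labels.singleton_cutVertex_iff] at hu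
    exact Labels.singleton_cutEdge_iff.2
      (PlaneTree.Labels.singleton_node_iff.2 ⟨0, le_rfl, hu.1, hu.2⟩)
  | cutDown h =>
    cases hS with
    | red _ h1 h2 =>
      rw [Labels.singleton_cutVertex_iff] at hu
      exact Labels.singleton_red_iff.2 ⟨0, hb, le_rfl, h1, aboveCut_labels h h2 hu.2⟩
  | @above l r s t h ih =>
    cases hS with
    | red _ h1 h2 =>
      rw [Labels.singleton_red_iff] at hu ⊢
      obtain ⟨g, h3, h4, h5, h6⟩ := hu
      refine ⟨g, h3, h4, h1, ?_⟩
      obtain ⟨u₁, u₃, h7, h8, h9⟩ := h6.of_append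
      obtain ⟨u₂, u₃, rfl, h9, h10⟩ := h9.of_append (l := [t])
      rw [h7]
      obtain ⟨v, rfl⟩ := h9.exists_eq_append (by simp)
      exact h8.append ((ih (h2 s (by simp)) h4 h9).append h10)

theorem Move.hasLabels (h : Move S T) (hS : S.Reduced) (hu : T.HasLabels (· ≤ ·) u) :
    S.HasLabels (· ≤ ·) u := by
  obtain ⟨b, hb, hu⟩ := hu
  exact ⟨b, hb, h.labels hS hb.le hu⟩

theorem aboveCut_length {fs : List (List PlaneTree)}
    (h : List.Forall₂ (fun c f => c.aboveCut = some f) cs fs) (hcs : ∀ c ∈ cs, c.Reduced) :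
    cs.length ≤ fs.flatten.length ∧ ∀ t ∈ fs.flatten, t.Reduced := by
  induction h with
  | nil => simp
  | @cons c f cs fs h _ ih =>
    obtain ⟨h1, h2⟩ := ih fun c hc => hcs c (by simp [hc])
    have hc := hcs c (by simp)
    cases c with
    | cutEdge t =>
      obtain rfl := Option.some.inj h
      cases hc
      simp at *; grind
    | cutVertex gs =>
      obtain rfl := Option.some.inj h
      cases hc
      simp at *; grind
    | red ds => cases h

theorem Move.reduced (h : Move S T) (hS : S.Reduced) : T.Reduced := by
  induction h with
  | contractBlue h =>
    cases hS with
    | cutEdge _ hS =>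
      cases hS with
      | node _ h1 h2 => exact .cutEdge _ (.node _ (h1.trans (h.length_le h2)) (h.reduced h2))
  | contractAboveCut h =>
    cases hS with
    | cutVertex _ h1 h2 => exact .cutVertex _ (h1.trans (h.length_le h2)) (h.reduced h2)
  | contractRed l cs r =>
    cases hS with
    | red _ h1 h2 =>
      have h3 := h2 (ColoredTree.red cs) (by simp)
      cases h3 with
      | red _ h3 h4 =>
        refine .red _ (by simp; omega) ?_
        simp at h2 ⊢; grind
  | cutUp cs =>
    cases hS with
    | cutEdge _ hS =>
      cases hS with
      | node _ h1 h2 => exact .cutVertex _ h1 h2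
  | cutDown h =>
    cases hS with
    | red _ h1 h2 =>
      obtain ⟨h3, h4⟩ := aboveCut_length h h2
      exact .cutVertex _ (h1.trans h3) h4
  | @above l r s t h ih =>
    cases hS with
    | red _ h1 h2 =>
      have := ih (h2 s (by simp))
      refine .red _ (by simpa using h1) ?_
      simp at h2 ⊢; grind

theorem aboveCut_leaves {fs : List (List PlaneTree)}
    (h : List.Forall₂ (fun c f => c.aboveCut = some f) cs fs) :
    (cs.map leaves).sum = (fs.flatten.map PlaneTree.leaves).sum := by
  induction h with
  | nil => simp
  | @cons c f cs fs h _ ih =>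
    cases c <;> simp [aboveCut] at h <;> simp [leaves, ih, ← h]

theorem Move.leaves_eq (h : Move S T) : S.leaves = T.leaves := by
  induction h with
  | contractBlue h => simp [leaves, PlaneTree.leaves, h.leaves_eq]
  | contractAboveCut h => simp [leaves, h.leaves_eq]
  | contractRed l cs r => simp [leaves]
  | cutUp cs => simp [leaves, PlaneTree.leaves]
  | cutDown h => simp [leaves, aboveCut_leaves h]
  | above l r h ih => simp [leaves, ih]

/-- The number of vertices that are not in the cut. -/
def codim : ColoredTree → ℕ
  | cutEdge t => t.vertices
  | cutVertex fs => (fs.map PlaneTree.vertices).sum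
  | red cs => (cs.map codim).sum + 1

theorem aboveCut_codim {fs : List (List PlaneTree)}
    (h : List.Forall₂ (fun c f => c.aboveCut = some f) cs fs) :
    (cs.map codim).sum = (fs.flatten.map PlaneTree.vertices).sum := by
  induction h with
  | nil => simp
  | @cons c f cs fs h _ ih =>
    cases c <;> simp [aboveCut] at h <;> simp [codim, ih, ← h]

/-- The face order is thus graded, which gives its antisymmetry and the minimality of the atomic
trees, whose codimension is maximal. -/
theorem Move.codim_eq (h : Move S T) : S.codim = T.codim + 1 := by
  induction h with
  | contractBlue h => simp [codim, PlaneTree.vertices, h.vertices_eq]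
  | contractAboveCut h => simp [codim, h.vertices_eq]
  | contractRed l cs r => simp [codim]; ring
  | cutUp cs => simp [codim, PlaneTree.vertices]
  | cutDown h => simp [codim, aboveCut_codim h]
  | above l r h ih => simp [codim, ih]; ring

end ColoredTree

theorem List.append_cons_inj_of_length_eq {α : Type*} {a b : α} {u u' v v' : List α}
    (h : u ++ a :: v = u' ++ b :: v') (hu : u.length = u'.length) : u = u' ∧ a = b ∧ v = v' := by
  obtain ⟨h1, h2⟩ := List.append_inj h hu
  simp_all

/-! ### Refinements by binary trees -/

namespace PlaneTree

variable {b : ℝ} {u : List ℝ} {cs ds : List PlaneTree}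

/-- Contractions of edges of a tree. -/
abbrev Refines : PlaneTree → PlaneTree → Prop :=
  Relation.ReflTransGen fun s t => (ColoredTree.cutEdge s).Move (.cutEdge t)

theorem Contractions.refines (h : Contractions cs ds) : Refines (.node cs) (.node ds) :=
  Relation.ReflTransGen.lift PlaneTree.node (fun _ _ h => .contractBlue h) _ _ h

theorem Refines.contractions {s t : PlaneTree} (h : Refines s t) : Contractions [s] [t] :=
  Relation.ReflTransGen.lift (p := Contraction) (fun s => [s])
    (fun _ _ h => by cases h with | contractBlue h => exact .inside [] [] h) _ _ h

theorem Refines.moves {s t : PlaneTree} (h : Refines s t) :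
    ColoredTree.Moves (.cutEdge s) (.cutEdge t) :=
  Relation.ReflTransGen.lift (p := ColoredTree.Move) ColoredTree.cutEdge (fun _ _ h => h) _ _ h

theorem Refines.leaves_eq {s t : PlaneTree} (h : Refines s t) : s.leaves = t.leaves := by
  induction h with
  | refl => rfl
  | tail _ h ih => simpa [ColoredTree.leaves, ih] using h.leaves_eq

/-- The weakly increasing labellings of `t` are those of all the binary trees below `t`. -/
def Detected (t : PlaneTree) : Prop :=
  (∃ s : BinaryTree Unit, Refines s.toPlaneTree t) ∧
    ∀ b u, (∀ s : BinaryTree Unit, Refines s.toPlaneTree t →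
      Labels (· ≤ ·) [s.toPlaneTree] b (u ++ [b])) → Labels (· ≤ ·) [t] b (u ++ [b])

theorem Detected.node_pair {c d : PlaneTree} (hc : c.Detected) (hd : d.Detected) :
    (PlaneTree.node [c, d]).Detected := by
  obtain ⟨⟨s, hs⟩, hc⟩ := hc
  obtain ⟨⟨t, ht⟩, hd⟩ := hd
  have key : ∀ s t : BinaryTree Unit, Refines s.toPlaneTree c → Refines t.toPlaneTree d →
      Refines (BinaryTree.node () s t).toPlaneTree (.node [c, d]) := fun s t hs ht =>
    (hs.contractions.append ht.contractions).refines
  refine ⟨⟨.node () s t, key s t hs ht⟩, fun b u h => ?_⟩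
  -- The gap of the root vertex is placed by the number of leaves of `c` alone. Hence `g` and the
  -- lists on its two sides are common to all choices of `s` and `t`, and one of the trees may vary
  -- while the other is fixed; this is why `Detected` includes existence.
  have split : ∀ s t : BinaryTree Unit, Refines s.toPlaneTree c → Refines t.toPlaneTree d →
      ∃ g u₁ u₂, u = u₁ ++ g :: u₂ ∧ b ≤ g ∧ Labels (· ≤ ·) [s.toPlaneTree] g (u₁ ++ [g]) ∧
        Labels (· ≤ ·) [t.toPlaneTree] g (u₂ ++ [g]) ∧ u₁.length + 1 = c.leaves := by
    intro s t hs ht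
    obtain ⟨g, h1, -, h2⟩ := Labels.singleton_node_iff.1 (h _ (key s t hs ht))
    obtain ⟨u₁, u₂, h3, h4, h5⟩ := h2.exists_split (by simp)
    refine ⟨g, u₁, u₂, h3, h1, h4, h5, ?_⟩
    simpa [hs.leaves_eq] using h4.length_eq
  obtain ⟨g, u₁, u₂, rfl, hbg, -, -, hl⟩ := split s t hs ht
  have hc' := hc g u₁ fun s' hs' => by
    obtain ⟨g', u₁', u₂', h1, -, h2, -, h3⟩ := split s' t hs' ht
    obtain ⟨rfl, rfl, -⟩ := List.append_cons_inj_of_length_eq h1 (by omega)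
    exact h2
  have hd' := hd g u₂ fun t' ht' => by
    obtain ⟨g', u₁', u₂', h1, -, -, h2, h3⟩ := split s t' hs ht'
    obtain ⟨-, rfl, rfl⟩ := List.append_cons_inj_of_length_eq h1 (by omega)
    exact h2
  exact Labels.singleton_node_iff.2 ⟨g, hbg, le_rfl, by simpa using hc'.cons hd'⟩

theorem Detected.of_refines {t t₁ t₂ : PlaneTree} (h₁ : t₁.Detected) (h₂ : t₂.Detected)
    (ht₁ : Refines t₁ t) (ht₂ : Refines t₂ t)
    (h : ∀ b u, Labels (· ≤ ·) [t₁] b (u ++ [b]) → Labels (· ≤ ·) [t₂] b (u ++ [b]) →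
      Labels (· ≤ ·) [t] b (u ++ [b])) : t.Detected := by
  obtain ⟨⟨s, hs⟩, h₁⟩ := h₁
  exact ⟨⟨s, hs.trans ht₁⟩, fun b u hu => h b u (h₁ b u fun s hs => hu s (hs.trans ht₁))
    (h₂.2 b u fun s hs => hu s (hs.trans ht₂))⟩

/-- A vertex with at least three inputs arises by contraction from two trees: one groups the first
two inputs, the other groups all inputs but the first. In the first tree the label of the first gap
is at least that of the others, in the second tree at most; together they force equality. Both trees
involve shorter lists of inputs. -/
theorem Detected.node {cs : List PlaneTree} (hcs : 2 ≤ cs.length) (h : ∀ c ∈ cs, c.Detected) :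
    (PlaneTree.node cs).Detected := by
  match cs, hcs with
  | [c, d], _ => exact node_pair (h c (by simp)) (h d (by simp))
  | c :: d :: e :: l, _ =>
    have hcd := node_pair (h c (by simp)) (h d (by simp))
    refine of_refines (t₁ := .node (.node [c, d] :: e :: l)) (t₂ := .node [c, .node (d :: e :: l)])
      (Detected.node (by simp) ?_)
      (node_pair (h c (by simp)) (Detected.node (by simp) ?_))
      (.single (.contractBlue (.edge [] [c, d] (e :: l))))
      (.single (.contractBlue (by simpa using Contraction.edge [c] (d :: e :: l) []))) ?_
    · simp at h ⊢; grind
    · simp at h ⊢; grind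
    · intro b u h₁ h₂
      obtain ⟨g, h1, -, h2⟩ := Labels.singleton_node_iff.1 h₁
      obtain ⟨x, y, rfl, h3, h4⟩ := h2.exists_split (by simp)
      obtain ⟨g₁, h5, -, h6⟩ := Labels.singleton_node_iff.1 h3
      obtain ⟨x₁, x₂, rfl, h7, h8⟩ := h6.exists_split (by simp)
      obtain ⟨g', h1', -, h2'⟩ := Labels.singleton_node_iff.1 h₂
      obtain ⟨z₁, z₂, h9, h10, h11⟩ := h2'.exists_split (by simp)
      obtain ⟨g₁', h12, -, h13⟩ := Labels.singleton_node_iff.1 h11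
      obtain ⟨w₁, w₂, rfl, h14, h15⟩ := h13.exists_split (by simp)
      have e1 := h7.length_eq
      have e2 := h8.length_eq
      have e3 := h10.length_eq
      have e4 := h14.length_eq
      simp only [List.length_append, List.length_singleton] at e1 e2 e3 e4
      rw [List.append_assoc, List.cons_append] at h9
      obtain ⟨rfl, rfl, h16⟩ := List.append_cons_inj_of_length_eq h9 (by omega)
      obtain ⟨rfl, rfl, rfl⟩ := List.append_cons_inj_of_length_eq h16 (by omega)
      obtain rfl := le_antisymm h5 h12
      exact Labels.singleton_node_iff.2 ⟨g, h1, by simp, by simpa using h7.cons (h8.cons h4)⟩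
termination_by cs.length

theorem Reduced.detected {t : PlaneTree} (h : t.Reduced) : t.Detected := by
  induction h with
  | leaf => exact ⟨⟨.nil, .refl⟩, fun b u h => h .nil .refl⟩
  | node cs h _ ih => exact .node h ih

end PlaneTree

namespace ColoredTree

variable {b : ℝ} {u : List ℝ} {cs ds : List ColoredTree}

theorem Moves.leaves_eq {s t : ColoredTree} (h : Moves s t) : s.leaves = t.leaves := by
  induction h with
  | refl => rfl
  | tail _ h ih => rw [ih, h.leaves_eq]

/-- The weakly increasing labellings of `T` are those of all the atomic trees below `T`. -/
def Detected (T : ColoredTree) : Prop :=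
  (∃ s : ColoredBinaryTree, Moves s.toColoredTree T) ∧
    ∀ b u, (∀ s : ColoredBinaryTree, Moves s.toColoredTree T →
      Labels (· ≤ ·) [s.toColoredTree] b (u ++ [b])) → Labels (· ≤ ·) [T] b (u ++ [b])

theorem Detected.red_pair {c d : ColoredTree} (hc : c.Detected) (hd : d.Detected) :
    (ColoredTree.red [c, d]).Detected := by
  obtain ⟨⟨s, hs⟩, hc⟩ := hc
  obtain ⟨⟨t, ht⟩, hd⟩ := hd
  have key : ∀ s t : ColoredBinaryTree, Moves s.toColoredTree c → Moves t.toColoredTree d →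
      Moves (ColoredBinaryTree.red s t).toColoredTree (.red [c, d]) := fun s t hs ht =>
    (hs.forestMoves.append ht.forestMoves).moves
  refine ⟨⟨.red s t, key s t hs ht⟩, fun b u h => ?_⟩
  have split : ∀ s t : ColoredBinaryTree, Moves s.toColoredTree c → Moves t.toColoredTree d →
      ∃ g u₁ u₂, u = u₁ ++ g :: u₂ ∧ b ≤ g ∧ g ≤ 0 ∧
        Labels (· ≤ ·) [s.toColoredTree] g (u₁ ++ [g]) ∧
        Labels (· ≤ ·) [t.toColoredTree] g (u₂ ++ [g]) ∧ u₁.length + 1 = c.leaves := by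
    intro s t hs ht
    obtain ⟨g, h1, h0, -, h2⟩ := Labels.singleton_red_iff.1 (h _ (key s t hs ht))
    obtain ⟨u₁, u₂, h3, h4, h5⟩ := h2.exists_split (by simp)
    refine ⟨g, u₁, u₂, h3, h1, h0, h4, h5, ?_⟩
    simpa [hs.leaves_eq] using h4.length_eq
  obtain ⟨g, u₁, u₂, rfl, hbg, hg, -, -, hl⟩ := split s t hs ht
  have hc' := hc g u₁ fun s' hs' => by
    obtain ⟨g', u₁', u₂', h1, -, -, h2, -, h3⟩ := split s' t hs' ht
    obtain ⟨rfl, rfl, -⟩ := List.append_cons_inj_of_length_eq h1 (by omega)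
    exact h2
  have hd' := hd g u₂ fun t' ht' => by
    obtain ⟨g', u₁', u₂', h1, -, -, -, h2, h3⟩ := split s t' hs ht'
    obtain ⟨-, rfl, rfl⟩ := List.append_cons_inj_of_length_eq h1 (by omega)
    exact h2
  exact Labels.singleton_red_iff.2 ⟨g, hbg, hg, le_rfl, by simpa using hc'.cons hd'⟩

theorem Detected.of_moves {T T₁ T₂ : ColoredTree} (h₁ : T₁.Detected) (h₂ : T₂.Detected)
    (hT₁ : Moves T₁ T) (hT₂ : Moves T₂ T)
    (h : ∀ b u, Labels (· ≤ ·) [T₁] b (u ++ [b]) → Labels (· ≤ ·) [T₂] b (u ++ [b]) →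
      Labels (· ≤ ·) [T] b (u ++ [b])) : T.Detected := by
  obtain ⟨⟨s, hs⟩, h₁⟩ := h₁
  exact ⟨⟨s, hs.trans hT₁⟩, fun b u hu => h b u (h₁ b u fun s hs => hu s (hs.trans hT₁))
    (h₂.2 b u fun s hs => hu s (hs.trans hT₂))⟩

theorem Detected.red {cs : List ColoredTree} (hcs : 2 ≤ cs.length) (h : ∀ c ∈ cs, c.Detected) :
    (ColoredTree.red cs).Detected := by
  match cs, hcs with
  | [c, d], _ => exact red_pair (h c (by simp)) (h d (by simp))
  | c :: d :: e :: l, _ =>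
    have hcd := red_pair (h c (by simp)) (h d (by simp))
    refine of_moves (T₁ := .red (.red [c, d] :: e :: l)) (T₂ := .red [c, .red (d :: e :: l)])
      (Detected.red (by simp) ?_)
      (red_pair (h c (by simp)) (Detected.red (by simp) ?_))
      (.single (.contractRed [] [c, d] (e :: l)))
      (.single (by simpa using Move.contractRed [c] (d :: e :: l) [])) ?_
    · simp at h ⊢; grind
    · simp at h ⊢; grind
    · intro b u h₁ h₂
      obtain ⟨g, h1, hg, -, h2⟩ := Labels.singleton_red_iff.1 h₁
      obtain ⟨x, y, rfl, h3, h4⟩ := h2.exists_split (by simp)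
      obtain ⟨g₁, h5, -, -, h6⟩ := Labels.singleton_red_iff.1 h3
      obtain ⟨x₁, x₂, rfl, h7, h8⟩ := h6.exists_split (by simp)
      obtain ⟨g', h1', -, -, h2'⟩ := Labels.singleton_red_iff.1 h₂
      obtain ⟨z₁, z₂, h9, h10, h11⟩ := h2'.exists_split (by simp)
      obtain ⟨g₁', h12, -, -, h13⟩ := Labels.singleton_red_iff.1 h11
      obtain ⟨w₁, w₂, rfl, h14, h15⟩ := h13.exists_split (by simp)
      have e1 := h7.length_eq
      have e2 := h8.length_eq
      have e3 := h10.length_eq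
      have e4 := h14.length_eq
      simp only [List.length_append, List.length_singleton] at e1 e2 e3 e4
      rw [List.append_assoc, List.cons_append] at h9
      obtain ⟨rfl, rfl, h16⟩ := List.append_cons_inj_of_length_eq h9 (by omega)
      obtain ⟨rfl, rfl, rfl⟩ := List.append_cons_inj_of_length_eq h16 (by omega)
      obtain rfl := le_antisymm h5 h12
      exact Labels.singleton_red_iff.2 ⟨g, h1, hg, by simp, by simpa using h7.cons (h8.cons h4)⟩
termination_by cs.length

theorem Detected.cutEdge {t : PlaneTree} (h : t.Detected) : (ColoredTree.cutEdge t).Detected := by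
  obtain ⟨⟨s, hs⟩, h⟩ := h
  exact ⟨⟨.cut s, hs.moves⟩, fun b u hu => Labels.singleton_cutEdge_iff.2
    (h 0 u fun s hs => Labels.singleton_cutEdge_iff.1 (hu (.cut s) hs.moves))⟩

/-- A vertex of the cut is approached from two sides: as a blue vertex just above the cut its label
is nonnegative, as a red vertex just below it nonpositive. The label is therefore `0`. -/
theorem Detected.cutVertex {cs : List PlaneTree} (hcs : 2 ≤ cs.length)
    (h : ∀ c ∈ cs, c.Detected) : (ColoredTree.cutVertex cs).Detected := by
  refine of_moves (T₁ := .cutEdge (.node cs)) (T₂ := .red (cs.map .cutEdge))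
    (Detected.cutEdge (.node hcs h)) (Detected.red (by simpa using hcs) ?_)
    (.single (.cutUp cs)) (.single ?_) ?_
  · simp only [List.mem_map, forall_exists_index, and_imp, forall_apply_eq_imp_iff₂]
    exact fun t ht => Detected.cutEdge (h t ht)
  · have := Move.cutDown (cs := cs.map .cutEdge) (fs := cs.map fun t => [t]) (by
      clear hcs h
      induction cs with
      | nil => exact .nil
      | cons t cs ih => exact .cons rfl ih)
    rwa [← List.flatMap_def, List.flatMap_singleton'] at this
  · intro b u h₁ h₂
    obtain ⟨g, h1, h2, h3⟩ :=
      PlaneTree.Labels.singleton_node_iff.1 (Labels.singleton_cutEdge_iff.1 h₁)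
    obtain ⟨g', h4, h5, h6, h7⟩ := Labels.singleton_red_iff.1 h₂
    match cs, hcs with
    | c :: d :: l, _ =>
      obtain ⟨u₁, u₂, rfl, h8, h9⟩ := h3.exists_split (by simp)
      obtain ⟨v₁, v₂, h10, h11, h12⟩ := Labels.exists_split (cs := (d :: l).map .cutEdge) h7 (by simp)
      have e1 := h8.length_eq
      have e2 := h11.length_eq
      simp only [List.length_append, List.length_singleton, List.map_cons, List.map_nil,
        leaves] at e1 e2
      obtain ⟨rfl, rfl, rfl⟩ := List.append_cons_inj_of_length_eq h10 (by omega)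
      obtain rfl := le_antisymm h1 h5
      exact Labels.singleton_cutVertex_iff.2 ⟨by simp, by simpa using h8.append h9⟩

theorem Reduced.detected {T : ColoredTree} (h : T.Reduced) : T.Detected := by
  induction h with
  | cutEdge t h => exact .cutEdge h.detected
  | cutVertex cs h h' => exact .cutVertex h fun c hc => (h' c hc).detected
  | red cs h _ ih => exact .red h ih

end ColoredTree

/-! ### The face order -/

theorem PlaneTree.Labels.le {cs : List PlaneTree} {b : ℝ} {u : List ℝ}
    (h : Labels (· < ·) cs b u) : Labels (· ≤ ·) cs b u := by
  induction h with
  | nil b => exact .nil b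
  | leaf _ ih => exact ih.leaf
  | node h1 h2 _ _ ih1 ih2 => exact .node h1.le h2 ih1 ih2

theorem ColoredTree.Labels.le {cs : List ColoredTree} {b : ℝ} {u : List ℝ}
    (h : Labels (· < ·) cs b u) : Labels (· ≤ ·) cs b u := by
  induction h with
  | nil b => exact .nil b
  | cutEdge h _ ih => exact .cutEdge h.le ih
  | cutVertex h1 h2 _ ih => exact .cutVertex h1 h2.le ih
  | red h1 h2 h3 _ _ ih1 ih2 => exact .red h1.le h2.le h3 ih1 ih2

theorem ColoredTree.HasLabels.labels {T : ColoredTree} {b : ℝ} {u : List ℝ}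
    (h : T.HasLabels (· ≤ ·) u) (hb : ∀ x ∈ u, b ≤ x) : Labels (· ≤ ·) [T] b (u ++ [b]) := by
  obtain ⟨c, hc, h⟩ := h
  cases T with
  | cutEdge t => exact Labels.singleton_cutEdge_iff.2 (Labels.singleton_cutEdge_iff.1 h)
  | cutVertex fs => exact Labels.singleton_cutVertex_iff.2 (Labels.singleton_cutVertex_iff.1 h)
  | red cs =>
    rw [Labels.singleton_red_iff] at h ⊢
    obtain ⟨g, h1, h2, h3, h4⟩ := h
    exact ⟨g, hb g (h4.mem_of_two_le_length h3), h2, h3, h4⟩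

theorem List.exists_lt_forall_le (u : List ℝ) (c : ℝ) : ∃ b < c, ∀ x ∈ u, b ≤ x := by
  induction u with
  | nil => exact ⟨c - 1, by linarith, by simp⟩
  | cons x u ih =>
    obtain ⟨b, hb, h⟩ := ih
    refine ⟨min b x, min_lt_of_left_lt hb, ?_⟩
    simp only [List.mem_cons, forall_eq_or_imp]
    exact ⟨min_le_right _ _, fun y hy => (min_le_left _ _).trans (h y hy)⟩

namespace CT

variable {n : ℕ} {S T : CT n} {u : List ℝ}

theorem exists_le_of_moves {T' : ColoredTree} (h : ColoredTree.Moves S.1 T') :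
    ∃ T : CT n, T.1 = T' ∧ S ≤ T := by
  induction h with
  | refl => exact ⟨S, rfl, .refl⟩
  | tail _ h ih =>
    obtain ⟨T, rfl, hT⟩ := ih
    exact ⟨⟨_, h.reduced T.2.1, h.leaves_eq ▸ T.2.2⟩, rfl, hT.tail h⟩

theorem hasLabels_of_le (h : S ≤ T) (hT : T.1.HasLabels (· ≤ ·) u) : S.1.HasLabels (· ≤ ·) u := by
  have h' : Relation.ReflTransGen (fun S T : CT n => S.1.Move T.1) S T := h
  induction h' with
  | refl => exact hT
  | @tail R T h1 h2 ih => exact ih h1 (h2.hasLabels R.2.1 hT)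

theorem exists_ge_strict (hS : S.1.HasLabels (· ≤ ·) u) :
    ∃ T, S ≤ T ∧ T.1.HasLabels (· < ·) u := by
  obtain ⟨T', h1, h2⟩ := hS.exists_strict
  obtain ⟨T, rfl, h3⟩ := exists_le_of_moves h1
  exact ⟨T, h3, h2⟩

/-- This turns the face order into membership in closed normal cones. A weak labelling of `S`
becomes strict on some tree above `S`, which is `T` by uniqueness; conversely, weak labels pass down
along moves. -/
theorem hasLabels_iff_le (hT : T.1.HasLabels (· < ·) u) : S.1.HasLabels (· ≤ ·) u ↔ S ≤ T := by
  constructor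
  · intro h
    obtain ⟨T', h1, h2⟩ := exists_ge_strict h
    rwa [Subtype.ext (h2.unique hT)] at h1
  · obtain ⟨b, hb, hT⟩ := hT
    exact fun h => hasLabels_of_le h ⟨b, hb, hT.le⟩

theorem codim_le (h : S ≤ T) : T.1.codim ≤ S.1.codim := by
  have h' : Relation.ReflTransGen (fun S T : CT n => S.1.Move T.1) S T := h
  induction h' with
  | refl => rfl
  | tail h1 h2 ih => have := ColoredTree.Move.codim_eq h2; have := ih h1; omega

theorem eq_of_le_of_codim_le (h : S ≤ T) (hc : S.1.codim ≤ T.1.codim) : S = T := by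
  rcases Relation.ReflTransGen.cases_head h with h | ⟨R, h1, h2⟩
  · exact h
  · have := codim_le h2
    have := ColoredTree.Move.codim_eq h1
    omega

theorem antisymm (h : S ≤ T) (h' : T ≤ S) : S = T :=
  eq_of_le_of_codim_le h (codim_le h')

theorem hasLabels_of_forall_atomic
    (h : ∀ t : AtomicTree n, t.toCT ≤ S → t.1.toColoredTree.HasLabels (· ≤ ·) u) :
    S.1.HasLabels (· ≤ ·) u := by
  -- A single bottom label below `0` and below every entry of `u` serves all atomic trees at once,
  -- as `Detected` requires.
  obtain ⟨b, hb, hu⟩ := u.exists_lt_forall_le 0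
  refine ⟨b, hb, S.2.1.detected.2 b u fun s hs => ?_⟩
  have hsn : s.leaves = n := by rw [← s.toColoredTree_leaves, hs.leaves_eq, S.2.2]
  have hle : AtomicTree.toCT ⟨s, hsn⟩ ≤ S := by
    obtain ⟨T, h1, h2⟩ := exists_le_of_moves (S := AtomicTree.toCT ⟨s, hsn⟩) hs
    rwa [Subtype.ext h1] at h2
  exact (h ⟨s, hsn⟩ hle).labels hu

/-- The face order is determined by the atomic trees. -/
theorem le_iff_forall_atomic : S ≤ T ↔ ∀ t : AtomicTree n, t.toCT ≤ S → t.toCT ≤ T := by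
  refine ⟨fun h t ht => Relation.ReflTransGen.trans ht h, fun h => ?_⟩
  obtain ⟨u, hu⟩ := T.2.1.exists_hasLabels
  exact (hasLabels_iff_le hu).1
    (hasLabels_of_forall_atomic fun t ht => (hasLabels_iff_le hu).2 (h t ht))

end CT

theorem BinaryTree.toPlaneTree_vertices (t : BinaryTree Unit) :
    t.toPlaneTree.vertices + 1 = t.numLeaves := by
  induction t with
  | nil => simp [toPlaneTree, PlaneTree.vertices]
  | node _ a b ha hb => simp [toPlaneTree, PlaneTree.vertices]; omega

theorem ColoredBinaryTree.toColoredTree_codim (t : ColoredBinaryTree) :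
    t.toColoredTree.codim + 1 = t.leaves := by
  induction t with
  | cut t => simpa [toColoredTree, ColoredTree.codim, leaves] using t.toPlaneTree_vertices
  | red a b ha hb => simp [toColoredTree, ColoredTree.codim, leaves]; omega

theorem BinaryTree.toPlaneTree_injective : Function.Injective BinaryTree.toPlaneTree := by
  intro s t h
  induction s generalizing t with
  | nil => cases t <;> simp_all [toPlaneTree]
  | node _ a b ha hb =>
    cases t with
    | nil => simp [toPlaneTree] at h
    | node _ c d =>
      simp only [toPlaneTree, PlaneTree.node.injEq, List.cons.injEq, and_true] at h
      rw [ha h.1, hb h.2]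

theorem ColoredBinaryTree.toColoredTree_injective :
    Function.Injective ColoredBinaryTree.toColoredTree := by
  intro s t h
  induction s generalizing t with
  | cut s =>
    cases t with
    | cut t =>
      simp only [toColoredTree, ColoredTree.cutEdge.injEq] at h
      rw [BinaryTree.toPlaneTree_injective h]
    | red c d => simp [toColoredTree] at h
  | red a b ha hb =>
    cases t with
    | cut t => simp [toColoredTree] at h
    | red c d =>
      simp only [toColoredTree, ColoredTree.red.injEq, List.cons.injEq, and_true] at h
      rw [ha h.1, hb h.2]

/-- The atomic trees are minimal for the face order. -/
theorem AtomicTree.eq_of_toCT_le {n : ℕ} {s t : AtomicTree n} (h : s.toCT ≤ t.toCT) : s = t := by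
  have h1 := s.1.toColoredTree_codim
  have h2 := t.1.toColoredTree_codim
  rw [s.2] at h1
  rw [t.2] at h2
  have h3 : s.toCT = t.toCT := CT.eq_of_le_of_codim_le h (by
    change s.1.toColoredTree.codim ≤ t.1.toColoredTree.codim
    omega)
  exact Subtype.ext (ColoredBinaryTree.toColoredTree_injective (congrArg Subtype.val h3))

/-! ### Splitting lists at a minimal entry -/

theorem List.append_cons_unique {α : Type*} {a : α} {u u' v v' : List α}
    (h : u ++ a :: v = u' ++ a :: v') (hu : a ∉ u) (hv : a ∉ v) : u = u' ∧ v = v' := by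
  induction u generalizing u' with
  | nil =>
    cases u' with
    | nil => simpa using h
    | cons x u' => simp at h; simp [h.2] at hv
  | cons x u ih =>
    cases u' with
    | nil => simp at h hu; exact absurd h.1.symm hu.1
    | cons y u' =>
      simp only [List.cons_append, List.cons.injEq, List.mem_cons, not_or] at h hu
      obtain ⟨rfl, rfl⟩ := ih h.2 hu.2
      simp [h.1]

theorem List.append_cons_append_cons_cases {α : Type*} {a : α} {u u' v w v' : List α}
    (h : u ++ a :: (v ++ a :: w) = u' ++ a :: v') (hu : a ∉ u) (hv : a ∉ v) (hw : a ∉ w) :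
    (u = u' ∧ v' = v ++ a :: w) ∨ (u' = u ++ a :: v ∧ w = v') := by
  induction u generalizing u' with
  | nil =>
    cases u' with
    | nil => simpa [eq_comm] using h
    | cons x u' =>
      simp only [List.nil_append, List.cons_append, List.cons.injEq] at h
      obtain ⟨rfl, h⟩ := h
      obtain ⟨rfl, rfl⟩ := List.append_cons_unique h hv hw
      simp
  | cons x u ih =>
    cases u' with
    | nil => simp at h hu; exact absurd h.1.symm hu.1
    | cons y u' =>
      simp only [List.cons_append, List.cons.injEq, List.mem_cons, not_or] at h hu
      obtain ⟨rfl, h⟩ := h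
      rcases ih h hu.2 with ⟨rfl, h'⟩ | ⟨rfl, h'⟩
      · simp [h']
      · simp [h']

theorem List.exists_min_split {u : List ℝ} (hu : u ≠ []) :
    ∃ u₁ g u₂, u = u₁ ++ g :: u₂ ∧ ∀ x ∈ u, g ≤ x := by
  obtain ⟨g, hg, h⟩ := u.toFinset.exists_min_image id (by simpa using hu)
  obtain ⟨u₁, u₂, h1⟩ := List.append_of_mem (List.mem_toFinset.1 hg)
  exact ⟨u₁, g, u₂, h1, fun x hx => h x (by simpa using hx)⟩

/-! ### Labels of binary trees -/

/-- The labels `u` of the vertices of the binary tree `t`, listed from left to right, increase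
weakly upwards. -/
inductive BinaryTree.Fits : BinaryTree Unit → List ℝ → Prop
  | nil : Fits .nil []
  | node {a c : BinaryTree Unit} {u v : List ℝ} {g : ℝ} (ha : Fits a u) (hc : Fits c v)
      (hu : ∀ x ∈ u, g ≤ x) (hv : ∀ x ∈ v, g ≤ x) : Fits (.node () a c) (u ++ g :: v)

/-- The labels `u` of the vertices of the 2-colored atomic tree `t`, listed from left to right,
increase weakly upwards, are nonpositive at red vertices, and nonnegative at blue ones. -/
inductive ColoredBinaryTree.Fits : ColoredBinaryTree → List ℝ → Prop
  | cut {t : BinaryTree Unit} {u : List ℝ} (ht : t.Fits u) (hu : ∀ x ∈ u, 0 ≤ x) : Fits (cut t) u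
  | red {a c : ColoredBinaryTree} {u v : List ℝ} {g : ℝ} (hg : g ≤ 0) (ha : Fits a u)
      (hc : Fits c v) (hu : ∀ x ∈ u, g ≤ x) (hv : ∀ x ∈ v, g ≤ x) : Fits (red a c) (u ++ g :: v)

namespace BinaryTree

variable {s t : BinaryTree Unit} {u v w : List ℝ} {b g : ℝ}

theorem Fits.length_eq (h : t.Fits u) : u.length + 1 = t.numLeaves := by
  induction h with
  | nil => rfl
  | node => simp [numLeaves]; omega

theorem fits_nil_iff : t.Fits [] ↔ t = .nil := by
  constructor
  · intro h
    generalize hw : [] = w at h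
    cases h <;> simp_all
  · rintro rfl
    exact .nil

theorem forall_mem_append_cons {p : ℝ → Prop} :
    (∀ x ∈ u ++ g :: v, p x) ↔ p g ∧ (∀ x ∈ u, p x) ∧ ∀ x ∈ v, p x := by
  simp only [List.mem_append, List.mem_cons]
  grind

theorem labels_iff_fits : PlaneTree.Labels (· ≤ ·) [t.toPlaneTree] b (u ++ [b]) ↔
    t.Fits u ∧ ∀ x ∈ u, b ≤ x := by
  induction t generalizing b u with
  | nil =>
    rw [toPlaneTree, PlaneTree.Labels.singleton_leaf_iff]
    constructor
    · rintro rfl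
      exact ⟨.nil, by simp⟩
    · rintro ⟨h, -⟩
      cases h
      rfl
  | node _ a c iha ihc =>
    rw [toPlaneTree, PlaneTree.Labels.singleton_node_iff]
    constructor
    · rintro ⟨g, h1, -, h2⟩
      obtain ⟨u₁, u₂, rfl, h3, h4⟩ := h2.exists_split (by simp)
      obtain ⟨h5, h6⟩ := iha.1 h3
      obtain ⟨h7, h8⟩ := ihc.1 h4
      exact ⟨.node h5 h7 h6 h8, forall_mem_append_cons.2
        ⟨h1, fun x hx => h1.trans (h6 x hx), fun x hx => h1.trans (h8 x hx)⟩⟩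
    · rintro ⟨h, hu⟩
      cases h with
      | @node _ _ u v g ha hc h1 h2 =>
        exact ⟨g, hu g (by simp), le_rfl,
          by simpa using (iha.2 ⟨ha, h1⟩).cons (ihc.2 ⟨hc, h2⟩)⟩

/-- This is the Cartesian tree of the list: a smallest label goes to the root, and the two sides are
treated recursively. -/
theorem exists_fits (u : List ℝ) : ∃ t : BinaryTree Unit, t.Fits u := by
  induction hn : u.length using Nat.strong_induction_on generalizing u with
  | _ n ih =>
    rcases eq_or_ne u [] with rfl | hu
    · exact ⟨_, .nil⟩
    · obtain ⟨u₁, g, u₂, rfl, h⟩ := List.exists_min_split hu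
      rw [forall_mem_append_cons] at h
      simp only [List.length_append, List.length_cons] at hn
      obtain ⟨a, ha⟩ := ih u₁.length (by omega) u₁ rfl
      obtain ⟨c, hc⟩ := ih u₂.length (by omega) u₂ rfl
      exact ⟨_, .node ha hc h.2.1 h.2.2⟩

/-- A vertex of minimal label may be taken as the root vertex. -/
theorem Fits.exists_root (h : t.Fits u) (hg : g ∈ u) (hu : ∀ x ∈ u, g ≤ x) :
    ∃ a c u₁ u₂, t = .node () a c ∧ u = u₁ ++ g :: u₂ ∧ a.Fits u₁ ∧ c.Fits u₂ := by
  cases h with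
  | nil => simp at hg
  | @node a c u v g' ha hc h1 h2 =>
    have : g = g' := by
      refine le_antisymm (hu _ (by simp)) ?_
      simp only [List.mem_append, List.mem_cons] at hg
      rcases hg with hg | hg | hg
      exacts [h1 _ hg, hg.ge, h2 _ hg]
    subst this
    exact ⟨a, c, u, v, rfl, rfl, ha, hc⟩

theorem fits_append_cons_iff (hu : ∀ x ∈ u, g < x) (hv : ∀ x ∈ v, g < x) :
    t.Fits (u ++ g :: v) ↔ ∃ a c, t = .node () a c ∧ a.Fits u ∧ c.Fits v := by
  constructor
  · intro h
    obtain ⟨a, c, u₁, u₂, rfl, h1, h2, h3⟩ := h.exists_root (g := g) (by simp)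
      (forall_mem_append_cons.2 ⟨le_rfl, fun x hx => (hu x hx).le, fun x hx => (hv x hx).le⟩)
    obtain ⟨rfl, rfl⟩ := List.append_cons_unique h1 (fun h => (hu _ h).false)
      fun h => (hv _ h).false
    exact ⟨a, c, rfl, h2, h3⟩
  · rintro ⟨a, c, rfl, ha, hc⟩
    exact .node ha hc (fun x hx => (hu x hx).le) fun x hx => (hv x hx).le

/-- If the labels do not determine the tree, then two adjacent vertices have the same label. -/
theorem Fits.unique_or_exists_rotation (h : s.Fits u) :
    (∀ t : BinaryTree Unit, t.Fits u → t = s) ∨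
      ∃ t : BinaryTree Unit, (s.Rotation t ∨ t.Rotation s) ∧ t.Fits u := by
  induction h with
  | nil => exact .inl fun t => fits_nil_iff.1
  | @node a c u v g ha hc hu hv iha ihc =>
    by_cases hgu : g ∈ u
    · obtain ⟨a₁, a₂, u₁, u₂, rfl, rfl, h1, h2⟩ := ha.exists_root hgu hu
      rw [forall_mem_append_cons] at hu
      refine .inr ⟨_, .inl (.root a₁ a₂ c), ?_⟩
      rw [List.append_assoc, List.cons_append]
      exact .node h1 (.node h2 hc hu.2.2 hv) hu.2.1
        (forall_mem_append_cons.2 ⟨le_rfl, hu.2.2, hv⟩)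
    by_cases hgv : g ∈ v
    · obtain ⟨c₁, c₂, v₁, v₂, rfl, rfl, h1, h2⟩ := hc.exists_root hgv hv
      rw [forall_mem_append_cons] at hv
      refine .inr ⟨_, .inr (.root a c₁ c₂), ?_⟩
      rw [← List.cons_append, ← List.append_assoc]
      exact .node (.node ha h1 hu hv.2.1) h2
        (forall_mem_append_cons.2 ⟨le_rfl, hu, hv.2.1⟩) hv.2.2
    rcases iha with iha | ⟨a', h1, h2⟩
    swap
    · exact .inr ⟨_, h1.imp (.left c) (.left c), .node h2 hc hu hv⟩
    rcases ihc with ihc | ⟨c', h1, h2⟩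
    swap
    · exact .inr ⟨_, h1.imp (.right a) (.right a), .node ha h2 hu hv⟩
    refine .inl fun t ht => ?_
    rw [fits_append_cons_iff (fun x hx => (hu x hx).lt_of_ne (by grind))
      fun x hx => (hv x hx).lt_of_ne (by grind)] at ht
    obtain ⟨a', c', rfl, h1, h2⟩ := ht
    rw [iha _ h1, ihc _ h2]

/-- Labels increasing strictly upwards lie in the interior of the normal cone of a vertex. The lower
bound `b` is carried along so that a root can be placed below two subtrees. -/
theorem exists_fits_iff_eq (t : BinaryTree Unit) (b : ℝ) :
    ∃ u : List ℝ, (∀ x ∈ u, b < x) ∧ ∀ s : BinaryTree Unit, s.Fits u ↔ s = t := by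
  induction t generalizing b with
  | nil => exact ⟨[], by simp, fun s => fits_nil_iff⟩
  | node _ a c iha ihc =>
    obtain ⟨u, hu, ha⟩ := iha (b + 1)
    obtain ⟨v, hv, hc⟩ := ihc (b + 1)
    refine ⟨u ++ (b + 1) :: v, forall_mem_append_cons.2 ⟨by simp, ?_, ?_⟩, fun s => ?_⟩
    · exact fun x hx => (lt_add_one b).trans (hu x hx)
    · exact fun x hx => (lt_add_one b).trans (hv x hx)
    · rw [fits_append_cons_iff hu hv]
      simp [ha, hc]

theorem fits_append_cons_append_cons_iff (hu : ∀ x ∈ u, g < x) (hv : ∀ x ∈ v, g < x)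
    (hw : ∀ x ∈ w, g < x) :
    t.Fits (u ++ g :: (v ++ g :: w)) ↔ ∃ a b c : BinaryTree Unit, a.Fits u ∧ b.Fits v ∧ c.Fits w ∧
      (t = .node () (.node () a b) c ∨ t = .node () a (.node () b c)) := by
  have hu' : ∀ x ∈ u, g ≤ x := fun x hx => (hu x hx).le
  have hv' : ∀ x ∈ v, g ≤ x := fun x hx => (hv x hx).le
  have hw' : ∀ x ∈ w, g ≤ x := fun x hx => (hw x hx).le
  constructor
  · intro h
    obtain ⟨a, c, u₁, u₂, rfl, h1, h2, h3⟩ := h.exists_root (g := g) (by simp)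
      (forall_mem_append_cons.2 ⟨le_rfl, hu', forall_mem_append_cons.2 ⟨le_rfl, hv', hw'⟩⟩)
    rcases List.append_cons_append_cons_cases h1 (fun h => (hu _ h).false)
      (fun h => (hv _ h).false) (fun h => (hw _ h).false) with ⟨rfl, rfl⟩ | ⟨rfl, rfl⟩
    · rw [fits_append_cons_iff hv hw] at h3
      obtain ⟨b, c, rfl, h4, h5⟩ := h3
      exact ⟨a, b, c, h2, h4, h5, .inr rfl⟩
    · rw [fits_append_cons_iff hu hv] at h2
      obtain ⟨a, b, rfl, h4, h5⟩ := h2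
      exact ⟨a, b, c, h4, h5, h3, .inl rfl⟩
  · rintro ⟨a, b, c, ha, hb, hc, rfl | rfl⟩
    · rw [← List.cons_append, ← List.append_assoc]
      exact .node (.node ha hb hu' hv') hc (forall_mem_append_cons.2 ⟨le_rfl, hu', hv'⟩) hw'
    · exact .node ha (.node hb hc hv' hw') hu' (forall_mem_append_cons.2 ⟨le_rfl, hv', hw'⟩)

/-- The labels increase strictly except for a tie between the two rotated vertices; such a vector
lies in the relative interior of the normal cone of an edge. -/
theorem Rotation.exists_fits_iff (h : s.Rotation t) (b : ℝ) :
    ∃ u : List ℝ, (∀ x ∈ u, b < x) ∧ ∀ r : BinaryTree Unit, r.Fits u ↔ r = s ∨ r = t := by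
  induction h generalizing b with
  | root a₁ a₂ a₃ =>
    obtain ⟨u, hu, ha⟩ := exists_fits_iff_eq a₁ (b + 1)
    obtain ⟨v, hv, hb⟩ := exists_fits_iff_eq a₂ (b + 1)
    obtain ⟨w, hw, hc⟩ := exists_fits_iff_eq a₃ (b + 1)
    refine ⟨u ++ (b + 1) :: (v ++ (b + 1) :: w), forall_mem_append_cons.2 ⟨by simp, ?_,
      forall_mem_append_cons.2 ⟨by simp, ?_, ?_⟩⟩, fun s => ?_⟩
    · exact fun x hx => (lt_add_one b).trans (hu x hx)
    · exact fun x hx => (lt_add_one b).trans (hv x hx)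
    · exact fun x hx => (lt_add_one b).trans (hw x hx)
    · rw [fits_append_cons_append_cons_iff hu hv hw]
      simp [ha, hb, hc]
  | left c _ ih =>
    obtain ⟨u, hu, ha⟩ := ih (b + 1)
    obtain ⟨v, hv, hc⟩ := exists_fits_iff_eq c (b + 1)
    refine ⟨u ++ (b + 1) :: v, forall_mem_append_cons.2 ⟨by simp, ?_, ?_⟩, fun s => ?_⟩
    · exact fun x hx => (lt_add_one b).trans (hu x hx)
    · exact fun x hx => (lt_add_one b).trans (hv x hx)
    · rw [fits_append_cons_iff hu hv]
      simp only [ha, hc]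
      grind
  | right c _ ih =>
    obtain ⟨u, hu, ha⟩ := exists_fits_iff_eq c (b + 1)
    obtain ⟨v, hv, hc⟩ := ih (b + 1)
    refine ⟨u ++ (b + 1) :: v, forall_mem_append_cons.2 ⟨by simp, ?_, ?_⟩, fun s => ?_⟩
    · exact fun x hx => (lt_add_one b).trans (hu x hx)
    · exact fun x hx => (lt_add_one b).trans (hv x hx)
    · rw [fits_append_cons_iff hu hv]
      simp only [ha, hc]
      grind

end BinaryTree

namespace ColoredBinaryTree

open BinaryTree (forall_mem_append_cons)

variable {s t : ColoredBinaryTree} {u v w : List ℝ} {b g : ℝ}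

theorem Fits.length_eq (h : t.Fits u) : u.length + 1 = t.leaves := by
  induction h with
  | cut h => exact h.length_eq
  | red => simp [leaves]; omega

theorem labels_iff_fits (hb : b ≤ 0) :
    ColoredTree.Labels (· ≤ ·) [t.toColoredTree] b (u ++ [b]) ↔ t.Fits u ∧ ∀ x ∈ u, b ≤ x := by
  induction t generalizing b u with
  | cut t =>
    rw [toColoredTree, ColoredTree.Labels.singleton_cutEdge_iff, BinaryTree.labels_iff_fits]
    constructor
    · exact fun h => ⟨.cut h.1 h.2, fun x hx => hb.trans (h.2 x hx)⟩
    · rintro ⟨h, -⟩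
      cases h with
      | cut h1 h2 => exact ⟨h1, h2⟩
  | red a c iha ihc =>
    rw [toColoredTree, ColoredTree.Labels.singleton_red_iff]
    constructor
    · rintro ⟨g, h1, h0, -, h2⟩
      obtain ⟨u₁, u₂, rfl, h3, h4⟩ := h2.exists_split (by simp)
      obtain ⟨h5, h6⟩ := (iha h0).1 h3
      obtain ⟨h7, h8⟩ := (ihc h0).1 h4
      exact ⟨.red h0 h5 h7 h6 h8, forall_mem_append_cons.2
        ⟨h1, fun x hx => h1.trans (h6 x hx), fun x hx => h1.trans (h8 x hx)⟩⟩
    · rintro ⟨h, hu⟩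
      cases h with
      | @red _ _ u v g hg ha hc h1 h2 =>
        exact ⟨g, hu g (by simp), hg, le_rfl,
          by simpa using ((iha hg).2 ⟨ha, h1⟩).cons ((ihc hg).2 ⟨hc, h2⟩)⟩

theorem hasLabels_iff_fits : t.toColoredTree.HasLabels (· ≤ ·) u ↔ t.Fits u := by
  constructor
  · rintro ⟨b, hb, h⟩
    exact ((labels_iff_fits hb.le).1 h).1
  · intro h
    obtain ⟨b, hb, hu⟩ := u.exists_lt_forall_le 0
    exact ⟨b, hb, (labels_iff_fits hb.le).2 ⟨h, hu⟩⟩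

/-- As long as some label is negative, a smallest one becomes a red root; once all labels are
nonnegative, a blue Cartesian tree completes the construction. -/
theorem exists_fits (u : List ℝ) : ∃ t : ColoredBinaryTree, t.Fits u := by
  induction hn : u.length using Nat.strong_induction_on generalizing u with
  | _ n ih =>
    by_cases h0 : ∀ x ∈ u, 0 ≤ x
    · obtain ⟨t, ht⟩ := BinaryTree.exists_fits u
      exact ⟨_, .cut ht h0⟩
    · obtain ⟨u₁, g, u₂, rfl, h⟩ := List.exists_min_split (u := u) (by rintro rfl; simp at h0)
      have hg : g ≤ 0 := by
        push Not at h0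
        obtain ⟨x, hx, hx0⟩ := h0
        exact (h x hx).trans hx0.le
      rw [forall_mem_append_cons] at h
      simp only [List.length_append, List.length_cons] at hn
      obtain ⟨a, ha⟩ := ih u₁.length (by omega) u₁ rfl
      obtain ⟨c, hc⟩ := ih u₂.length (by omega) u₂ rfl
      exact ⟨_, .red hg ha hc h.2.1 h.2.2⟩

/-- A red vertex of minimal label may be taken as the root vertex. -/
theorem Fits.exists_root (h : t.Fits u) (hg : g ∈ u) (hu : ∀ x ∈ u, g ≤ x) :
    (∃ t', t = .cut t' ∧ t'.Fits u ∧ 0 ≤ g) ∨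
    ∃ a c u₁ u₂, t = .red a c ∧ u = u₁ ++ g :: u₂ ∧ a.Fits u₁ ∧ c.Fits u₂ ∧ g ≤ 0 := by
  cases h with
  | cut h h' => exact .inl ⟨_, rfl, h, h' g hg⟩
  | @red a c u v g' hg' ha hc h1 h2 =>
    have : g = g' := by
      refine le_antisymm (hu _ (by simp)) ?_
      simp only [List.mem_append, List.mem_cons] at hg
      rcases hg with hg | hg | hg
      exacts [h1 _ hg, hg.ge, h2 _ hg]
    subst this
    exact .inr ⟨a, c, u, v, rfl, rfl, ha, hc, hg'⟩

theorem fits_iff_of_pos (hu : ∀ x ∈ u, 0 < x) :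
    t.Fits u ↔ ∃ t' : BinaryTree Unit, t = .cut t' ∧ t'.Fits u := by
  constructor
  · intro h
    cases h with
    | cut h => exact ⟨_, rfl, h⟩
    | red hg => exact absurd hg (hu _ (by simp)).not_ge
  · rintro ⟨t', rfl, h⟩
    exact .cut h fun x hx => (hu x hx).le

theorem fits_append_cons_iff (hg : g < 0) (hu : ∀ x ∈ u, g < x) (hv : ∀ x ∈ v, g < x) :
    t.Fits (u ++ g :: v) ↔ ∃ a c, t = .red a c ∧ a.Fits u ∧ c.Fits v := by
  constructor
  · intro h
    rcases h.exists_root (g := g) (by simp)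
      (forall_mem_append_cons.2 ⟨le_rfl, fun x hx => (hu x hx).le, fun x hx => (hv x hx).le⟩) with
      ⟨t', -, -, h1⟩ | ⟨a, c, u₁, u₂, rfl, h1, h2, h3, -⟩
    · exact absurd h1 hg.not_ge
    · obtain ⟨rfl, rfl⟩ := List.append_cons_unique h1 (fun h => (hu _ h).false)
        fun h => (hv _ h).false
      exact ⟨a, c, rfl, h2, h3⟩
  · rintro ⟨a, c, rfl, ha, hc⟩
    exact .red hg.le ha hc (fun x hx => (hu x hx).le) fun x hx => (hv x hx).le

/-- If the labels do not determine the tree, then two adjacent vertices of the same color have the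
same label, or the label of a vertex adjacent to the cut is `0`. -/
theorem Fits.unique_or_exists_cover (h : s.Fits u) :
    (∀ t : ColoredBinaryTree, t.Fits u → t = s) ∨
      ∃ t : ColoredBinaryTree, (s.Cover t ∨ t.Cover s) ∧ t.Fits u := by
  induction h with
  | @cut s u h hu =>
    by_cases h0 : (0 : ℝ) ∈ u
    · obtain ⟨a, c, u₁, u₂, rfl, rfl, h1, h2⟩ := h.exists_root h0 hu
      rw [forall_mem_append_cons] at hu
      exact .inr ⟨_, .inl (.recolor a c), .red le_rfl (.cut h1 hu.2.1) (.cut h2 hu.2.2)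
        hu.2.1 hu.2.2⟩
    rcases h.unique_or_exists_rotation with h | ⟨t, h1, h2⟩
    · refine .inl fun t ht => ?_
      rw [fits_iff_of_pos fun x hx => (hu x hx).lt_of_ne (by grind)] at ht
      obtain ⟨t, rfl, ht⟩ := ht
      rw [h _ ht]
    · exact .inr ⟨_, h1.imp .rotateBlue .rotateBlue, .cut h2 hu⟩
  | @red a c u v g hg ha hc hu hv iha ihc =>
    by_cases ha' : g ∈ u ∧ ∃ a₁ a₂, a = .red a₁ a₂
    · obtain ⟨hgu, a₁, a₂, rfl⟩ := ha'
      rcases ha.exists_root hgu hu with ⟨_, h, -⟩ | ⟨a₁, a₂, u₁, u₂, h, rfl, h1, h2, -⟩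
      · cases h
      rw [h]
      rw [forall_mem_append_cons] at hu
      refine .inr ⟨_, .inl (.rotateRed a₁ a₂ c), ?_⟩
      rw [List.append_assoc, List.cons_append]
      exact .red hg h1 (.red hg h2 hc hu.2.2 hv) hu.2.1
        (forall_mem_append_cons.2 ⟨le_rfl, hu.2.2, hv⟩)
    by_cases hc' : g ∈ v ∧ ∃ c₁ c₂, c = .red c₁ c₂
    · obtain ⟨hgv, c₁, c₂, rfl⟩ := hc'
      rcases hc.exists_root hgv hv with ⟨_, h, -⟩ | ⟨c₁, c₂, v₁, v₂, h, rfl, h1, h2, -⟩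
      · cases h
      rw [h]
      rw [forall_mem_append_cons] at hv
      refine .inr ⟨_, .inr (.rotateRed a c₁ c₂), ?_⟩
      rw [← List.cons_append, ← List.append_assoc]
      exact .red hg (.red hg ha h1 hu hv.2.1) h2
        (forall_mem_append_cons.2 ⟨le_rfl, hu, hv.2.1⟩) hv.2.2
    -- If the red root has label `0`, all labels above it are nonnegative. A red root vertex of a
    -- subtree would then also have label `0`, a case already excluded, so both subtrees are blue
    -- and the cut can be moved below the root.
    rcases hg.eq_or_lt with rfl | hg
    · have key : ∀ (d : ColoredBinaryTree) (w : List ℝ), d.Fits w → (∀ x ∈ w, 0 ≤ x) →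
          ¬ ((0 : ℝ) ∈ w ∧ ∃ d₁ d₂, d = .red d₁ d₂) → ∃ d', d = .cut d' ∧ d'.Fits w := by
        intro d w hd hw h
        cases hd with
        | cut hd => exact ⟨_, rfl, hd⟩
        | @red _ _ _ _ g' hg' =>
          refine absurd ⟨?_, _, _, rfl⟩ h
          simp [hg'.antisymm (hw g' (by simp))]
      obtain ⟨a, rfl, ha₁⟩ := key a u ha hu ha'
      obtain ⟨c, rfl, hc₁⟩ := key c v hc hv hc'
      exact .inr ⟨_, .inr (.recolor a c), .cut (.node ha₁ hc₁ hu hv)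
        (forall_mem_append_cons.2 ⟨le_rfl, hu, hv⟩)⟩
    rcases iha with iha | ⟨a', h1, h2⟩
    swap
    · exact .inr ⟨_, h1.imp (.left c) (.left c), .red hg.le h2 hc hu hv⟩
    rcases ihc with ihc | ⟨c', h1, h2⟩
    swap
    · exact .inr ⟨_, h1.imp (.right a) (.right a), .red hg.le ha h2 hu hv⟩
    have key : ∀ (d : ColoredBinaryTree) (w : List ℝ), d.Fits w → (∀ x ∈ w, g ≤ x) →
        ¬ (g ∈ w ∧ ∃ d₁ d₂, d = .red d₁ d₂) → ∀ x ∈ w, g < x := by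
      intro d w hd hw h x hx
      refine (hw x hx).lt_of_ne ?_
      rintro rfl
      rcases hd.exists_root hx hw with ⟨_, -, -, h1⟩ | ⟨d₁, d₂, -, -, h1, -⟩
      · exact hg.not_ge h1
      · exact h ⟨hx, d₁, d₂, h1⟩
    refine .inl fun t ht => ?_
    rw [fits_append_cons_iff hg (key a u ha hu ha') (key c v hc hv hc')] at ht
    obtain ⟨a', c', rfl, h1, h2⟩ := ht
    rw [iha _ h1, ihc _ h2]

theorem exists_fits_iff_eq (t : ColoredBinaryTree) :
    ∃ u : List ℝ, ∀ s : ColoredBinaryTree, s.Fits u ↔ s = t := by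
  induction t with
  | cut t =>
    obtain ⟨u, hu, h⟩ := t.exists_fits_iff_eq 0
    exact ⟨u, fun s => by simp [fits_iff_of_pos hu, h]⟩
  | red a c iha ihc =>
    obtain ⟨u, ha⟩ := iha
    obtain ⟨v, hc⟩ := ihc
    obtain ⟨b, hb, h⟩ := (u ++ v).exists_lt_forall_le 0
    have h' : ∀ x ∈ u ++ v, b - 1 < x := fun x hx => (sub_one_lt b).trans_le (h x hx)
    refine ⟨u ++ (b - 1) :: v, fun s => ?_⟩
    rw [fits_append_cons_iff (by linarith) (fun x hx => h' x (by simp [hx]))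
      fun x hx => h' x (by simp [hx])]
    simp [ha, hc]

theorem fits_append_cons_append_cons_iff (hg : g < 0) (hu : ∀ x ∈ u, g < x) (hv : ∀ x ∈ v, g < x)
    (hw : ∀ x ∈ w, g < x) :
    t.Fits (u ++ g :: (v ++ g :: w)) ↔ ∃ a b c : ColoredBinaryTree, a.Fits u ∧ b.Fits v ∧
      c.Fits w ∧ (t = .red (.red a b) c ∨ t = .red a (.red b c)) := by
  have hu' : ∀ x ∈ u, g ≤ x := fun x hx => (hu x hx).le
  have hv' : ∀ x ∈ v, g ≤ x := fun x hx => (hv x hx).le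
  have hw' : ∀ x ∈ w, g ≤ x := fun x hx => (hw x hx).le
  constructor
  · intro h
    rcases h.exists_root (g := g) (by simp)
      (forall_mem_append_cons.2 ⟨le_rfl, hu', forall_mem_append_cons.2 ⟨le_rfl, hv', hw'⟩⟩) with
      ⟨t', -, -, h1⟩ | ⟨a, c, u₁, u₂, rfl, h1, h2, h3, -⟩
    · exact absurd h1 hg.not_ge
    rcases List.append_cons_append_cons_cases h1 (fun h => (hu _ h).false)
      (fun h => (hv _ h).false) (fun h => (hw _ h).false) with ⟨rfl, rfl⟩ | ⟨rfl, rfl⟩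
    · rw [fits_append_cons_iff hg hv hw] at h3
      obtain ⟨b, c, rfl, h4, h5⟩ := h3
      exact ⟨a, b, c, h2, h4, h5, .inr rfl⟩
    · rw [fits_append_cons_iff hg hu hv] at h2
      obtain ⟨a, b, rfl, h4, h5⟩ := h2
      exact ⟨a, b, c, h4, h5, h3, .inl rfl⟩
  · rintro ⟨a, b, c, ha, hb, hc, rfl | rfl⟩
    · rw [← List.cons_append, ← List.append_assoc]
      exact .red hg.le (.red hg.le ha hb hu' hv') hc
        (forall_mem_append_cons.2 ⟨le_rfl, hu', hv'⟩) hw'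
    · exact .red hg.le ha (.red hg.le hb hc hv' hw') hu'
        (forall_mem_append_cons.2 ⟨le_rfl, hv', hw'⟩)

theorem fits_append_zero_cons_iff (hu : ∀ x ∈ u, 0 < x) (hv : ∀ x ∈ v, 0 < x) :
    t.Fits (u ++ 0 :: v) ↔ ∃ a c : BinaryTree Unit, a.Fits u ∧ c.Fits v ∧
      (t = .cut (.node () a c) ∨ t = .red (.cut a) (.cut c)) := by
  have hu' : ∀ x ∈ u, 0 ≤ x := fun x hx => (hu x hx).le
  have hv' : ∀ x ∈ v, 0 ≤ x := fun x hx => (hv x hx).le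
  constructor
  · intro h
    rcases h.exists_root (g := 0) (by simp) (forall_mem_append_cons.2 ⟨le_rfl, hu', hv'⟩) with
      ⟨t, rfl, h1, -⟩ | ⟨a, c, u₁, u₂, rfl, h1, h2, h3, -⟩
    · rw [BinaryTree.fits_append_cons_iff hu hv] at h1
      obtain ⟨a, c, rfl, h2, h3⟩ := h1
      exact ⟨a, c, h2, h3, .inl rfl⟩
    · obtain ⟨rfl, rfl⟩ := List.append_cons_unique h1 (fun h => (hu _ h).false)
        fun h => (hv _ h).false
      rw [fits_iff_of_pos hu] at h2
      rw [fits_iff_of_pos hv] at h3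
      obtain ⟨a, rfl, h2⟩ := h2
      obtain ⟨c, rfl, h3⟩ := h3
      exact ⟨a, c, h2, h3, .inr rfl⟩
  · rintro ⟨a, c, ha, hc, rfl | rfl⟩
    · exact .cut (.node ha hc hu' hv') (forall_mem_append_cons.2 ⟨le_rfl, hu', hv'⟩)
    · exact .red le_rfl (.cut ha hu') (.cut hc hv') hu' hv'

/-- A rotation is realized by a tie between the two vertices, a recoloring by the label `0` at the
vertex concerned; all other inequalities are strict. -/
theorem Cover.exists_fits_iff (h : s.Cover t) :
    ∃ u : List ℝ, ∀ r : ColoredBinaryTree, r.Fits u ↔ r = s ∨ r = t := by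
  induction h with
  | rotateBlue h =>
    obtain ⟨u, hu, h⟩ := h.exists_fits_iff 0
    refine ⟨u, fun r => ?_⟩
    simp only [fits_iff_of_pos hu, h]
    grind
  | rotateRed a₁ a₂ a₃ =>
    obtain ⟨u, ha⟩ := exists_fits_iff_eq a₁
    obtain ⟨v, hb⟩ := exists_fits_iff_eq a₂
    obtain ⟨w, hc⟩ := exists_fits_iff_eq a₃
    obtain ⟨b, hb0, h⟩ := (u ++ (v ++ w)).exists_lt_forall_le 0
    have h' : ∀ x ∈ u ++ (v ++ w), b - 1 < x := fun x hx => (sub_one_lt b).trans_le (h x hx)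
    refine ⟨u ++ (b - 1) :: (v ++ (b - 1) :: w), fun s => ?_⟩
    rw [fits_append_cons_append_cons_iff (by linarith) (fun x hx => h' x (by simp [hx]))
      (fun x hx => h' x (by simp [hx])) fun x hx => h' x (by simp [hx])]
    simp [ha, hb, hc]
  | recolor a c =>
    obtain ⟨u, hu, ha⟩ := a.exists_fits_iff_eq 0
    obtain ⟨v, hv, hc⟩ := c.exists_fits_iff_eq 0
    refine ⟨u ++ 0 :: v, fun s => ?_⟩
    rw [fits_append_zero_cons_iff hu hv]
    simp [ha, hc]
  | left c _ ih =>
    obtain ⟨u, ha⟩ := ih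
    obtain ⟨v, hc⟩ := exists_fits_iff_eq c
    obtain ⟨b, hb, h⟩ := (u ++ v).exists_lt_forall_le 0
    have h' : ∀ x ∈ u ++ v, b - 1 < x := fun x hx => (sub_one_lt b).trans_le (h x hx)
    refine ⟨u ++ (b - 1) :: v, fun s => ?_⟩
    rw [fits_append_cons_iff (by linarith) (fun x hx => h' x (by simp [hx]))
      fun x hx => h' x (by simp [hx])]
    simp only [ha, hc]
    grind
  | right c _ ih =>
    obtain ⟨v, hc⟩ := ih
    obtain ⟨u, ha⟩ := exists_fits_iff_eq c
    obtain ⟨b, hb, h⟩ := (u ++ v).exists_lt_forall_le 0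
    have h' : ∀ x ∈ u ++ v, b - 1 < x := fun x hx => (sub_one_lt b).trans_le (h x hx)
    refine ⟨u ++ (b - 1) :: v, fun s => ?_⟩
    rw [fits_append_cons_iff (by linarith) (fun x hx => h' x (by simp [hx]))
      fun x hx => h' x (by simp [hx])]
    simp only [ha, hc]
    grind

end ColoredBinaryTree

/-! ### Sums over pairs of leaves -/

section PairSum

variable {α β : Type*} (op : α → α → α) (φ ψ : α → ℝ)

/-- The sum of `φ (x + u₁ + ⋯ + uᵢ) wᵢ`, where `+` denotes `op`. -/
def rowSum : α → List α → List ℝ → ℝ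
  | _, _, [] => 0
  | x, [], w :: _ => φ x * w
  | x, u :: us, w :: ws => φ x * w + rowSum (op x u) us ws

/-- The sum of `wᵢ wⱼ φ (uᵢ + ⋯ + uⱼ₋₁)` over all `i < j`, where `+` denotes `op`. The weights `w`
are those of the leaves of a tree, and `u` lists labels of the gaps between leaves. -/
def pairSum : List α → List ℝ → ℝ
  | u :: us, w :: ws => w * rowSum op φ u us ws + pairSum us ws
  | _, _ => 0

variable {op φ ψ}

theorem rowSum_map {op' : β → β → β} {f : β → α} (hf : ∀ x y, f (op' x y) = op (f x) (f y)) (x : β)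
    (u : List β) (w : List ℝ) :
    rowSum op φ (f x) (u.map f) w = rowSum op' (fun x => φ (f x)) x u w := by
  induction w generalizing x u with
  | nil => simp [rowSum]
  | cons w ws ih =>
    cases u with
    | nil => simp [rowSum]
    | cons u us => simp [rowSum, ← hf, ih]

/-- It is applied to a monotone function, which commutes with `min`, and to the passage from sets of
gaps with `∪` to values with `min`. -/
theorem pairSum_map {op' : β → β → β} {f : β → α} (hf : ∀ x y, f (op' x y) = op (f x) (f y))
    (u : List β) (w : List ℝ) :
    pairSum op φ (u.map f) w = pairSum op' (fun x => φ (f x)) u w := by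
  induction u generalizing w with
  | nil => simp [pairSum]
  | cons u us ih =>
    cases w with
    | nil => simp [pairSum]
    | cons w ws => simp [pairSum, rowSum_map hf, ih]

theorem rowSum_add (x : α) (u : List α) (w : List ℝ) :
    rowSum op (fun x => φ x + ψ x) x u w = rowSum op φ x u w + rowSum op ψ x u w := by
  induction w generalizing x u with
  | nil => simp [rowSum]
  | cons w ws ih =>
    cases u with
    | nil => simp [rowSum, add_mul]
    | cons u us => simp only [rowSum, ih]; ring

theorem pairSum_add (u : List α) (w : List ℝ) :
    pairSum op (fun x => φ x + ψ x) u w = pairSum op φ u w + pairSum op ψ u w := by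
  induction u generalizing w with
  | nil => simp [pairSum]
  | cons u us ih =>
    cases w with
    | nil => simp [pairSum]
    | cons w ws => simp only [pairSum, rowSum_add, ih]; ring

theorem rowSum_mul_left (c : ℝ) (x : α) (u : List α) (w : List ℝ) :
    rowSum op (fun x => c * φ x) x u w = c * rowSum op φ x u w := by
  induction w generalizing x u with
  | nil => simp [rowSum]
  | cons w ws ih =>
    cases u with
    | nil => simp [rowSum, mul_assoc]
    | cons u us => simp only [rowSum, ih]; ring

theorem pairSum_mul_left (c : ℝ) (u : List α) (w : List ℝ) :
    pairSum op (fun x => c * φ x) u w = c * pairSum op φ u w := by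
  induction u generalizing w with
  | nil => simp [pairSum]
  | cons u us ih =>
    cases w with
    | nil => simp [pairSum]
    | cons w ws => simp only [pairSum, rowSum_mul_left, ih]; ring

theorem rowSum_mono {K : Set α} (hK : ∀ x ∈ K, ∀ y ∈ K, op x y ∈ K) (h : ∀ x ∈ K, φ x ≤ ψ x)
    {x : α} {u : List α} {w : List ℝ} (hx : x ∈ K) (hu : ∀ y ∈ u, y ∈ K) (hw : ∀ y ∈ w, 0 ≤ y) :
    rowSum op φ x u w ≤ rowSum op ψ x u w := by
  induction w generalizing x u with
  | nil => simp [rowSum]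
  | cons w ws ih =>
    simp only [List.mem_cons, forall_eq_or_imp] at hw
    cases u with
    | nil => exact mul_le_mul_of_nonneg_right (h x hx) hw.1
    | cons u us =>
      simp only [List.mem_cons, forall_eq_or_imp] at hu
      exact add_le_add (mul_le_mul_of_nonneg_right (h x hx) hw.1)
        (ih (hK x hx u hu.1) hu.2 hw.2)

/-- Only values of `φ` and `ψ` on iterated `op` of entries occur, so a comparison on a set `K`
closed under `op` is enough. -/
theorem pairSum_mono {K : Set α} (hK : ∀ x ∈ K, ∀ y ∈ K, op x y ∈ K) (h : ∀ x ∈ K, φ x ≤ ψ x)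
    {u : List α} {w : List ℝ} (hu : ∀ y ∈ u, y ∈ K) (hw : ∀ y ∈ w, 0 ≤ y) :
    pairSum op φ u w ≤ pairSum op ψ u w := by
  induction u generalizing w with
  | nil => simp [pairSum]
  | cons u us ih =>
    cases w with
    | nil => simp [pairSum]
    | cons w ws =>
      simp only [List.mem_cons, forall_eq_or_imp] at hw hu
      exact add_le_add (mul_le_mul_of_nonneg_left (rowSum_mono hK h hu.1 hu.2 hw.2) hw.1)
        (ih hu.2 hw.2)

theorem rowSum_append (x g : α) {us : List α} (u₂ : List α) {ws : List ℝ} (w₂ : List ℝ)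
    (h : ws.length = us.length + 1) :
    rowSum op φ x (us ++ g :: u₂) (ws ++ w₂) =
      rowSum op φ x us ws + rowSum op φ (op (us.foldl op x) g) u₂ w₂ := by
  induction us generalizing x ws with
  | nil =>
    match ws, h with
    | [w], _ => simp [rowSum]
  | cons u us ih =>
    match ws, h with
    | w :: ws, h =>
      have := ih (op x u) (ws := ws) (by simpa using h)
      simp only [List.cons_append, rowSum, this, List.foldl_cons]
      ring

end PairSum

/-! ### Sums over pairs of minima of labels -/

section MinPairSum

variable {φ : ℝ → ℝ}

/-- A running minimum that starts at most at `g` stays there. Since the weights are positive and `φ`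
is injective, equality of the sums means equality in each term. -/
theorem rowSum_min_le (hφ : StrictMono φ) {x g : ℝ} {u w : List ℝ} (hx : x ≤ g)
    (hl : w.length = u.length + 1) (hw : ∀ y ∈ w, 0 < y) :
    rowSum min φ x u w ≤ φ g * w.sum ∧
      (rowSum min φ x u w = φ g * w.sum ↔ g ≤ x ∧ ∀ y ∈ u, g ≤ y) := by
  have key : ∀ {x w₀ : ℝ}, x ≤ g → 0 < w₀ →
      φ x * w₀ ≤ φ g * w₀ ∧ (φ x * w₀ = φ g * w₀ ↔ g ≤ x) := by
    intro x w₀ hx hw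
    refine ⟨mul_le_mul_of_nonneg_right (hφ.monotone hx) hw.le, ?_⟩
    rw [mul_left_inj' hw.ne', hφ.injective.eq_iff]
    exact ⟨fun h => h.ge, hx.antisymm⟩
  induction u generalizing x w with
  | nil =>
    match w, hl with
    | [w], _ => simpa [rowSum] using key hx (hw w (by simp))
  | cons y u ih =>
    match w, hl with
    | w :: ws, hl =>
      simp only [List.mem_cons, forall_eq_or_imp] at hw
      obtain ⟨h1, h2⟩ := ih (x := min x y) (w := ws) (min_le_of_left_le hx) (by simpa using hl) hw.2
      obtain ⟨h3, h4⟩ := key hx hw.1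
      simp only [rowSum, List.sum_cons, mul_add, List.mem_cons, forall_eq_or_imp]
      refine ⟨add_le_add h3 h1, ?_⟩
      rw [add_eq_add_iff_eq_and_eq h3 h1, h2, h4, le_min_iff]
      tauto

theorem foldl_min_ge {g x : ℝ} {u : List ℝ} : g ≤ u.foldl min x ↔ g ≤ x ∧ ∀ y ∈ u, g ≤ y := by
  induction u generalizing x with
  | nil => simp
  | cons y u ih => simp [ih, and_assoc]

/-- The pairs of leaves on either side of the gap `g` have a minimum of at most `g`, and those on
one side are unaffected by it. This is the inductive step at a root vertex with gap `g`: equality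
holds exactly when no label exceeds the root downwards. -/
theorem pairSum_min_append_le (hφ : StrictMono φ) {g : ℝ} {u₁ u₂ w₁ w₂ : List ℝ}
    (hl₁ : w₁.length = u₁.length + 1) (hl₂ : w₂.length = u₂.length + 1)
    (hw₁ : ∀ y ∈ w₁, 0 < y) (hw₂ : ∀ y ∈ w₂, 0 < y) :
    pairSum min φ (u₁ ++ g :: u₂) (w₁ ++ w₂) ≤
        pairSum min φ u₁ w₁ + φ g * (w₁.sum * w₂.sum) + pairSum min φ u₂ w₂ ∧
      (pairSum min φ (u₁ ++ g :: u₂) (w₁ ++ w₂) =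
        pairSum min φ u₁ w₁ + φ g * (w₁.sum * w₂.sum) + pairSum min φ u₂ w₂ ↔
        (∀ x ∈ u₁, g ≤ x) ∧ ∀ x ∈ u₂, g ≤ x) := by
  induction u₁ generalizing w₁ with
  | nil =>
    match w₁, hl₁ with
    | [w], _ =>
      obtain ⟨h1, h2⟩ := rowSum_min_le hφ le_rfl hl₂ hw₂ (g := g)
      have hw := hw₁ w (by simp)
      have h3 := mul_le_mul_of_nonneg_left h1 hw.le
      simp only [pairSum, List.nil_append, List.cons_append, List.sum_singleton]
      refine ⟨by linarith, ?_⟩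
      rw [zero_add, add_left_inj, mul_left_comm, mul_right_inj' hw.ne', h2]
      simp
  | cons u us ih =>
    match w₁, hl₁ with
    | w :: ws, hl₁ =>
      simp only [List.mem_cons, forall_eq_or_imp] at hw₁
      have hl : ws.length = us.length + 1 := by simpa using hl₁
      obtain ⟨h1, h2⟩ := ih hl hw₁.2
      obtain ⟨h3, h4⟩ := rowSum_min_le hφ (min_le_right (us.foldl min u) g) hl₂ hw₂
      have h5 := mul_le_mul_of_nonneg_left h3 hw₁.1.le
      simp only [pairSum, List.cons_append, List.sum_cons, rowSum_append _ _ _ _ hl]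
      refine ⟨by linarith, ?_⟩
      have h6 : ∀ A B C D E : ℝ, w * (A + B) + C = w * A + D + E * ((w + ws.sum) * w₂.sum)
          + pairSum min φ u₂ w₂ ↔ w * B + C = w * (E * w₂.sum) +
          (D + E * (ws.sum * w₂.sum) + pairSum min φ u₂ w₂) := by
        intro A B C D E
        constructor <;> intro h <;> linarith
      rw [h6, add_eq_add_iff_eq_and_eq h5 h1, h2, mul_right_inj' hw₁.1.ne', h4]
      simp only [le_min_iff, foldl_min_ge, List.mem_cons, forall_eq_or_imp, le_refl]
      tauto

end MinPairSum

/-! ### The scalar products of the vertices with a vector of labels -/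

/-- The scalar product of two lists. -/
def List.dot (u x : List ℝ) : ℝ :=
  (List.zipWith (· * ·) u x).sum

theorem List.dot_append_cons {u₁ u₂ x₁ x₂ : List ℝ} {g y : ℝ} (h : u₁.length = x₁.length) :
    List.dot (u₁ ++ g :: u₂) (x₁ ++ y :: x₂) = List.dot u₁ x₁ + g * y + List.dot u₂ x₂ := by
  simp [List.dot, List.zipWith_append h, add_assoc]

/-- The label of a vertex is multiplied by `2` if it is negative, as the vertex is then red. -/
noncomputable def colorWeight (x : ℝ) : ℝ := min x (2 * x)

theorem colorWeight_strictMono : StrictMono colorWeight := fun x y h => by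
  unfold colorWeight
  exact lt_min (min_lt_of_left_lt h) (min_lt_of_right_lt (by linarith))

theorem colorWeight_of_nonneg {x : ℝ} (h : 0 ≤ x) : colorWeight x = x :=
  min_eq_left (by linarith)

theorem colorWeight_of_nonpos {x : ℝ} (h : x ≤ 0) : colorWeight x = 2 * x :=
  min_eq_right (by linarith)

theorem colorWeight_le {x : ℝ} : colorWeight x ≤ x := min_le_left _ _

theorem colorWeight_le_two_mul {x : ℝ} : colorWeight x ≤ 2 * x := min_le_right _ _

theorem colorWeight_eq_iff {x : ℝ} : colorWeight x = x ↔ 0 ≤ x := by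
  rw [colorWeight, min_eq_left_iff]
  constructor <;> intro h <;> linarith

theorem colorWeight_eq_two_mul_iff {x : ℝ} : colorWeight x = 2 * x ↔ x ≤ 0 := by
  rw [colorWeight, min_eq_right_iff]
  constructor <;> intro h <;> linarith

theorem List.exists_split_of_length {u : List ℝ} {k l : ℕ} (h : u.length + 1 = (k + 1) + (l + 1)) :
    ∃ u₁ g u₂, u = u₁ ++ g :: u₂ ∧ u₁.length = k ∧ u₂.length = l := by
  have hk : k < u.length := by omega
  refine ⟨u.take k, u[k], u.drop (k + 1), ?_, by simp; omega, by simp; omega⟩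
  simp

theorem List.sum_pos_of_forall_pos {w : List ℝ} (h : ∀ x ∈ w, 0 < x) (hw : 0 < w.length) :
    0 < w.sum :=
  List.sum_pos _ h (by rintro rfl; simp at hw)

theorem BinaryTree.fits_node_iff {a c : BinaryTree Unit} {u v : List ℝ} {g : ℝ}
    (hu : u.length + 1 = a.numLeaves) :
    (BinaryTree.node () a c).Fits (u ++ g :: v) ↔
      a.Fits u ∧ c.Fits v ∧ (∀ x ∈ u, g ≤ x) ∧ ∀ x ∈ v, g ≤ x := by
  constructor
  · intro h
    generalize hw : u ++ g :: v = w at h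
    cases h with
    | node ha hc h1 h2 =>
      have := ha.length_eq
      obtain ⟨rfl, rfl, rfl⟩ := List.append_cons_inj_of_length_eq hw (by omega)
      exact ⟨ha, hc, h1, h2⟩
  · rintro ⟨ha, hc, h1, h2⟩
    exact .node ha hc h1 h2

theorem ColoredBinaryTree.fits_red_iff {a c : ColoredBinaryTree} {u v : List ℝ} {g : ℝ}
    (hu : u.length + 1 = a.leaves) :
    (ColoredBinaryTree.red a c).Fits (u ++ g :: v) ↔
      g ≤ 0 ∧ a.Fits u ∧ c.Fits v ∧ (∀ x ∈ u, g ≤ x) ∧ ∀ x ∈ v, g ≤ x := by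
  constructor
  · intro h
    generalize hw : u ++ g :: v = w at h
    cases h with
    | red hg ha hc h1 h2 =>
      have := ha.length_eq
      obtain ⟨rfl, rfl, rfl⟩ := List.append_cons_inj_of_length_eq hw (by omega)
      exact ⟨hg, ha, hc, h1, h2⟩
  · rintro ⟨hg, ha, hc, h1, h2⟩
    exact .red hg ha hc h1 h2

/-- By induction, splitting the pairs of leaves according to whether they meet at the root. Besides
the inequality for minima, `colorWeight g ≤ g` is used at each vertex, which is an equality
precisely for `0 ≤ g`. -/
theorem BinaryTree.pairSum_le_dot (t : BinaryTree Unit) {u w : List ℝ}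
    (hu : u.length + 1 = t.numLeaves) (hl : w.length = t.numLeaves) (hw : ∀ x ∈ w, 0 < x) :
    pairSum min colorWeight u w ≤ u.dot (t.coords w) ∧
      (pairSum min colorWeight u w = u.dot (t.coords w) ↔ t.Fits u ∧ ∀ x ∈ u, 0 ≤ x) := by
  induction t generalizing u w with
  | nil =>
    obtain rfl : u = [] := by simpa [numLeaves] using hu
    simp [pairSum, List.dot, coords, fits_nil_iff]
  | node _ a c iha ihc =>
    obtain ⟨k, hk⟩ := Nat.exists_eq_succ_of_ne_zero a.numLeaves_pos.ne'
    obtain ⟨l, hl'⟩ := Nat.exists_eq_succ_of_ne_zero c.numLeaves_pos.ne'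
    rw [numLeaves] at hu hl
    rw [hk, hl'] at hu
    obtain ⟨u₁, g, u₂, rfl, h1, h2⟩ := List.exists_split_of_length hu
    have hw₁ : ∀ x ∈ w.take a.numLeaves, 0 < x := fun x hx => hw x (List.mem_of_mem_take hx)
    have hw₂ : ∀ x ∈ w.drop a.numLeaves, 0 < x := fun x hx => hw x (List.mem_of_mem_drop hx)
    have hl₁ : (w.take a.numLeaves).length = a.numLeaves := by simp; omega
    have hl₂ : (w.drop a.numLeaves).length = c.numLeaves := by simp; omega
    obtain ⟨h3, h4⟩ := pairSum_min_append_le colorWeight_strictMono (g := g)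
      (by omega : _ = u₁.length + 1) (by omega : _ = u₂.length + 1) hw₁ hw₂
    obtain ⟨h5, h6⟩ := iha (by omega : u₁.length + 1 = _) hl₁ hw₁
    obtain ⟨h7, h8⟩ := ihc (by omega : u₂.length + 1 = _) hl₂ hw₂
    have h9 := a.length_coords (w.take a.numLeaves)
    rw [List.take_append_drop] at h3 h4
    rw [coords, List.dot_append_cons (by omega), fits_node_iff (by omega),
      forall_mem_append_cons]
    have hs : 0 < (w.take a.numLeaves).sum * (w.drop a.numLeaves).sum :=
      mul_pos (List.sum_pos_of_forall_pos hw₁ (by omega)) (List.sum_pos_of_forall_pos hw₂ (by omega))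
    have h10 := mul_le_mul_of_nonneg_right (colorWeight_le (x := g)) hs.le
    refine ⟨by linarith, ?_⟩
    -- An equality between sums of termwise comparable numbers splits into equalities of the terms;
    -- these are exactly the conditions in `Fits`.
    have h11 := add_eq_add_iff_eq_and_eq h5 h10
    have h12 := add_eq_add_iff_eq_and_eq (add_le_add h5 h10) h7
    rw [mul_left_inj' hs.ne', colorWeight_eq_iff] at h11
    rw [h11, h6, h8] at h12
    constructor
    · intro h
      have h13 := h4.1 (by linarith)
      have h14 := h12.1 (by linarith)
      tauto
    · intro h
      have h13 := h4.2 (by tauto)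
      have h14 := h12.2 (by tauto)
      rw [h13, h14]

theorem ColoredBinaryTree.leaves_pos (t : ColoredBinaryTree) : 0 < t.leaves := by
  induction t with
  | cut t => exact t.numLeaves_pos
  | red => simp [leaves]; omega

/-- The minimum of the scalar product of `u` with a vertex is the sum over pairs of leaves of the
products of their weights with the minima of the (weighted) labels of the gaps between them. -/
theorem ColoredBinaryTree.pairSum_le_dot (t : ColoredBinaryTree) {u w : List ℝ}
    (hu : u.length + 1 = t.leaves) (hl : w.length = t.leaves) (hw : ∀ x ∈ w, 0 < x) :
    pairSum min colorWeight u w ≤ u.dot (t.coords w) ∧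
      (pairSum min colorWeight u w = u.dot (t.coords w) ↔ t.Fits u) := by
  induction t generalizing u w with
  | cut t =>
    obtain ⟨h1, h2⟩ := t.pairSum_le_dot hu hl hw
    refine ⟨h1, h2.trans ⟨fun h => .cut h.1 h.2, fun h => ?_⟩⟩
    cases h with
    | cut h h' => exact ⟨h, h'⟩
  | red a c iha ihc =>
    obtain ⟨k, hk⟩ := Nat.exists_eq_succ_of_ne_zero a.leaves_pos.ne'
    obtain ⟨l, hl'⟩ := Nat.exists_eq_succ_of_ne_zero c.leaves_pos.ne'
    rw [leaves] at hu hl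
    rw [hk, hl'] at hu
    obtain ⟨u₁, g, u₂, rfl, h1, h2⟩ := List.exists_split_of_length hu
    have hw₁ : ∀ x ∈ w.take a.leaves, 0 < x := fun x hx => hw x (List.mem_of_mem_take hx)
    have hw₂ : ∀ x ∈ w.drop a.leaves, 0 < x := fun x hx => hw x (List.mem_of_mem_drop hx)
    have hl₁ : (w.take a.leaves).length = a.leaves := by simp; omega
    have hl₂ : (w.drop a.leaves).length = c.leaves := by simp; omega
    obtain ⟨h3, h4⟩ := pairSum_min_append_le colorWeight_strictMono (g := g)
      (by omega : _ = u₁.length + 1) (by omega : _ = u₂.length + 1) hw₁ hw₂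
    obtain ⟨h5, h6⟩ := iha (by omega : u₁.length + 1 = _) hl₁ hw₁
    obtain ⟨h7, h8⟩ := ihc (by omega : u₂.length + 1 = _) hl₂ hw₂
    have h9 := a.length_coords (w.take a.leaves)
    rw [List.take_append_drop] at h3 h4
    rw [coords, List.dot_append_cons (by omega), fits_red_iff (by omega), mul_assoc 2,
      mul_left_comm, ← mul_assoc 2]
    have hs : 0 < (w.take a.leaves).sum * (w.drop a.leaves).sum :=
      mul_pos (List.sum_pos_of_forall_pos hw₁ (by omega)) (List.sum_pos_of_forall_pos hw₂ (by omega))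
    have h10 := mul_le_mul_of_nonneg_right (colorWeight_le_two_mul (x := g)) hs.le
    refine ⟨by linarith, ?_⟩
    have h11 := add_eq_add_iff_eq_and_eq h5 h10
    have h12 := add_eq_add_iff_eq_and_eq (add_le_add h5 h10) h7
    rw [mul_left_inj' hs.ne', colorWeight_eq_two_mul_iff] at h11
    rw [h11, h6, h8] at h12
    constructor
    · intro h
      have h13 := h4.1 (by linarith)
      have h14 := h12.1 (by linarith)
      tauto
    · intro h
      have h13 := h4.2 (by tauto)
      have h14 := h12.2 (by tauto)
      rw [h13, h14]

/-! ### Scalar products of vectors and lists -/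

theorem List.dot_ofFn {m : ℕ} (f : Fin m → ℝ) (l : List ℝ) (hl : l.length = m) :
    List.dot (List.ofFn f) l = ∑ i : Fin m, f i * l.getD i 0 := by
  subst hl
  have : List.zipWith (· * ·) (List.ofFn f) l =
      List.ofFn fun i : Fin l.length => f i * l[(i : ℕ)] := by
    apply List.ext_getElem <;> simp
  rw [List.dot, this, List.sum_ofFn]
  simp

theorem EuclideanSpace.real_inner_eq_sum {m : ℕ} (x y : EuclideanSpace ℝ (Fin m)) :
    inner ℝ x y = ∑ i, x i * y i := by
  simp [PiLp.inner_apply, mul_comm]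

theorem finite_setOf_numLeaves_le (n : ℕ) : {t : BinaryTree Unit | t.numLeaves ≤ n}.Finite := by
  induction n with
  | zero =>
    refine Set.Finite.subset Set.finite_empty fun t ht => ?_
    exact absurd ht (by simpa using t.numLeaves_pos.ne')
  | succ n ih =>
    refine ((ih.image2 (BinaryTree.node ()) ih).insert .nil).subset fun t ht => ?_
    cases t with
    | nil => exact .inl rfl
    | node _ a c =>
      have ha := a.numLeaves_pos
      have hc := c.numLeaves_pos
      simp only [Set.mem_ofPred_eq, BinaryTree.numLeaves] at ht
      exact .inr ⟨a, by simp; omega, c, by simp; omega, rfl⟩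

theorem finite_setOf_leaves_le (n : ℕ) : {t : ColoredBinaryTree | t.leaves ≤ n}.Finite := by
  induction n with
  | zero =>
    refine Set.Finite.subset Set.finite_empty fun t ht => ?_
    exact absurd ht (by simpa using t.leaves_pos.ne')
  | succ n ih =>
    refine ((ih.image2 .red ih).union ((finite_setOf_numLeaves_le (n + 1)).image .cut)).subset
      fun t ht => ?_
    cases t with
    | cut t => exact .inr ⟨t, ht, rfl⟩
    | red a c =>
      have ha := a.leaves_pos
      have hc := c.leaves_pos
      simp only [Set.mem_ofPred_eq, ColoredBinaryTree.leaves] at ht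
      exact .inl ⟨a, by simp; omega, c, by simp; omega, rfl⟩

instance AtomicTree.finite (n : ℕ) : Finite (AtomicTree n) :=
  ((finite_setOf_leaves_le n).subset fun _ h => h.le : {t : ColoredBinaryTree | t.leaves = n}.Finite)

/-! ### The faces of the Forcey–Loday realization -/

section Faces

variable {m : ℕ} {ω : Fin (m + 1) → ℝ} {u v x y : EuclideanSpace ℝ (Fin m)}
  {s t : AtomicTree (m + 1)}

/-- The labels of a vector. -/
def labelList (u : EuclideanSpace ℝ (Fin m)) : List ℝ := List.ofFn fun i => u i

theorem exists_labelList_eq {l : List ℝ} (hl : l.length = m) :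
    ∃ u : EuclideanSpace ℝ (Fin m), labelList u = l := by
  subst hl
  exact ⟨WithLp.toLp 2 fun i => l[(i : ℕ)], by simp [labelList, List.ofFn_getElem]⟩

theorem length_labelList : (labelList u).length = m := by simp [labelList]

theorem inner_forceyLodayPoint :
    inner ℝ u (forceyLodayPoint ω t) = (labelList u).dot (t.1.coords (List.ofFn ω)) := by
  have h := t.1.length_coords (List.ofFn ω)
  rw [t.2] at h
  rw [labelList, List.dot_ofFn _ _ (by omega), EuclideanSpace.real_inner_eq_sum]
  rfl

/-- The minimum of the scalar product with `u` on the Forcey–Loday realization. -/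
noncomputable def minValue (ω : Fin (m + 1) → ℝ) (u : EuclideanSpace ℝ (Fin m)) : ℝ :=
  pairSum min colorWeight (labelList u) (List.ofFn ω)

/-- The face of the Forcey–Loday realization on which the scalar product with `u` is minimal. -/
def minFace (ω : Fin (m + 1) → ℝ) (u : EuclideanSpace ℝ (Fin m)) :
    Set (EuclideanSpace ℝ (Fin m)) :=
  {x ∈ forceyLoday ω | inner ℝ u x = minValue ω u}

theorem minValue_le_inner_point (hω : ∀ i, 0 < ω i) :
    minValue ω u ≤ inner ℝ u (forceyLodayPoint ω t) ∧
      (inner ℝ u (forceyLodayPoint ω t) = minValue ω u ↔ t.1.Fits (labelList u)) := by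
  have := t.1.pairSum_le_dot (u := labelList u) (w := List.ofFn ω) (by simp [labelList, t.2])
    (by simp [t.2]) (by simpa only [List.forall_mem_ofFn_iff] using hω)
  rw [inner_forceyLodayPoint, eq_comm]
  exact this

theorem forceyLodayPoint_mem : forceyLodayPoint ω t ∈ forceyLoday ω :=
  subset_convexHull _ _ ⟨t, rfl⟩

theorem forceyLodayPoint_mem_minFace (hω : ∀ i, 0 < ω i) :
    forceyLodayPoint ω t ∈ minFace ω u ↔ t.1.Fits (labelList u) := by
  rw [← (minValue_le_inner_point hω).2]
  exact and_iff_right forceyLodayPoint_mem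

/-- The asserted property is stable under convex combinations and holds at the vertices. The second
part says that a minimal face is spanned by the vertices it contains. -/
theorem minFace_aux (hω : ∀ i, 0 < ω i) (hx : x ∈ forceyLoday ω) :
    minValue ω u ≤ inner ℝ u x ∧ (inner ℝ u x = minValue ω u →
      x ∈ convexHull ℝ (forceyLodayPoint ω '' {t | t.1.Fits (labelList u)})) := by
  have hconv : Convex ℝ {x | minValue ω u ≤ inner ℝ u x ∧ (inner ℝ u x = minValue ω u →
      x ∈ convexHull ℝ (forceyLodayPoint ω '' {t | t.1.Fits (labelList u)}))} := by
    intro x hx y hy a b ha hb hab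
    simp only [Set.mem_ofPred_eq, inner_add_right, inner_smul_right] at *
    have h1 := mul_le_mul_of_nonneg_left hx.1 ha
    have h2 := mul_le_mul_of_nonneg_left hy.1 hb
    have h3 : minValue ω u = a * minValue ω u + b * minValue ω u := by rw [← add_mul, hab, one_mul]
    refine ⟨by linarith, fun h => ?_⟩
    rw [h3, eq_comm, add_eq_add_iff_eq_and_eq h1 h2, mul_eq_mul_left_iff, mul_eq_mul_left_iff] at h
    rcases eq_or_ne a 0 with rfl | ha'
    · obtain rfl : b = 1 := by linarith
      simpa using hy.2 (by simpa [eq_comm] using h.2)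
    rcases eq_or_ne b 0 with rfl | hb'
    · obtain rfl : a = 1 := by linarith
      simpa using hx.2 (by simpa [eq_comm] using h.1)
    · exact convex_convexHull ℝ _ (hx.2 (by simpa [ha', eq_comm] using h.1))
        (hy.2 (by simpa [hb', eq_comm] using h.2)) ha hb hab
  refine convexHull_min ?_ hconv hx
  rintro _ ⟨t, rfl⟩
  exact ⟨(minValue_le_inner_point hω).1, fun h => subset_convexHull _ _
    ⟨t, (minValue_le_inner_point hω).2.1 h, rfl⟩⟩

theorem minValue_le_inner (hω : ∀ i, 0 < ω i) (hx : x ∈ forceyLoday ω) :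
    minValue ω u ≤ inner ℝ u x :=
  (minFace_aux hω hx).1

theorem minFace_eq_convexHull (hω : ∀ i, 0 < ω i) :
    minFace ω u = convexHull ℝ (forceyLodayPoint ω '' {t | t.1.Fits (labelList u)}) := by
  apply Set.Subset.antisymm
  · exact fun x hx => (minFace_aux hω hx.1).2 hx.2
  · have h1 : Convex ℝ (minFace ω u) := by
      have h2 : Convex ℝ {x : EuclideanSpace ℝ (Fin m) | inner ℝ u x = minValue ω u} := by
        intro x hx y hy a b ha hb hab
        simp only [Set.mem_ofPred_eq, inner_add_right, inner_smul_right] at *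
        rw [hx, hy, ← add_mul, hab, one_mul]
      exact (convex_convexHull ℝ _).inter h2
    refine convexHull_min ?_ h1
    rintro _ ⟨t, ht, rfl⟩
    exact (forceyLodayPoint_mem_minFace hω).2 ht

theorem exists_atomicTree_fits (u : EuclideanSpace ℝ (Fin m)) :
    ∃ t : AtomicTree (m + 1), t.1.Fits (labelList u) := by
  obtain ⟨t, ht⟩ := ColoredBinaryTree.exists_fits (labelList u)
  exact ⟨⟨t, by rw [← ht.length_eq, length_labelList]⟩, ht⟩

theorem minFace_eq (hω : ∀ i, 0 < ω i) :
    minFace ω u = {x ∈ forceyLoday ω | ∀ y ∈ forceyLoday ω, inner ℝ u x ≤ inner ℝ u y} := by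
  ext x
  refine and_congr_right fun hx => ⟨fun h y hy => h ▸ minValue_le_inner hω hy, fun h => ?_⟩
  obtain ⟨t, ht⟩ := exists_atomicTree_fits u
  refine le_antisymm ?_ (minValue_le_inner hω hx)
  rw [← (minValue_le_inner_point hω).2.2 ht]
  exact h _ forceyLodayPoint_mem

theorem isExposed_minFace (hω : ∀ i, 0 < ω i) : IsExposed ℝ (forceyLoday ω) (minFace ω u) := by
  -- Exposed faces are sets of maximizers, whence the sign.
  refine fun _ => ⟨innerSL ℝ (-u), ?_⟩
  simp [minFace_eq hω]

theorem minFace_nonempty (hω : ∀ i, 0 < ω i) : (minFace ω u).Nonempty := by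
  obtain ⟨t, ht⟩ := exists_atomicTree_fits u
  exact ⟨_, (forceyLodayPoint_mem_minFace hω).2 ht⟩

theorem exists_eq_minFace (hω : ∀ i, 0 < ω i) {F : Set (EuclideanSpace ℝ (Fin m))}
    (hF : IsExposed ℝ (forceyLoday ω) F) (hne : F.Nonempty) : ∃ u, F = minFace ω u := by
  obtain ⟨l, rfl⟩ := hF hne
  refine ⟨-(InnerProductSpace.toDual ℝ _).symm l, ?_⟩
  simp [minFace_eq hω]

theorem minFace_subset_iff (hω : ∀ i, 0 < ω i) : minFace ω u ⊆ minFace ω v ↔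
    ∀ t : AtomicTree (m + 1), t.1.Fits (labelList u) → t.1.Fits (labelList v) := by
  constructor
  · intro h t ht
    exact (forceyLodayPoint_mem_minFace hω).1 (h ((forceyLodayPoint_mem_minFace hω).2 ht))
  · intro h
    rw [minFace_eq_convexHull hω, minFace_eq_convexHull hω]
    exact convexHull_mono (Set.image_mono h)

theorem exists_labelList_fits_iff {p : ColoredBinaryTree → Prop} {l : List ℝ}
    (h : ∀ r : ColoredBinaryTree, r.Fits l ↔ p r) (hs : p s.1) :
    ∃ u : EuclideanSpace ℝ (Fin m), ∀ r : ColoredBinaryTree, r.Fits (labelList u) ↔ p r := by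
  have h1 := ((h _).2 hs).length_eq
  rw [s.2] at h1
  obtain ⟨u, rfl⟩ := exists_labelList_eq (by omega : l.length = m)
  exact ⟨u, h⟩

theorem exists_minFace_eq_singleton (hω : ∀ i, 0 < ω i) (t : AtomicTree (m + 1)) :
    ∃ u, (∀ r : AtomicTree (m + 1), r.1.Fits (labelList u) ↔ r = t) ∧
      minFace ω u = {forceyLodayPoint ω t} := by
  obtain ⟨l, hl⟩ := t.1.exists_fits_iff_eq
  obtain ⟨u, hu⟩ := exists_labelList_fits_iff hl rfl
  have h : ∀ r : AtomicTree (m + 1), r.1.Fits (labelList u) ↔ r = t := fun r =>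
    (hu r.1).trans Subtype.ext_iff.symm
  exact ⟨u, h, by simp [minFace_eq_convexHull hω, h]⟩

theorem forceyLodayPoint_injective (hω : ∀ i, 0 < ω i) :
    Function.Injective (forceyLodayPoint ω) := by
  intro s t h
  obtain ⟨u, h1, h2⟩ := exists_minFace_eq_singleton hω t
  rw [← h1, ← forceyLodayPoint_mem_minFace hω, h2]
  exact h

theorem forceyLodayPoint_mem_extremePoints (hω : ∀ i, 0 < ω i) :
    forceyLodayPoint ω t ∈ (forceyLoday ω).extremePoints ℝ := by
  obtain ⟨u, h1, h2⟩ := exists_minFace_eq_singleton hω t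
  refine exposedPoints_subset_extremePoints ?_
  rw [mem_exposedPoints_iff_exposed_singleton, ← h2]
  exact isExposed_minFace hω

theorem isPolytope_forceyLoday : IsPolytope (forceyLoday ω) :=
  ⟨(Set.finite_range (forceyLodayPoint ω)).toFinset, by simp [forceyLoday]⟩

/-! ### The dimension -/

theorem BinaryTree.exists_numLeaves (n : ℕ) : ∃ t : BinaryTree Unit, t.numLeaves = n + 1 := by
  induction n with
  | zero => exact ⟨.nil, rfl⟩
  | succ n ih =>
    obtain ⟨t, ht⟩ := ih
    exact ⟨.node () t .nil, by simp [numLeaves, ht]⟩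

/-- The atomic tree with only red vertices. -/
def BinaryTree.toRed : BinaryTree Unit → ColoredBinaryTree
  | .nil => .cut .nil
  | .node _ a c => .red a.toRed c.toRed

theorem BinaryTree.leaves_toRed (t : BinaryTree Unit) : t.toRed.leaves = t.numLeaves := by
  induction t with
  | nil => rfl
  | node _ a c ha hc => simp [toRed, ColoredBinaryTree.leaves, numLeaves, ha, hc]

theorem BinaryTree.nonpos_of_fits_toRed {t : BinaryTree Unit} {l : List ℝ} (h : t.toRed.Fits l) :
    ∀ x ∈ l, x ≤ 0 := by
  induction t generalizing l with
  | nil =>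
    have := h.length_eq
    simp_all [toRed, ColoredBinaryTree.leaves, numLeaves]
  | node _ a c ha hc =>
    cases h with
    | red hg h1 h2 => exact forall_mem_append_cons.2 ⟨hg, ha h1, hc h2⟩

/-- A vector orthogonal to the polytope is minimal at every vertex, so its labels fit every atomic
tree. An entirely blue tree forces them to be nonnegative, an entirely red one nonpositive. -/
theorem finrank_vectorSpan_forceyLoday (hω : ∀ i, 0 < ω i) :
    Module.finrank ℝ (vectorSpan ℝ (forceyLoday ω)) = m := by
  suffices h : vectorSpan ℝ (forceyLoday ω) = ⊤ by
    rw [h, finrank_top, finrank_euclideanSpace_fin]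
  rw [← Submodule.orthogonal_eq_bot_iff, Submodule.eq_bot_iff]
  intro u hu
  have hconst : ∀ t : AtomicTree (m + 1), t.1.Fits (labelList u) := by
    intro t
    obtain ⟨s, hs⟩ := exists_atomicTree_fits u
    rw [← (minValue_le_inner_point hω).2] at hs ⊢
    rw [← hs, ← sub_eq_zero, ← inner_sub_right, real_inner_comm]
    exact (Submodule.mem_orthogonal _ _).1 hu _
      (vsub_mem_vectorSpan ℝ forceyLodayPoint_mem forceyLodayPoint_mem)
  obtain ⟨t, ht⟩ := BinaryTree.exists_numLeaves m
  have h1 : ∀ x ∈ labelList u, 0 ≤ x := by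
    have := hconst ⟨.cut t, ht⟩
    cases this with
    | cut _ h => exact h
  have h2 := BinaryTree.nonpos_of_fits_toRed (hconst ⟨t.toRed, by rw [t.leaves_toRed, ht]⟩)
  ext i
  have hi : u i ∈ labelList u := by simp [labelList]
  exact le_antisymm (h2 _ hi) (h1 _ hi)

/-! ### The isomorphism of face lattices -/

theorem exists_strictLabels (T : CT (m + 1)) :
    ∃ u : EuclideanSpace ℝ (Fin m), T.1.HasLabels (· < ·) (labelList u) := by
  obtain ⟨l, hl⟩ := T.2.1.exists_hasLabels
  have h1 := hl.length_eq
  rw [T.2.2] at h1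
  obtain ⟨u, rfl⟩ := exists_labelList_eq (by omega : l.length = m)
  exact ⟨u, hl⟩

theorem toCT_le_iff {T : CT (m + 1)} {l : List ℝ} (h : T.1.HasLabels (· < ·) l) :
    t.toCT ≤ T ↔ t.1.Fits l := by
  rw [← CT.hasLabels_iff_le h, ← ColoredBinaryTree.hasLabels_iff_fits]
  rfl

/-- A tree is sent to the minimal face of any of its strict labellings, whose vertices are the
atomic trees below it; so the order is compared on atomic trees. For surjectivity, a vector defining
a face fits some atomic tree, and resolving its ties yields a tree with the same vertices. -/
theorem exists_faceLattice_iso (hω : ∀ i, 0 < ω i) :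
    ∃ Φ : WithBot (CT (m + 1)) ≃o Face (forceyLoday ω), ∀ t : AtomicTree (m + 1),
      (Φ (t.toCT : WithBot (CT (m + 1)))).1 = {forceyLodayPoint ω t} := by
  choose f hf using exists_strictLabels (m := m)
  let Φ : WithBot (CT (m + 1)) → Face (forceyLoday ω) := fun T =>
    WithBot.recBotCoe ⟨∅, isExposed_empty⟩ (fun T => ⟨minFace ω (f T), isExposed_minFace hω⟩) T
  have hle : ∀ S T, Φ S ≤ Φ T ↔ S ≤ T := by
    intro S T
    induction S using WithBot.recBotCoe with
    | bot => exact iff_of_true (Set.empty_subset _) bot_le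
    | coe S =>
      induction T using WithBot.recBotCoe with
      | bot =>
        refine iff_of_false (fun h => ?_) (WithBot.not_coe_le_bot S)
        exact (minFace_nonempty hω).ne_empty (Set.subset_empty_iff.1 h)
      | coe T =>
        rw [WithBot.coe_le_coe, CT.le_iff_forall_atomic]
        refine (minFace_subset_iff hω).trans (forall_congr' fun t => ?_)
        rw [toCT_le_iff (hf S), toCT_le_iff (hf T)]
  have hinj : Function.Injective Φ := by
    intro S T h
    have h1 := (hle S T).1 h.le
    have h2 := (hle T S).1 h.ge
    induction S using WithBot.recBotCoe with
    | bot =>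
      induction T using WithBot.recBotCoe with
      | bot => rfl
      | coe T => exact absurd h2 (WithBot.not_coe_le_bot T)
    | coe S =>
      induction T using WithBot.recBotCoe with
      | bot => exact absurd h1 (WithBot.not_coe_le_bot S)
      | coe T => rw [CT.antisymm (WithBot.coe_le_coe.1 h1) (WithBot.coe_le_coe.1 h2)]
  have hsurj : Function.Surjective Φ := by
    rintro ⟨F, hF⟩
    rcases F.eq_empty_or_nonempty with rfl | hne
    · exact ⟨⊥, rfl⟩
    · obtain ⟨u, rfl⟩ := exists_eq_minFace hω hF hne
      obtain ⟨t, ht⟩ := exists_atomicTree_fits u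
      obtain ⟨T, -, hT⟩ := CT.exists_ge_strict (S := t.toCT)
        (ColoredBinaryTree.hasLabels_iff_fits.2 ht)
      refine ⟨T, Subtype.ext ?_⟩
      change minFace ω (f T) = minFace ω u
      apply Set.Subset.antisymm <;> rw [minFace_subset_iff hω] <;> intro s
      · rw [← toCT_le_iff (hf T), ← toCT_le_iff hT]; exact id
      · rw [← toCT_le_iff (hf T), ← toCT_le_iff hT]; exact id
  refine ⟨⟨Equiv.ofBijective Φ ⟨hinj, hsurj⟩, hle _ _⟩, fun t => ?_⟩
  change minFace ω (f t.toCT) = _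
  have : {s : AtomicTree (m + 1) | s.1.Fits (labelList (f t.toCT))} = {t} := by
    ext s
    rw [Set.mem_ofPred_eq, ← toCT_le_iff (hf t.toCT)]
    exact ⟨fun h => AtomicTree.eq_of_toCT_le h, fun h => h ▸ .refl⟩
  simp [minFace_eq_convexHull hω, this]

end Faces

/-! ### The order of the vertices -/

namespace BinaryTree

variable {s t : BinaryTree Unit} {v w : List ℝ}

theorem coords_node_append {a c : BinaryTree Unit} {w₁ w₂ : List ℝ} (h : w₁.length = a.numLeaves) :
    (BinaryTree.node () a c).coords (w₁ ++ w₂) =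
      a.coords w₁ ++ (w₁.sum * w₂.sum) :: c.coords w₂ := by
  simp [coords, ← h]

theorem Rotation.numLeaves_eq (h : s.Rotation t) : s.numLeaves = t.numLeaves := by
  induction h with
  | root => simp [numLeaves, add_assoc]
  | left _ _ ih => simp [numLeaves, ih]
  | right _ _ ih => simp [numLeaves, ih]

end BinaryTree

theorem List.exists_append_of_length {α : Type*} {w : List α} {k l : ℕ} (h : w.length = k + l) :
    ∃ w₁ w₂, w = w₁ ++ w₂ ∧ w₁.length = k ∧ w₂.length = l :=
  ⟨w.take k, w.drop k, by simp, by simp; omega, by simp; omega⟩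

/-- The list `v` is positive and decreasing. -/
def List.DecreasingPos (v : List ℝ) : Prop :=
  v.Pairwise (· > ·) ∧ ∀ x ∈ v, 0 < x

theorem List.DecreasingPos.of_append_cons {v₁ v₂ : List ℝ} {x : ℝ}
    (h : (v₁ ++ x :: v₂).DecreasingPos) :
    v₁.DecreasingPos ∧ v₂.DecreasingPos ∧ 0 < x ∧ ∀ y ∈ v₂, y < x := by
  obtain ⟨h1, h2⟩ := h
  rw [List.pairwise_append, List.pairwise_cons] at h1
  rw [BinaryTree.forall_mem_append_cons] at h2
  exact ⟨⟨h1.1, h2.2.1⟩, ⟨h1.2.1.2, h2.2.2⟩, h2.1, h1.2.1.1⟩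

theorem List.exists_pos_splits {v w : List ℝ} {k l : ℕ} (hv : v.length + 1 = k + l)
    (hk : 0 < k) (hl : 0 < l) (hw : w.length = k + l) (hpos : ∀ x ∈ w, 0 < x) :
    ∃ v₁ x v₂ w₁ w₂, v = v₁ ++ x :: v₂ ∧ w = w₁ ++ w₂ ∧ v₁.length + 1 = k ∧ v₂.length + 1 = l ∧
      w₁.length = k ∧ w₂.length = l ∧ (∀ x ∈ w₁, 0 < x) ∧ (∀ x ∈ w₂, 0 < x) ∧
      0 < w₁.sum ∧ 0 < w₂.sum := by
  obtain ⟨k, rfl⟩ := Nat.exists_eq_succ_of_ne_zero hk.ne'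
  obtain ⟨l, rfl⟩ := Nat.exists_eq_succ_of_ne_zero hl.ne'
  obtain ⟨v₁, x, v₂, rfl, h1, h2⟩ := List.exists_split_of_length hv
  obtain ⟨w₁, w₂, rfl, h3, h4⟩ := List.exists_append_of_length hw
  have h5 : ∀ x ∈ w₁, 0 < x := fun x hx => hpos x (by simp [hx])
  have h6 : ∀ x ∈ w₂, 0 < x := fun x hx => hpos x (by simp [hx])
  exact ⟨v₁, x, v₂, w₁, w₂, rfl, rfl, by omega, by omega, h3, h4, h5, h6,
    List.sum_pos_of_forall_pos h5 (by omega), List.sum_pos_of_forall_pos h6 (by omega)⟩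

/-- The difference of the two sides is `(x - y) α γ`: a rotation changes only two coordinates,
shifting the product of the outer weights from the right vertex to the left one. -/
theorem rotation_sum_lt {A B C x y α β γ : ℝ} (hα : 0 < α) (hγ : 0 < γ) (h : y < x) :
    A + x * (α * β) + B + y * ((α + β) * γ) + C <
      A + x * (α * (β + γ)) + (B + y * (β * γ) + C) := by
  have := mul_pos (mul_pos hα hγ) (sub_pos.2 h)
  linarith

theorem BinaryTree.Rotation.dot_lt {s t : BinaryTree Unit} (h : s.Rotation t) {v w : List ℝ}
    (hv : v.length + 1 = s.numLeaves) (hw : w.length = s.numLeaves) (hpos : ∀ x ∈ w, 0 < x)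
    (hdec : v.DecreasingPos) : v.dot (s.coords w) < v.dot (t.coords w) := by
  induction h generalizing v w with
  | root a b c =>
    simp only [numLeaves, add_assoc] at hv hw
    obtain ⟨v₁, x, v₂, w₁, w₂, rfl, rfl, l1, l2, l3, l4, h1, h2, h3, h4⟩ :=
      List.exists_pos_splits hv a.numLeaves_pos (by have := b.numLeaves_pos; omega) hw hpos
    obtain ⟨v₂, y, v₃, w₂, w₃, rfl, rfl, l5, l6, l7, l8, h5, h6, h7, h8⟩ :=
      List.exists_pos_splits l2 b.numLeaves_pos c.numLeaves_pos l4 h2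
    have hxy := hdec.of_append_cons.2.2.2 y (by simp)
    have e1 := a.length_coords w₁
    have e2 := b.length_coords w₂
    have e3 : (BinaryTree.node () (.node () a b) c).coords (w₁ ++ (w₂ ++ w₃)) =
        (a.coords w₁ ++ (w₁.sum * w₂.sum) :: b.coords w₂) ++
          ((w₁.sum + w₂.sum) * w₃.sum) :: c.coords w₃ := by
      rw [← List.append_assoc, coords_node_append (by simp [numLeaves]; omega),
        coords_node_append l3, List.sum_append]
    have e4 : v₁ ++ x :: (v₂ ++ y :: v₃) = (v₁ ++ x :: v₂) ++ y :: v₃ := by simp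
    rw [coords_node_append l3, coords_node_append l7, List.dot_append_cons (g := x) (by omega),
      List.dot_append_cons (g := y) (by omega), e3, e4, List.dot_append_cons (by simp; omega),
      List.dot_append_cons (by omega), List.sum_append]
    exact rotation_sum_lt h3 h8 hxy
  | @left s t c h ih =>
    rw [numLeaves] at hv hw
    obtain ⟨v₁, x, v₂, w₁, w₂, rfl, rfl, l1, l2, l3, l4, h1, h2, h3, h4⟩ :=
      List.exists_pos_splits hv s.numLeaves_pos c.numLeaves_pos hw hpos
    have e1 := s.length_coords w₁
    have e2 := t.length_coords w₁
    have e3 := h.numLeaves_eq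
    rw [coords_node_append (by omega), coords_node_append (by omega),
      List.dot_append_cons (by omega), List.dot_append_cons (by omega)]
    have := ih l1 l3 h1 hdec.of_append_cons.1
    linarith
  | @right c s t h ih =>
    rw [numLeaves] at hv hw
    obtain ⟨v₁, x, v₂, w₁, w₂, rfl, rfl, l1, l2, l3, l4, h1, h2, h3, h4⟩ :=
      List.exists_pos_splits hv c.numLeaves_pos s.numLeaves_pos hw hpos
    have e1 := c.length_coords w₁
    rw [coords_node_append (by omega), coords_node_append (by omega),
      List.dot_append_cons (by omega), List.dot_append_cons (by omega)]
    have := ih l2 l4 h2 hdec.of_append_cons.2.1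
    linarith

namespace ColoredBinaryTree

theorem coords_red_append {a c : ColoredBinaryTree} {w₁ w₂ : List ℝ} (h : w₁.length = a.leaves) :
    (red a c).coords (w₁ ++ w₂) =
      a.coords w₁ ++ (2 * w₁.sum * w₂.sum) :: c.coords w₂ := by
  simp [coords, ← h]

theorem Cover.leaves_eq {s t : ColoredBinaryTree} (h : s.Cover t) : s.leaves = t.leaves := by
  induction h with
  | rotateBlue h => simp [leaves, h.numLeaves_eq]
  | rotateRed => simp [leaves, add_assoc]
  | recolor => simp [leaves, BinaryTree.numLeaves]
  | left _ _ ih => simp [leaves, ih]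
  | right _ _ ih => simp [leaves, ih]

/-- A blue rotation gains `α γ (x - y)`, a red one twice as much, and a recoloring doubles one
coordinate, which gains since `v` is positive. -/
theorem Cover.dot_lt {s t : ColoredBinaryTree} (h : s.Cover t) {v w : List ℝ}
    (hv : v.length + 1 = s.leaves) (hw : w.length = s.leaves) (hpos : ∀ x ∈ w, 0 < x)
    (hdec : v.DecreasingPos) : v.dot (s.coords w) < v.dot (t.coords w) := by
  induction h generalizing v w with
  | rotateBlue h => exact h.dot_lt hv hw hpos hdec
  | rotateRed a b c =>
    simp only [leaves, add_assoc] at hv hw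
    obtain ⟨v₁, x, v₂, w₁, w₂, rfl, rfl, l1, l2, l3, l4, h1, h2, h3, h4⟩ :=
      List.exists_pos_splits hv a.leaves_pos (by have := b.leaves_pos; omega) hw hpos
    obtain ⟨v₂, y, v₃, w₂, w₃, rfl, rfl, l5, l6, l7, l8, h5, h6, h7, h8⟩ :=
      List.exists_pos_splits l2 b.leaves_pos c.leaves_pos l4 h2
    have hxy := hdec.of_append_cons.2.2.2 y (by simp)
    have e1 := a.length_coords w₁
    have e2 := b.length_coords w₂
    have e3 : (red (red a b) c).coords (w₁ ++ (w₂ ++ w₃)) =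
        (a.coords w₁ ++ (2 * w₁.sum * w₂.sum) :: b.coords w₂) ++
          (2 * (w₁.sum + w₂.sum) * w₃.sum) :: c.coords w₃ := by
      rw [← List.append_assoc, coords_red_append (by simp [leaves]; omega),
        coords_red_append l3, List.sum_append]
    have e4 : v₁ ++ x :: (v₂ ++ y :: v₃) = (v₁ ++ x :: v₂) ++ y :: v₃ := by simp
    rw [coords_red_append l3, coords_red_append l7, List.dot_append_cons (g := x) (by omega),
      List.dot_append_cons (g := y) (by omega), e3, e4, List.dot_append_cons (by simp; omega),
      List.dot_append_cons (by omega), List.sum_append]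
    have := mul_pos (mul_pos h3 h8) (sub_pos.2 hxy)
    linarith
  | recolor a c =>
    simp only [leaves, BinaryTree.numLeaves] at hv hw
    obtain ⟨v₁, x, v₂, w₁, w₂, rfl, rfl, l1, l2, l3, l4, h1, h2, h3, h4⟩ :=
      List.exists_pos_splits hv a.numLeaves_pos c.numLeaves_pos hw hpos
    have e1 := a.length_coords w₁
    rw [coords, BinaryTree.coords_node_append (by omega), coords_red_append (by simpa [leaves]),
      coords, coords, List.dot_append_cons (by omega), List.dot_append_cons (by omega)]
    have := mul_pos hdec.of_append_cons.2.2.1 (mul_pos h3 h4)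
    linarith
  | @left s t c h ih =>
    rw [leaves] at hv hw
    obtain ⟨v₁, x, v₂, w₁, w₂, rfl, rfl, l1, l2, l3, l4, h1, h2, h3, h4⟩ :=
      List.exists_pos_splits hv s.leaves_pos c.leaves_pos hw hpos
    have e1 := s.length_coords w₁
    have e2 := t.length_coords w₁
    have e3 := h.leaves_eq
    rw [coords_red_append (by omega), coords_red_append (by omega),
      List.dot_append_cons (by omega), List.dot_append_cons (by omega)]
    have := ih l1 l3 h1 hdec.of_append_cons.1
    linarith
  | @right c s t h ih =>
    rw [leaves] at hv hw
    obtain ⟨v₁, x, v₂, w₁, w₂, rfl, rfl, l1, l2, l3, l4, h1, h2, h3, h4⟩ :=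
      List.exists_pos_splits hv c.leaves_pos s.leaves_pos hw hpos
    have e1 := c.length_coords w₁
    rw [coords_red_append (by omega), coords_red_append (by omega),
      List.dot_append_cons (by omega), List.dot_append_cons (by omega)]
    have := ih l2 l4 h2 hdec.of_append_cons.2.1
    linarith

end ColoredBinaryTree

/-! ### Good orientation vectors and the edges of the realization -/

section GoodOrientationVector

variable {m : ℕ} {v : EuclideanSpace ℝ (Fin m)}

theorem IsGoodOrientationVector.pos (hv : IsGoodOrientationVector v) (i : Fin m) : 0 < v i := by
  obtain ⟨i, hi⟩ := i
  obtain ⟨k, hk⟩ := Nat.exists_eq_add_of_lt hi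
  induction k generalizing i with
  | zero => exact hv.last_pos _ (by simp; omega)
  | succ k ih =>
    have h1 := ih (i + 1) (by omega) (by omega)
    have h2 := hv.two_mul_le i (by omega)
    linarith

/-- Each coordinate of a good orientation vector exceeds the sum of the following ones. -/
theorem IsGoodOrientationVector.sum_Ioi_lt (hv : IsGoodOrientationVector v) (i : Fin m) :
    ∑ j ∈ Finset.Ioi i, v j < v i := by
  obtain ⟨i, hi⟩ := i
  obtain ⟨k, hk⟩ := Nat.exists_eq_add_of_lt hi
  induction k generalizing i with
  | zero =>
    have : Finset.Ioi (⟨i, hi⟩ : Fin m) = ∅ := by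
      ext ⟨j, hj⟩
      simp [Fin.lt_def]
      omega
    rw [this, Finset.sum_empty]
    exact hv.pos _
  | succ k ih =>
    have hi' : i + 1 < m := by omega
    have h1 := ih (i + 1) hi' (by omega)
    have h2 := hv.two_mul_le i hi'
    have : Finset.Ioi (⟨i, hi⟩ : Fin m) = insert ⟨i + 1, hi'⟩ (Finset.Ioi ⟨i + 1, hi'⟩) := by
      ext ⟨j, hj⟩
      simp [Fin.lt_def]
    rw [this, Finset.sum_insert (by simp)]
    linarith

theorem IsGoodOrientationVector.decreasingPos (hv : IsGoodOrientationVector v) :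
    (labelList v).DecreasingPos := by
  refine ⟨List.pairwise_ofFn.2 fun i j hij => ?_, List.forall_mem_ofFn_iff.2 hv.pos⟩
  refine lt_of_le_of_lt ?_ (hv.sum_Ioi_lt i)
  exact Finset.single_le_sum (f := fun j => v j) (fun j _ => (hv.pos j).le) (by simpa using hij)

variable {ω : Fin (m + 1) → ℝ} {x y : EuclideanSpace ℝ (Fin m)} {s t : AtomicTree (m + 1)}

theorem inner_lt_of_cover (hω : ∀ i, 0 < ω i) (hv : IsGoodOrientationVector v)
    (h : s.1.Cover t.1) :
    inner ℝ v (forceyLodayPoint ω s) < inner ℝ v (forceyLodayPoint ω t) := by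
  rw [inner_forceyLodayPoint, inner_forceyLodayPoint]
  exact h.dot_lt (by simp [labelList, s.2]) (by simp [s.2])
    (by simpa only [List.forall_mem_ofFn_iff] using hω) hv.decreasingPos

theorem isEdge_of_cover (hω : ∀ i, 0 < ω i) (hv : IsGoodOrientationVector v)
    (h : s.1.Cover t.1) :
    IsEdge (forceyLoday ω) (forceyLodayPoint ω s) (forceyLodayPoint ω t) := by
  refine ⟨fun he => ((he ▸ inner_lt_of_cover hω hv h).false : False), ?_⟩
  obtain ⟨l, hl⟩ := h.exists_fits_iff
  obtain ⟨u, hu⟩ := exists_labelList_fits_iff hl (.inl rfl)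
  have : {r : AtomicTree (m + 1) | r.1.Fits (labelList u)} = {s, t} := by
    ext r
    exact (hu r.1).trans (or_congr Subtype.ext_iff.symm Subtype.ext_iff.symm)
  rw [← convexHull_pair, ← Set.image_pair, ← this, ← minFace_eq_convexHull hω]
  exact isExposed_minFace hω

/-- A vector defining the edge fits only the trees of the two ends, because vertices of the polytope
lying in a segment are its ends. It fits both, so it is not unique for `s`; hence it fits a tree
related to `s` by a cover, which has to be the other end. -/
theorem cover_of_isEdge (hω : ∀ i, 0 < ω i) (hv : IsGoodOrientationVector v)
    (h : IsEdge (forceyLoday ω) x y) : ∃ s t : AtomicTree (m + 1), x = forceyLodayPoint ω s ∧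
      y = forceyLodayPoint ω t ∧ (s.1.Cover t.1 ∨ t.1.Cover s.1) := by
  obtain ⟨hxy, h⟩ := h
  obtain ⟨u, hu⟩ := exists_eq_minFace hω h ⟨x, left_mem_segment ℝ x y⟩
  have hsub : ∀ r : AtomicTree (m + 1), r.1.Fits (labelList u) →
      forceyLodayPoint ω r = x ∨ forceyLodayPoint ω r = y := by
    intro r hr
    rw [← forceyLodayPoint_mem_minFace hω, ← hu] at hr
    have h1 : forceyLodayPoint ω r ∈ (segment ℝ x y).extremePoints ℝ := by
      rw [h.isExtreme.extremePoints_eq]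
      exact ⟨hr, forceyLodayPoint_mem_extremePoints hω⟩
    rw [← convexHull_pair] at h1
    simpa using extremePoints_convexHull_subset h1
  have hmem : ∀ x y : EuclideanSpace ℝ (Fin m), x ≠ y → x ∈ minFace ω u →
      (∀ r : AtomicTree (m + 1), r.1.Fits (labelList u) →
        forceyLodayPoint ω r = x ∨ forceyLodayPoint ω r = y) →
      ∃ s : AtomicTree (m + 1), x = forceyLodayPoint ω s ∧ s.1.Fits (labelList u) := by
    intro x y hxy hx hsub
    by_contra! hne
    rw [minFace_eq_convexHull hω] at hx
    have h1 : forceyLodayPoint ω '' {t | t.1.Fits (labelList u)} ⊆ {y} := by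
      rintro _ ⟨r, hr, rfl⟩
      exact (hsub r hr).resolve_left fun he => hne r he.symm hr
    exact hxy (by simpa using convexHull_mono h1 hx)
  obtain ⟨s, rfl, hs⟩ := hmem x y hxy (hu ▸ left_mem_segment ℝ x y) hsub
  obtain ⟨t, rfl, ht⟩ := hmem y _ hxy.symm (hu ▸ right_mem_segment ℝ _ y)
    fun r hr => (hsub r hr).symm
  refine ⟨s, t, rfl, rfl, ?_⟩
  rcases hs.unique_or_exists_cover with h1 | ⟨r, h1, h2⟩
  · exact absurd (congrArg _ (Subtype.ext (h1 t.1 ht)).symm) hxy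
  · have hr : r.leaves = m + 1 := by rw [← h2.length_eq, length_labelList]
    have hinj := forceyLodayPoint_injective hω
    -- The neighbour cannot be `s` itself, since a cover strictly increases the scalar product with
    -- `v`.
    rcases hsub ⟨r, hr⟩ h2 with h3 | h3
    · obtain rfl := hinj h3
      have : (⟨r, hr⟩ : AtomicTree (m + 1)).1.Cover r := h1.elim id id
      exact absurd (inner_lt_of_cover (s := ⟨r, hr⟩) (t := ⟨r, hr⟩) hω hv this) (lt_irrefl _)
    · obtain rfl := hinj h3
      exact h1

theorem le_iff_vertexOrder (hω : ∀ i, 0 < ω i) (hv : IsGoodOrientationVector v) :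
    s ≤ t ↔ VertexOrder (forceyLoday ω) v (forceyLodayPoint ω s) (forceyLodayPoint ω t) := by
  constructor
  · intro h
    exact Relation.ReflTransGen.lift (p := fun x y =>
      IsEdge (forceyLoday ω) x y ∧ inner ℝ v x < inner ℝ v y) (forceyLodayPoint ω)
      (fun s t h => ⟨isEdge_of_cover hω hv h, inner_lt_of_cover hω hv h⟩) _ _ h
  · intro h
    have key : ∀ y, VertexOrder (forceyLoday ω) v (forceyLodayPoint ω s) y →
        ∀ t : AtomicTree (m + 1), y = forceyLodayPoint ω t → s ≤ t := by
      intro y h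
      induction h with
      | refl =>
        intro t ht
        rw [forceyLodayPoint_injective hω ht]
        exact .refl
      | tail _ h ih =>
        rintro t rfl
        obtain ⟨r, t', rfl, h2, h3⟩ := cover_of_isEdge hω hv h.1
        obtain rfl := forceyLodayPoint_injective hω h2
        refine Relation.ReflTransGen.tail (ih r rfl) (h3.resolve_right fun h4 => ?_)
        exact (h.2.trans (inner_lt_of_cover hω hv h4)).false
    exact key _ h t rfl

end GoodOrientationVector

/-! ### The facet description of the Forcey–Loday realization -/

section Facets

variable {m : ℕ} {ω : Fin (m + 1) → ℝ} {u x : EuclideanSpace ℝ (Fin m)}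

theorem minValue_toLp_comp {f : ℝ → ℝ} (hf : Monotone f) :
    minValue ω (WithLp.toLp 2 fun i => f (u i)) =
      pairSum min (fun x => colorWeight (f x)) (labelList u) (List.ofFn ω) := by
  rw [← pairSum_map fun x y => hf.map_min]
  simp [minValue, labelList, List.map_ofFn, Function.comp_def]

/-- Monotone functions commute with `min`, so additivity of `colorWeight` on the values of `u`
passes to each pair of leaves. The set `K` is closed under `min` because the order is total. -/
theorem minValue_eq_add {p q : ℝ → ℝ} (hp : Monotone p) (hq : Monotone q) {c : ℝ} {K : Set ℝ}
    (hK : ∀ x ∈ K, colorWeight x = colorWeight (p x) + c * colorWeight (q x))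
    (hu : ∀ i, u i ∈ K) (hω : ∀ i, 0 < ω i) :
    minValue ω u = minValue ω (WithLp.toLp 2 fun i => p (u i)) +
      c * minValue ω (WithLp.toLp 2 fun i => q (u i)) := by
  rw [minValue_toLp_comp hp, minValue_toLp_comp hq, ← pairSum_mul_left, ← pairSum_add]
  have hmin : ∀ x ∈ K, ∀ y ∈ K, min x y ∈ K := fun x hx y hy => by
    rcases min_choice x y with h | h <;> rwa [h]
  have hu' : ∀ y ∈ labelList u, y ∈ K := List.forall_mem_ofFn_iff.2 hu
  have hw : ∀ y ∈ List.ofFn ω, 0 ≤ y := List.forall_mem_ofFn_iff.2 fun i => (hω i).le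
  exact le_antisymm (pairSum_mono hmin (fun x hx => (hK x hx).le) hu' hw)
    (pairSum_mono hmin (fun x hx => (hK x hx).ge) hu' hw)

/-- The normal vectors of the facets: the entries `some i` of `S` contribute basis vectors, and the
entry `none` contributes the vector `(-1, …, -1)`. -/
noncomputable def indicatorVector (S : Finset (Option (Fin m))) : EuclideanSpace ℝ (Fin m) :=
  WithLp.toLp 2 fun i => (if some i ∈ S then 1 else 0) - (if none ∈ S then 1 else 0)

/-- The family of coordinates of `x`, extended by the opposite of their sum. -/
noncomputable def extendedCoords (x : EuclideanSpace ℝ (Fin m)) (o : Option (Fin m)) : ℝ :=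
  o.elim (-∑ i, x i) x

theorem inner_indicatorVector (S : Finset (Option (Fin m))) :
    inner ℝ (indicatorVector S) x = ∑ o ∈ S, extendedCoords x o := by
  rw [EuclideanSpace.real_inner_eq_sum]
  have : ∑ o ∈ S, extendedCoords x o = ∑ o, if o ∈ S then extendedCoords x o else 0 := by
    rw [← Finset.sum_filter]
    simp
  rw [this, Fintype.sum_option]
  simp only [indicatorVector, extendedCoords, Option.elim, sub_mul, Finset.sum_sub_distrib, ite_mul,
    one_mul, zero_mul]
  by_cases h : none ∈ S <;> simp [h]
  ring

/-- As for a Lovász extension, `u` is a combination with positive coefficients of indicator vectors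
of level sets, along which `minValue` is additive. Each step removes the smallest positive level or,
when there is none, the negative level closest to `0`, so fewer coordinates are nonzero. The
summands have the same sign as the original values, where `colorWeight` is linear. -/
theorem minValue_le_inner_of_indicator (hω : ∀ i, 0 < ω i)
    (h : ∀ S, minValue ω (indicatorVector S) ≤ inner ℝ (indicatorVector S) x) :
    minValue ω u ≤ inner ℝ u x := by
  induction hn : (Finset.univ.filter fun i => u i ≠ 0).card using Nat.strong_induction_on
    generalizing u with
  | _ n ih =>
    have key : ∀ (p q : ℝ → ℝ) (c : ℝ) (K : Set ℝ) (S : Finset (Option (Fin m))) (j : Fin m),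
        Monotone p → Monotone q → 0 < c → (∀ x ∈ K, p x + c * q x = x) →
        (∀ x ∈ K, colorWeight x = colorWeight (p x) + c * colorWeight (q x)) →
        (∀ i, u i ∈ K) → p 0 = 0 → u j ≠ 0 → p (u j) = 0 →
        (∀ i, q (u i) = indicatorVector S i) → minValue ω u ≤ inner ℝ u x := by
      intro p q c K S j hp hq hc h1 h2 hu h0 hj hpj hS
      have hS' : (WithLp.toLp 2 fun i => q (u i)) = indicatorVector S := by
        ext i
        exact hS i
      rw [minValue_eq_add hp hq h2 hu hω, hS']
      have hu' : u = (WithLp.toLp 2 fun i => p (u i)) + c • indicatorVector S := by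
        ext i
        simp [← hS, h1 _ (hu i)]
      have h3 := ih _ ?_ (u := WithLp.toLp 2 fun i => p (u i)) rfl
      · have h4 := mul_le_mul_of_nonneg_left (h S) hc.le
        conv_rhs => rw [hu', inner_add_left, inner_smul_left]
        exact add_le_add h3 h4
      · rw [← hn]
        refine Finset.card_lt_card ((Finset.ssubset_iff_of_subset fun i hi => ?_).2 ⟨j, ?_, ?_⟩)
        · simp only [Finset.mem_filter, Finset.mem_univ, true_and] at hi ⊢
          exact fun h => hi (by simp [h, h0])
        · simpa using hj
        · simpa using hpj
    by_cases hpos : ∃ i, 0 < u i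
    · obtain ⟨j, hj, hmin⟩ := Finset.exists_min_image (Finset.univ.filter fun i => 0 < u i)
        (fun i => u i) (by simpa [Finset.filter_nonempty_iff] using hpos)
      simp only [Finset.mem_filter, Finset.mem_univ, true_and] at hj hmin
      -- The first function fixes the nonpositive values and lowers those from `u j` on by `u j`.
      -- The formula extends it monotonically over the gap between `0` and `u j`, where no
      -- coordinate lies.
      refine key (fun x => max (x - u j) (min x 0)) (fun x => if 0 < x then 1 else 0) (u j)
        {x | x ≤ 0 ∨ u j ≤ x} (Finset.univ.filter fun o => ∃ i, o = some i ∧ 0 < u i) j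
        ?_ ?_ hj ?_ ?_ ?_ ?_ hj.ne' ?_ ?_
      · intro x y hxy
        exact max_le_max (by linarith) (min_le_min_right _ hxy)
      · intro x y hxy
        dsimp only
        split_ifs <;> linarith
      · rintro x (hx | hx)
        · simp [hx, hx.not_gt, hj.le]
        · have := hj.trans_le hx
          simp [this, this.le, hx]
      · rintro x (hx | hx)
        · simp [hx, hx.not_gt, hj.le, colorWeight]
        · have := hj.trans_le hx
          simp [this, this.le, hx, colorWeight_of_nonneg]
      · intro i
        by_cases hi : 0 < u i
        · exact .inr (hmin i hi)
        · exact .inl (not_lt.1 hi)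
      · simp [hj.le]
      · simp [hj.le]
      · intro i
        simp [indicatorVector]
    · push Not at hpos
      by_cases hneg : ∃ i, u i < 0
      · obtain ⟨j, hj, hmax⟩ := Finset.exists_max_image (Finset.univ.filter fun i => u i < 0)
          (fun i => u i) (by simpa [Finset.filter_nonempty_iff] using hneg)
        simp only [Finset.mem_filter, Finset.mem_univ, true_and] at hj hmax
        -- Symmetrically, values up to `u j` are raised by `-u j` and `0` is fixed. The set contains
        -- `none`, so its vector is `-1` at the negative coordinates and `0` elsewhere.
        refine key (fun x => min (x - u j) (max x 0)) (fun x => if x < 0 then -1 else 0) (-u j)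
          {x | x = 0 ∨ x ≤ u j} (Finset.univ.filter fun o => ∀ i, o = some i → 0 ≤ u i) j
          ?_ ?_ (by linarith) ?_ ?_ ?_ ?_ hj.ne ?_ ?_
        · intro x y hxy
          exact min_le_min (by linarith) (max_le_max_right _ hxy)
        · intro x y hxy
          dsimp only
          split_ifs <;> linarith
        · rintro x (rfl | hx)
          · simp [hj.le]
          · have := hx.trans_lt hj
            simp [this, this.le, hx]
        · rintro x (rfl | hx)
          · simp [hj.le, colorWeight]
          · have h1 := hx.trans_lt hj
            simp only [h1, if_true, max_eq_right h1.le, min_eq_left (sub_nonpos.2 hx)]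
            rw [colorWeight_of_nonpos h1.le, colorWeight_of_nonpos (sub_nonpos.2 hx),
              colorWeight_of_nonpos (by norm_num)]
            ring
        · intro i
          rcases (hpos i).lt_or_eq with hi | hi
          · exact .inr (hmax i hi)
          · exact .inl hi
        · simp [hj.le]
        · simp [hj.le]
        · intro i
          by_cases hi : u i < 0
          · simp [indicatorVector, hi, hi.not_ge]
          · simp [indicatorVector, hi, not_lt.1 hi]
      · push Not at hneg
        have : u = indicatorVector ∅ := by
          ext i
          simpa [indicatorVector] using le_antisymm (hpos i) (hneg i)
        rw [this]
        exact h ∅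

/-- A point outside is separated from the polytope by a linear form; but the inequalities for
indicator vectors imply those for all linear forms. -/
theorem mem_forceyLoday_iff (hω : ∀ i, 0 < ω i) : x ∈ forceyLoday ω ↔
    ∀ S, minValue ω (indicatorVector S) ≤ ∑ o ∈ S, extendedCoords x o := by
  simp only [← inner_indicatorVector]
  refine ⟨fun h S => minValue_le_inner hω h, fun h => ?_⟩
  by_contra hx
  obtain ⟨l, r, h1, h2⟩ := geometric_hahn_banach_point_closed (convex_convexHull ℝ _)
    ((Set.finite_range (forceyLodayPoint ω)).isClosed_convexHull ℝ) hx
  obtain ⟨t, ht⟩ := exists_atomicTree_fits ((InnerProductSpace.toDual ℝ _).symm l)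
  have h3 := minValue_le_inner_of_indicator (u := (InnerProductSpace.toDual ℝ _).symm l) hω h
  rw [← (minValue_le_inner_point hω).2.2 ht] at h3
  simp only [InnerProductSpace.toDual_symm_apply] at h3
  exact absurd (h2 _ forceyLodayPoint_mem) (by linarith)

/-! ### Supermodularity of the minimum -/

theorem minValue_zero (hω : ∀ i, 0 < ω i) : minValue ω 0 = 0 := by
  obtain ⟨t, ht⟩ := exists_atomicTree_fits (0 : EuclideanSpace ℝ (Fin m))
  rw [← (minValue_le_inner_point hω).2.2 ht, inner_zero_left]

open Classical in
/-- The value of an indicator vector on a set of gaps between leaves. -/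
noncomputable def indicatorMin (S : Finset (Option (Fin m))) (I : Finset (Fin m)) : ℝ :=
  (if ∀ i ∈ I, some i ∈ S then 1 else 0) - (if none ∈ S then 1 else 0)

theorem ite_and_eq_min {a b : Prop} [Decidable a] [Decidable b] [Decidable (a ∧ b)] :
    (if a ∧ b then (1 : ℝ) else 0) = min (if a then 1 else 0) (if b then 1 else 0) := by
  by_cases ha : a <;> by_cases hb : b <;> simp [ha, hb]

theorem minValue_indicatorVector (S : Finset (Option (Fin m))) :
    minValue ω (indicatorVector S) = pairSum (· ∪ ·) (fun I => colorWeight (indicatorMin S I))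
      (List.ofFn fun i => {i}) (List.ofFn ω) := by
  rw [← pairSum_map (op := min)]
  · simp [minValue, labelList, List.map_ofFn, Function.comp_def, indicatorMin, indicatorVector]
  · intro I J
    have : (∀ i ∈ I ∪ J, some i ∈ S) ↔ (∀ i ∈ I, some i ∈ S) ∧ ∀ i ∈ J, some i ∈ S := by
      simp only [Finset.mem_union, or_imp, forall_and]
    simp only [indicatorMin, this, min_sub_sub_right]
    rw [ite_and_eq_min]

/-- The propositions say that a set of gaps is contained in `S`, in `T` or in their union, and that
`none` belongs to `S` or to `T`. Only the values `1`, `0`, `-2` of `colorWeight` occur, and the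
cases can be enumerated. -/
theorem colorWeight_supermodular {a b c α β : Prop} [Decidable a] [Decidable b] [Decidable c]
    [Decidable α] [Decidable β] (ha : a → c) (hb : b → c) :
    colorWeight ((if a then 1 else 0) - if α then 1 else 0) +
        colorWeight ((if b then 1 else 0) - if β then 1 else 0) ≤
      colorWeight ((if c then 1 else 0) - if α ∨ β then 1 else 0) +
        colorWeight ((if a ∧ b then 1 else 0) - if α ∧ β then 1 else 0) := by
  by_cases hc : c <;> by_cases ha : a <;> by_cases hb : b <;> by_cases hα : α <;>
    by_cases hβ : β <;> simp_all [colorWeight]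

theorem minValue_supermodular (hω : ∀ i, 0 < ω i) (S T : Finset (Option (Fin m))) :
    minValue ω (indicatorVector S) + minValue ω (indicatorVector T) ≤
      minValue ω (indicatorVector (S ∪ T)) + minValue ω (indicatorVector (S ∩ T)) := by
  simp only [minValue_indicatorVector, ← pairSum_add]
  refine pairSum_mono (K := Set.univ) (by simp) (fun I _ => ?_) (by simp)
    (List.forall_mem_ofFn_iff.2 fun i => (hω i).le)
  have h1 : (∀ i ∈ I, some i ∈ S ∩ T) ↔ (∀ i ∈ I, some i ∈ S) ∧ ∀ i ∈ I, some i ∈ T := by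
    simp only [Finset.mem_inter, imp_and, forall_and]
  have h2 : (∀ i ∈ I, some i ∈ S) → ∀ i ∈ I, some i ∈ S ∪ T := fun h i hi =>
    Finset.mem_union_left _ (h i hi)
  have h3 : (∀ i ∈ I, some i ∈ T) → ∀ i ∈ I, some i ∈ S ∪ T := fun h i hi =>
    Finset.mem_union_right _ (h i hi)
  simp only [indicatorMin, h1, Finset.mem_union (a := none), Finset.mem_inter (a := none)]
  exact colorWeight_supermodular h2 h3

end Facets

/-! ### Vectors with entries `-1`, `0`, `1` -/

/-- The first nonzero entry of `d` decides: its contribution `± v i` exceeds in absolute value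
everything that follows. -/
theorem IsGoodOrientationVector.inner_ne_zero {m : ℕ} {v d : EuclideanSpace ℝ (Fin m)}
    (hv : IsGoodOrientationVector v) (hd : ∀ i, d i = -1 ∨ d i = 0 ∨ d i = 1) (hne : d ≠ 0) :
    inner ℝ v d ≠ 0 := by
  have hne' : (Finset.univ.filter fun i => d i ≠ 0).Nonempty := by
    by_contra h
    rw [Finset.not_nonempty_iff_eq_empty, Finset.filter_eq_empty_iff] at h
    exact hne (by ext i; simpa using h (Finset.mem_univ i))
  obtain ⟨i, hi, hmin⟩ := Finset.exists_min_image _ id hne'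
  simp only [Finset.mem_filter, Finset.mem_univ, true_and, id] at hi hmin
  have h1 : inner ℝ v d = v i * d i + ∑ j ∈ Finset.Ioi i, v j * d j := by
    rw [EuclideanSpace.real_inner_eq_sum, ← Finset.sum_insert (f := fun j => v j * d j)
      (Finset.notMem_Ioi_self (b := i)), Finset.Ioi_insert]
    refine (Finset.sum_subset (Finset.subset_univ _) fun j _ hj => ?_).symm
    have : d j = 0 := by
      by_contra h
      exact hj (by simpa using hmin j h)
    simp [this]
  have h2 : |∑ j ∈ Finset.Ioi i, v j * d j| ≤ ∑ j ∈ Finset.Ioi i, v j := by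
    refine (Finset.abs_sum_le_sum_abs _ _).trans (Finset.sum_le_sum fun j _ => ?_)
    have := hv.pos j
    rcases hd j with h | h | h <;> simp [h, abs_of_pos this, this.le]
  have h3 := hv.sum_Ioi_lt i
  rw [abs_le] at h2
  rw [h1]
  rcases hd i with h | h | h
  · rw [h]; intro h4; linarith
  · exact absurd h hi
  · rw [h]; intro h4; linarith

/-- If two partitions of a finite set are such that some nonzero vector has a vanishing sum over
every part, there is such a vector with entries `-1`, `0`, `1`. -/
theorem exists_signVector {O : Type*} [Fintype O] [DecidableEq O] (r : ℕ → Setoid O)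
    [∀ k, DecidableRel (r k)] (hr : ∀ k, r (k + 2) = r k) {e : O → ℝ} (he : e ≠ 0)
    (hsum : ∀ k x, ∑ y with r k y x, e y = 0) :
    ∃ d : O → ℝ, d ≠ 0 ∧ (∀ x, d x = -1 ∨ d x = 0 ∨ d x = 1) ∧
      ∀ k x, ∑ y with r k y x, d y = 0 := by
  have hr' : ∀ k n, r (k + 2 * n) = r k := by
    intro k n
    induction n with
    | zero => rfl
    | succ n ih => rw [← ih, ← hr (k + 2 * n)]; rfl
  -- An element of the support cannot be alone in its block, as the sum over the block vanishes. So
  -- one can walk in the support, changing element within a block of the two partitions alternately.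
  have hnext : ∀ (k : ℕ) (x : {x // e x ≠ 0}), ∃ y : {x // e x ≠ 0}, r k y.1 x.1 ∧ y ≠ x := by
    intro k x
    by_contra! h
    have h1 := hsum k x.1
    rw [Finset.sum_eq_single_of_mem x.1 (by simp)] at h1
    · exact x.2 h1
    · intro y hy hyx
      by_contra hy'
      simp only [Finset.mem_filter, Finset.mem_univ, true_and] at hy
      exact hyx (congrArg Subtype.val (h ⟨y, hy'⟩ hy))
  choose next hnext1 hnext2 using hnext
  obtain ⟨x₀, hx₀⟩ := Function.ne_iff.1 he
  let a : ℕ → {x // e x ≠ 0} := fun k => Nat.rec ⟨x₀, hx₀⟩ (fun k x => next k x) k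
  have ha1 : ∀ k, r k (a (k + 1)).1 (a k).1 := fun k => hnext1 k (a k)
  have ha2 : ∀ k, a (k + 1) ≠ a k := fun k => hnext2 k (a k)
  -- By finiteness the walk returns, after an even number of steps, to a block of the partition used
  -- next. A shortest return yields a simple cycle.
  have hex : ∃ n, 0 < n ∧ ∃ i, r i (a i).1 (a (i + 2 * n)).1 := by
    obtain ⟨k, l, hkl, h⟩ := Finite.exists_ne_map_eq_of_infinite fun k => a (2 * k)
    wlog hlt : k < l generalizing k l
    · exact this l k hkl.symm h.symm (by omega)
    obtain ⟨n, rfl⟩ := Nat.exists_eq_add_of_lt hlt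
    refine ⟨n + 1, by omega, 2 * k, ?_⟩
    have : 2 * k + 2 * (n + 1) = 2 * (k + n + 1) := by ring
    rw [this, ← h]
  classical
  obtain ⟨hn, i, hi⟩ := Nat.find_spec hex
  have hmin : ∀ n' < Nat.find hex, 0 < n' → ∀ i, ¬ r i (a i).1 (a (i + 2 * n')).1 :=
    fun n' h1 h2 i h3 => Nat.find_min hex h1 ⟨h2, i, h3⟩
  generalize Nat.find hex = n at hn hi hmin
  let b : ℕ → O := fun k => (a (i + 1 + k)).1
  -- A repetition at even distance, or at odd distance after dropping one step, would be a shorter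
  -- return; at distance one it is excluded because consecutive elements differ.
  have hb : ∀ k l, k < l → l < 2 * n → b k ≠ b l := by
    intro k l hkl hl h
    obtain ⟨n', hn' | hn'⟩ := Nat.even_or_odd' (l - k)
    · obtain rfl : l = k + 2 * n' := by omega
      refine hmin n' (by omega) (by omega) (i + 1 + k) ?_
      have : (a (i + 1 + k)).1 = (a (i + 1 + k + 2 * n')).1 := by
        rw [add_assoc (i + 1)]; exact h
      rw [← this]
    · obtain rfl : l = k + 2 * n' + 1 := by omega
      have h1 := ha1 (i + 1 + k + 2 * n')
      have h2 : (a (i + 1 + k)).1 = (a (i + 1 + k + 2 * n' + 1)).1 := by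
        rw [add_assoc (i + 1), add_assoc (i + 1)]; exact h
      rw [← h2, hr'] at h1
      rcases Nat.eq_zero_or_pos n' with rfl | h0
      · exact ha2 _ (Subtype.ext h2.symm)
      · exact hmin n' (by omega) h0 _ h1
  let d : O → ℝ := fun x => ∑ k ∈ Finset.range (2 * n), if b k = x then (-1) ^ k else 0
  have hd : ∀ k < 2 * n, d (b k) = (-1) ^ k := by
    intro k hk
    refine (Finset.sum_eq_single_of_mem k (by simpa using hk) fun l hl hlk => if_neg ?_).trans
      (if_pos rfl)
    rcases lt_or_gt_of_ne hlk with h | h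
    · exact hb l k h hk
    · exact (hb k l h (by simpa using hl)).symm
  refine ⟨d, fun h => ?_, fun x => ?_, fun k x => ?_⟩
  · have := hd 0 (by omega)
    simp [h] at this
  · by_cases hx : ∃ k < 2 * n, b k = x
    · obtain ⟨k, hk, rfl⟩ := hx
      rw [hd k hk]
      rcases neg_one_pow_eq_or ℝ k with h | h <;> simp [h]
    · push Not at hx
      exact .inr (.inl (Finset.sum_eq_zero fun k hk => if_neg (hx k (by simpa using hk))))
  · have h1 : ∑ y with r k y x, d y =
        ∑ j ∈ Finset.range n, ((if r k (b (2 * j)) x then (1 : ℝ) else 0) -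
          (if r k (b (2 * j + 1)) x then 1 else 0)) := by
      have h2 : ∑ y with r k y x, d y =
          ∑ j ∈ Finset.range (2 * n), if r k (b j) x then (-1 : ℝ) ^ j else 0 := by
        rw [Finset.sum_comm]
        refine Finset.sum_congr rfl fun j _ => ?_
        rw [Finset.sum_ite_eq]
        simp
      rw [h2]
      clear h2 hd d hb hmin hi hn
      induction n with
      | zero => simp
      | succ n ih =>
        rw [Finset.sum_range_succ, ← ih, mul_add, mul_one, Finset.sum_range_succ,
          Finset.sum_range_succ, pow_succ, pow_mul]
        split_ifs <;> simp
    have hstep : ∀ l, r k = r (i + 1 + l) →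
        (if r k (b l) x then (1 : ℝ) else 0) = if r k (b (l + 1)) x then 1 else 0 := by
      intro l hl
      have h2 : r k (b (l + 1)) (b l) := by
        rw [hl]
        exact ha1 _
      exact if_congr ⟨fun h => (r k).trans h2 h, fun h => (r k).trans ((r k).symm h2) h⟩ rfl rfl
    rw [h1]
    -- For the partition `r (i + 1)` the terms `2j` and `2j + 1` lie in one block and cancel. For `r
    -- i` it is the terms `2j + 1` and `2j + 2`, and the sum telescopes, the two ends agreeing
    -- because the cycle closes.
    have hk : r k = r (i + 1) ∨ r k = r i := by
      have hpar : ∀ k, r k = r (k % 2) := fun k => by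
        conv_lhs => rw [← Nat.mod_add_div k 2]
        exact hr' _ _
      rw [hpar k, hpar (i + 1), hpar i]
      rcases Nat.mod_two_eq_zero_or_one k with h | h <;>
        rcases Nat.mod_two_eq_zero_or_one i with h' | h' <;> simp [h, h', Nat.add_mod]
    rcases hk with hk | hk
    · refine Finset.sum_eq_zero fun j _ => sub_eq_zero.2 (hstep _ ?_)
      rw [hk, hr']
    · have h2 : ∀ j, (if r k (b (2 * j + 1)) x then (1 : ℝ) else 0) =
          if r k (b (2 * (j + 1))) x then 1 else 0 := fun j => by
        refine hstep (2 * j + 1) ?_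
        rw [hk, show i + 1 + (2 * j + 1) = i + 2 * (j + 1) by ring, hr']
      simp only [h2]
      rw [Finset.sum_range_sub' (fun j => if r k (b (2 * j)) x then (1 : ℝ) else 0), sub_eq_zero]
      have h3 : r k (b 0) (b (2 * n)) := by
        have h4 := ha1 (i + 2 * n)
        rw [hr'] at h4
        rw [hk]
        refine (r i).trans ((r i).trans (ha1 i) hi) ((r i).symm ?_)
        have : i + 1 + 2 * n = i + 2 * n + 1 := by ring
        simpa only [b, this] using h4
      exact if_congr ⟨fun h => (r k).trans ((r k).symm h3) h, fun h => (r k).trans h3 h⟩ rfl rfl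

/-- If the sums of `d` over the members of a lattice of sets vanish, so do its sums over the classes
of elements that belong to the same members of the lattice. -/
theorem sum_class_eq_zero {O : Type*} [Fintype O] [DecidableEq O] {L : Set (Finset O)}
    (hbot : ∅ ∈ L) (htop : Finset.univ ∈ L) (hsup : ∀ S ∈ L, ∀ T ∈ L, S ∪ T ∈ L)
    (hinf : ∀ S ∈ L, ∀ T ∈ L, S ∩ T ∈ L) {d : O → ℝ} (hd : ∀ S ∈ L, ∑ o ∈ S, d o = 0)
    (R : Setoid O) [DecidableRel R] (hR : ∀ x y, R x y ↔ ∀ S ∈ L, x ∈ S ↔ y ∈ S) (x : O) :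
    ∑ y with R y x, d y = 0 := by
  classical
  -- `D` is the smallest member containing `x`, and `U` below is the largest member inside `D` that
  -- avoids `x`. The class of `x` is their difference.
  let D : Finset O := (Finset.univ.filter fun S => S ∈ L ∧ x ∈ S).inf id
  have hD : D ∈ L := Finset.inf_mem L htop hinf _ _ fun S hS => (Finset.mem_filter.1 hS).2.1
  have hD' : ∀ S ∈ L, x ∈ S → D ⊆ S := fun S hS hx =>
    Finset.inf_le (f := id) (by simpa using ⟨hS, hx⟩)
  have hxD : x ∈ D := by simp [D, Finset.mem_inf]
  let U : Finset O := (Finset.univ.filter fun S => S ∈ L ∧ S ⊆ D ∧ x ∉ S).sup id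
  have hU : U ∈ L := Finset.sup_mem L hbot hsup _ _ fun S hS => (Finset.mem_filter.1 hS).2.1
  have hU' : ∀ S ∈ L, S ⊆ D → x ∉ S → S ⊆ U := fun S hS h1 h2 =>
    Finset.le_sup (f := id) (by simpa using ⟨hS, h1, h2⟩)
  have hUD : U ⊆ D := Finset.sup_le fun S hS => (Finset.mem_filter.1 hS).2.2.1
  have hxU : x ∉ U := by simp only [U, Finset.mem_sup]; simp
  have : (Finset.univ.filter fun y => R y x) = D \ U := by
    ext y
    simp only [Finset.mem_filter, Finset.mem_univ, true_and, Finset.mem_sdiff, hR]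
    constructor
    · exact fun h => ⟨(h D hD).2 hxD, fun hy => hxU ((h U hU).1 hy)⟩
    · rintro ⟨h1, h2⟩ S hS
      refine ⟨fun hy => ?_, fun hx => hD' S hS hx h1⟩
      by_contra hx
      exact h2 (hU' (S ∩ D) (hinf S hS D hD) Finset.inter_subset_right (by simp [hx])
        (by simp [hy, h1]))
  rw [this, Finset.sum_sdiff_eq_sub hUD, hd D hD, hd U hU, sub_zero]

theorem sum_eq_zero_of_sum_class {O : Type*} [Fintype O] [DecidableEq O] {d : O → ℝ}
    {S : Finset O} (R : Setoid O) [DecidableRel R] (hR : ∀ x y, R x y → x ∈ S → y ∈ S)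
    (h : ∀ x, ∑ y with R y x, d y = 0) : ∑ o ∈ S, d o = 0 := by
  refine Finset.sum_cancels_of_partition_cancels R fun x hx => ?_
  rw [← h x]
  refine Finset.sum_congr ?_ fun _ _ => rfl
  ext y
  simp only [Finset.mem_filter, Finset.mem_univ, true_and, and_iff_right_iff_imp]
  exact fun hy => hR x y (R.symm hy) hx

/-! ### The orientation of the Forcey–Loday realization -/

section Orientation

open Filter Topology

variable {m : ℕ} {ω : Fin (m + 1) → ℝ} {x y d v : EuclideanSpace ℝ (Fin m)}

theorem extendedCoords_add (o : Option (Fin m)) :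
    extendedCoords (x + y) o = extendedCoords x o + extendedCoords y o := by
  cases o <;> simp [extendedCoords, Finset.sum_add_distrib, add_comm]

theorem extendedCoords_smul (c : ℝ) (o : Option (Fin m)) :
    extendedCoords (c • x) o = c * extendedCoords x o := by
  cases o <;> simp [extendedCoords, Finset.mul_sum]

/-- The facets of the Forcey–Loday realization that contain `x`. -/
def tightSets (ω : Fin (m + 1) → ℝ) (x : EuclideanSpace ℝ (Fin m)) :
    Set (Finset (Option (Fin m))) :=
  {S | ∑ o ∈ S, extendedCoords x o = minValue ω (indicatorVector S)}

/-- Two coordinates are equivalent if they belong to the same tight sets. -/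
def tightSetoid (ω : Fin (m + 1) → ℝ) (x : EuclideanSpace ℝ (Fin m)) : Setoid (Option (Fin m)) where
  r i j := ∀ S ∈ tightSets ω x, i ∈ S ↔ j ∈ S
  iseqv := ⟨fun _ _ _ => .rfl, fun h S hS => (h S hS).symm,
    fun h h' S hS => (h S hS).trans (h' S hS)⟩

theorem empty_mem_tightSets (hω : ∀ i, 0 < ω i) : ∅ ∈ tightSets ω x := by
  have : indicatorVector (∅ : Finset (Option (Fin m))) = 0 := by ext; simp [indicatorVector]
  simp [tightSets, this, minValue_zero hω]

theorem univ_mem_tightSets (hω : ∀ i, 0 < ω i) : Finset.univ ∈ tightSets ω x := by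
  have : indicatorVector (Finset.univ : Finset (Option (Fin m))) = 0 := by
    ext; simp [indicatorVector]
  simp [tightSets, ← inner_indicatorVector, this, minValue_zero hω]

/-- Uncrossing: by supermodularity the two inequalities for the union and the intersection have no
slack in total when `S` and `T` are tight. -/
theorem union_inter_mem_tightSets (hω : ∀ i, 0 < ω i) (hx : x ∈ forceyLoday ω)
    {S T : Finset (Option (Fin m))} (hS : S ∈ tightSets ω x) (hT : T ∈ tightSets ω x) :
    S ∪ T ∈ tightSets ω x ∧ S ∩ T ∈ tightSets ω x := by
  rw [mem_forceyLoday_iff hω] at hx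
  simp only [tightSets, Set.mem_ofPred_eq] at *
  have h1 := hx (S ∪ T)
  have h2 := hx (S ∩ T)
  have h3 := minValue_supermodular hω S T
  have h4 := Finset.sum_union_inter (s₁ := S) (s₂ := T) (f := extendedCoords x)
  constructor <;> linarith

open Classical in
theorem sum_tightSetoid_iff (hω : ∀ i, 0 < ω i) (hx : x ∈ forceyLoday ω)
    {d : Option (Fin m) → ℝ} : (∀ i, ∑ j with tightSetoid ω x j i, d j = 0) ↔
      ∀ S ∈ tightSets ω x, ∑ o ∈ S, d o = 0 :=
  ⟨fun h S hS => sum_eq_zero_of_sum_class (tightSetoid ω x) (fun _ _ hR => (hR S hS).1) h,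
    fun h => sum_class_eq_zero (empty_mem_tightSets hω) (univ_mem_tightSets hω)
      (fun _ hS _ hT => (union_inter_mem_tightSets hω hx hS hT).1)
      (fun _ hS _ hT => (union_inter_mem_tightSets hω hx hS hT).2) h _ fun _ _ => Iff.rfl⟩

/-- The tight inequalities are unchanged along `d`, and the finitely many others are strict, hence
persist for small `δ` of either sign. -/
theorem eventually_add_smul_mem (hω : ∀ i, 0 < ω i) (hx : x ∈ forceyLoday ω)
    (hd : ∀ S ∈ tightSets ω x, ∑ o ∈ S, extendedCoords d o = 0) :
    ∀ᶠ δ : ℝ in 𝓝 0, x + δ • d ∈ forceyLoday ω := by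
  simp only [mem_forceyLoday_iff hω, eventually_all]
  intro S
  have hS := (mem_forceyLoday_iff hω).1 hx S
  simp only [extendedCoords_add, extendedCoords_smul, Finset.sum_add_distrib, ← Finset.mul_sum]
  rcases hS.eq_or_lt with h | h
  · rw [hd S h.symm]
    simp [hS]
  · have : ContinuousAt (fun δ : ℝ => ∑ o ∈ S, extendedCoords x o +
        δ * ∑ o ∈ S, extendedCoords d o) 0 := by fun_prop
    exact (this.eventually (lt_mem_nhds (by simpa using h))).mono fun _ h => h.le

/-- An inequality that is tight at the midpoint is tight at both ends. -/
theorem sum_extendedCoords_sub_eq_zero (hω : ∀ i, 0 < ω i) (hx : x ∈ forceyLoday ω)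
    (hy : y ∈ forceyLoday ω) {S : Finset (Option (Fin m))}
    (hS : S ∈ tightSets ω ((1 / 2 : ℝ) • (x + y))) : ∑ o ∈ S, extendedCoords (y - x) o = 0 := by
  have h1 := (mem_forceyLoday_iff hω).1 hx S
  have h2 := (mem_forceyLoday_iff hω).1 hy S
  have h3 : y - x = y + (-1 : ℝ) • x := by simp [sub_eq_add_neg]
  simp only [tightSets, Set.mem_ofPred_eq, h3, extendedCoords_add, extendedCoords_smul,
    Finset.sum_add_distrib, ← Finset.mul_sum] at *
  linarith

/-- A direction in which both members of a pair of points of the Forcey–Loday realization can be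
moved in common may be replaced by one whose coordinates are `-1`, `0` or `1`. -/
theorem exists_sign_direction (hω : ∀ i, 0 < ω i) {p q e : EuclideanSpace ℝ (Fin m)}
    (hp : p ∈ forceyLoday ω) (hq : q ∈ forceyLoday ω) (he : e ≠ 0)
    (hep : ∀ S ∈ tightSets ω p, ∑ o ∈ S, extendedCoords e o = 0)
    (heq : ∀ S ∈ tightSets ω q, ∑ o ∈ S, extendedCoords e o = 0) :
    ∃ d : EuclideanSpace ℝ (Fin m), d ≠ 0 ∧ (∀ i, d i = -1 ∨ d i = 0 ∨ d i = 1) ∧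
      (∀ S ∈ tightSets ω p, ∑ o ∈ S, extendedCoords d o = 0) ∧
      ∀ S ∈ tightSets ω q, ∑ o ∈ S, extendedCoords d o = 0 := by
  classical
  let r : ℕ → Setoid (Option (Fin m)) := fun k =>
    if Even k then tightSetoid ω p else tightSetoid ω q
  have he' : extendedCoords e ≠ 0 := fun h => he (by ext i; exact congrFun h (some i))
  have hcongr : ∀ {R R' : Setoid (Option (Fin m))}, R = R' → ∀ (f : Option (Fin m) → ℝ) i,
      ∑ j with R j i, f j = ∑ j with R' j i, f j := by
    rintro R _ rfl f i
    rfl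
  obtain ⟨d, hd, hd', hsum⟩ := exists_signVector r
    (fun k => by simp [r, Nat.even_add]) he' fun k i => by
      by_cases hk : Even k
      · exact (hcongr (if_pos hk) _ i).trans ((sum_tightSetoid_iff hω hp).2 hep i)
      · exact (hcongr (if_neg hk) _ i).trans ((sum_tightSetoid_iff hω hq).2 heq i)
  have hp' := (sum_tightSetoid_iff hω hp (d := d)).1 fun i =>
    (hcongr (by simp [r]) d i).trans (hsum 0 i)
  have hq' := (sum_tightSetoid_iff hω hq (d := d)).1 fun i =>
    (hcongr (by simp [r]) d i).trans (hsum 1 i)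
  -- The whole set is tight, so `d` has total sum zero and its entry at `none` is the opposite of
  -- the sum of the others.
  have hdd : extendedCoords (WithLp.toLp 2 fun i => d (some i)) = d := by
    have := hp' _ (univ_mem_tightSets hω)
    rw [Fintype.sum_option] at this
    funext o
    cases o
    · simp only [extendedCoords, Option.elim]
      linarith
    · rfl
  refine ⟨WithLp.toLp 2 fun i => d (some i), fun h => ?_, fun i => hd' _, ?_, ?_⟩
  · rw [h] at hdd
    refine hd (hdd.symm.trans ?_)
    funext o
    cases o <;> simp [extendedCoords]
  · rwa [hdd]
  · rwa [hdd]

theorem mem_reflection_iff {z : EuclideanSpace ℝ (Fin m)} {P : Set (EuclideanSpace ℝ (Fin m))} :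
    x ∈ reflection z P ↔ (2 : ℝ) • z - x ∈ P :=
  ⟨fun ⟨y, hy, h⟩ => by rwa [← h, sub_sub_cancel], fun h => ⟨_, h, sub_sub_cancel _ _⟩⟩

/-- At the midpoint `p` of an edge of the intersection and at its reflection `q`, the edge direction
preserves all tight equalities, so a sign vector `d` does as well. Small moves of `p` along `±d`
stay in the intersection, hence in the edge, and `d` is parallel to it. -/
theorem positivelyOriented_forceyLoday (hω : ∀ i, 0 < ω i) (hv : IsGoodOrientationVector v) :
    PositivelyOriented (forceyLoday ω) v := by
  rintro z - x y ⟨hxy, hedge⟩ hperp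
  have hx := hedge.subset (left_mem_segment ℝ x y)
  have hy := hedge.subset (right_mem_segment ℝ x y)
  rw [Set.mem_inter_iff, mem_reflection_iff] at hx hy
  let p := (1 / 2 : ℝ) • (x + y)
  let q := (1 / 2 : ℝ) • (((2 : ℝ) • z - y) + ((2 : ℝ) • z - x))
  have hpq : ∀ w, (2 : ℝ) • z - (p + w) = q - w := fun w => by
    simp only [p, q]
    module
  have hmid : ∀ a ∈ forceyLoday ω, ∀ b ∈ forceyLoday ω, (1 / 2 : ℝ) • (a + b) ∈ forceyLoday ω :=
    fun a ha b hb => by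
      rw [smul_add]
      exact convex_convexHull ℝ _ ha hb (by norm_num) (by norm_num) (by norm_num)
  have hp : p ∈ forceyLoday ω := hmid _ hx.1 _ hy.1
  have hq : q ∈ forceyLoday ω := hmid _ hy.2 _ hx.2
  obtain ⟨d, hd0, hd, hdp, hdq⟩ := exists_sign_direction hω hp hq (sub_ne_zero.2 hxy.symm)
    (fun S hS => sum_extendedCoords_sub_eq_zero hω hx.1 hy.1 hS) fun S hS => by
      have := sum_extendedCoords_sub_eq_zero hω hy.2 hx.2 hS
      rwa [sub_sub_sub_cancel_left] at this
  have hneg : Tendsto (fun δ : ℝ => -δ) (𝓝 0) (𝓝 0) := by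
    simpa using (continuous_neg (G := ℝ)).tendsto 0
  have hp' := eventually_add_smul_mem hω hp hdp
  have hq' := eventually_add_smul_mem hω hq hdq
  obtain ⟨δ, ⟨⟨h1, h2⟩, h3, h4⟩, hδ⟩ :=
    (((hp'.and (hneg.eventually hp')).and (hq'.and (hneg.eventually hq'))).filter_mono
      nhdsWithin_le_nhds |>.and (self_mem_nhdsWithin (s := Set.Ioi (0 : ℝ)))).exists
  have hδ : δ ≠ 0 := (Set.mem_Ioi.1 hδ).ne'
  have hmem : ∀ δ : ℝ, p + δ • d ∈ forceyLoday ω → q + -δ • d ∈ forceyLoday ω →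
      p + δ • d ∈ forceyLoday ω ∩ reflection z (forceyLoday ω) := by
    intro δ h h'
    refine ⟨h, mem_reflection_iff.2 ?_⟩
    rwa [hpq, sub_eq_add_neg, ← neg_smul]
  -- `p` is the midpoint of `p + δ d` and `p - δ d`, and an exposed face is extreme.
  have h5 : p + δ • d ∈ segment ℝ x y := by
    refine hedge.isExtreme.left_mem_of_mem_openSegment (hmem δ h1 h4)
      (hmem (-δ) h2 (by rwa [neg_neg])) (z := p) ?_ ?_
    · exact ⟨1 / 2, 1 / 2, by norm_num, by norm_num, by norm_num, by simp only [p]; module⟩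
    · exact ⟨1 / 2, 1 / 2, by norm_num, by norm_num, by norm_num, by module⟩
  rw [segment_eq_image'] at h5
  obtain ⟨θ, -, h5⟩ := h5
  have h6 : δ • d = (θ - 1 / 2) • (y - x) := by
    have : δ • d = (x + θ • (y - x)) - p := eq_sub_of_add_eq' h5.symm
    rw [this]
    simp only [p]
    module
  have h7 := congrArg (inner ℝ v) h6
  rw [inner_smul_right, inner_smul_right, hperp, mul_zero] at h7
  exact (mul_ne_zero hδ (hv.inner_ne_zero hd hd0)) h7

end Orientation

theorem mainTheorem12 (m : ℕ) (ω : Fin (m + 1) → ℝ) (hω : ∀ i, 0 < ω i)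
    (v : EuclideanSpace ℝ (Fin m)) (hv : IsGoodOrientationVector v) :
    IsWellOrientedRealization (forceyLoday ω) v (forceyLodayPoint ω) :=
  ⟨isPolytope_forceyLoday, finrank_vectorSpan_forceyLoday hω, exists_faceLattice_iso hω,
    positivelyOriented_forceyLoday hω hv, fun _ _ => le_iff_vertexOrder hω hv⟩
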